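/- **Setting.** Let $A$ be a ring (associative, unital) and $C$ an $A$-coring with comultiplication $\Delta(c)=c_{(1)}\otimes_A c_{(2)}$ and counit $\varepsilon$. Write $\mathcal M^C$ and ${}^C\mathcal M$ for the categories of right and left $C$-comodules, $F:\mathcal M^C\to\mathcal M_A$ and $F':{}^C\mathcal M\to{}_A\mathcal M$ for the forgetful functors, $G=-\otimes_A C$ and $G'=C\otimes_A-$ for their right adjoints. Let $\mathcal M^C_{\rm fgp}$ and ${}^C_{\rm fgp}\mathcal M$ be the classes of comodules that are finitely generated and projective as $A$-modules. Assume that $\mathcal M^C_{\rm fgp}$ generates $\mathcal M^C$ and that ${}^C_{\rm fgp}\mathcal M$ generates ${}^C\mathcal M$ (every pair of distinct parallel morphisms $X\rightrightarrows Y$ is separated by a morphism $M\to X$ with $M$ in the class). A module $M$ is *locally projective* if for every finitely generated submodule $P\subseteq M$, every surjection $p:N'\to N$ and every $g:M\to N$ there is $h:M\to N'$ with $p\circ h=g$ on $P$. $C^*={\rm Hom}_A(C,A)$ (right linear maps) is a ring by $(f*g)(c)=f(g(c_{(1)})c_{(2)})$, and ${}^*C={}_A{\rm Hom}(C,A)$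 is a ring by $(f*g)(c)=g(c_{(1)}f(c_{(2)}))$, both with unit $\varepsilon$. $C^*$ is a $C^*$-$A$-bimodule with $(fa)(c)=f(ac)$, and ${}^*C$ is an $A$-${}^*C$-bimodule with $(af)(c)=f(ca)$. $C^*$ acts on left comodules by $f\cdot m=f(m_{[-1]})m_{[0]}$, ${}^*C$ acts on right comodules by $m\cdot f=m_{[0]}f(m_{[1]})$; in particular $C$ is a $C^*$-$A$-bimodule and an $A$-${}^*C$-bimodule. For a set $I$, $X^{(I)}$ denotes a direct sum and $X^I$ a product of $I$ copies of $X$; $S$ is the functor $N\mapsto N^{(I)}$ on $\mathcal M_A$, and $S'$ the one on ${}_A\mathcal M$. $(C^A)^{(I)}$ is the set of families $(z_i)\in C^{(I)}$ with $az_i=z_ia$ for all $a\in A$, $i\in I$. *Locally quasi-Frobenius corings.* $C$ is *left locally quasi-Frobenius with index set $I$* if $C$ is locally projective as a left $A$-module and there is an $A$-${}^*C$-bilinear map $j=(j_i):C\to({}^*C)^I$ such that for all $c_1,\dots,c_n\in C$ and every $A$-bimodule map $f:C\to A$ there is $(z_i)\in(C^A)^{(I)}$ with $\sum_i j_i(c_k)(z_i)=f(c_k)$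 for all $k$. It is *right locally quasi-Frobenius with index set $I$* if $C$ is locally projective as a right $A$-module and the same holds with a $C^*$-$A$-bilinear $j:C\to(C^*)^I$. It is left (right) locally quasi-Frobenius if it is so with some index set. *Locally quasi-adjoint functors.* Let $\Phi:\mathcal X\to\mathcal Y$, $\Gamma:\mathcal Y\to\mathcal X$ be functors and $\mathcal E$ a class of objects of $\mathcal X$. $\Gamma$ is an *$\mathcal E$-locally left adjoint* for $\Phi$ if there is $\epsilon:\Gamma\Phi\to 1_{\mathcal X}$ such that for each $f:E\to\Gamma D$ with $E\in\mathcal E$, $D\in\mathcal Y$ there is $\eta:1_{\mathcal Y}\to\Phi\Gamma$ with $\epsilon_{\Gamma D}\circ\Gamma\eta_D\circ f=f$. $\Phi$ is an *$\mathcal E$-locally right adjoint* for $\Gamma$ if there is $\epsilon:\Gamma\Phi\to 1_{\mathcal X}$ such that for each $f:\Phi E\to\Phi X$ with $E\in\mathcal E$, $X\in\mathcal X$ there is $\eta:1_{\mathcal Y}\to\Phi\Gamma$ with $\Phi\epsilon_X\circ\eta_{\Phi X}\circ f=f$. For a fixed index set $I$ and $\Sigma(D)=D^{(I)}$ on $\mathcal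 Y$, $\Gamma$ is a *left $\mathcal E$-locally quasi-adjoint* for $\Phi$ if it is an $\mathcal E$-locally left adjoint for $\Sigma\Phi$; $\Phi$ is a *right $\mathcal E$-locally quasi-adjoint* for $\Gamma$ if it is an $\mathcal E$-locally right adjoint for $\Gamma\Sigma$. $(\Phi,\Gamma)$ is an *$\mathcal E$-locally quasi-Frobenius pair* (with index set $I$) if $\Phi$ is left adjoint to $\Gamma$ and both of these hold. **Theorem.** **(i)** Suppose that $C$ is locally projective as a left $A$-module. For every set $I$ the following are equivalent: * (a) $C$ is left locally quasi-Frobenius with index set $I$; * (d) there is a natural transformation $J':G'S'F'\to 1_{{}^C\mathcal M}$ such that for every $f:F'M\to F'M'$ with $M\in{}^C_{\rm fgp}\mathcal M$, $M'\in{}^C\mathcal M$ there is $\beta:1_{{}_A\mathcal M}\to F'G'S'$ with $F'J'_{M'}\circ\beta_{F'M'}\circ f=f$; * (e) $F'$ is a right ${}^C_{\rm fgp}\mathcal M$-locally quasi-adjoint for $G'$ (with index set $I$); * (f) there is a natural transformation $J:GSF\to 1_{\mathcal M^C}$ such that for every $f:M\to GN$ with $M\in\mathcal M^C_{\rm fgp}$,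 $N\in\mathcal M_A$ there is $\beta:1_{\mathcal M_A}\to SFG$ with $J_{GN}\circ G\beta_N\circ f=f$; * (g) $G$ is a left $\mathcal M^C_{\rm fgp}$-locally quasi-adjoint for $F$ (with index set $I$). These conditions imply that $C$ is also locally projective as a right $A$-module. If $C$ is locally projective as a right $A$-module as well, then they are moreover equivalent to each of the following: * (b) there is a $C^*$-$A$-bilinear map $\tilde\jmath:C^{(I)}\to C^*$ such that for every $M\in{}^C_{\rm fgp}\mathcal M$ there is a $C^*$-$A$-bilinear $\psi:C^*\to C^{(I)}$ for which $e=\tilde\jmath(\psi(\varepsilon))$ satisfies $e\cdot m=m$ for all $m\in M$; * (c) there is a $C^*$-$A$-bilinear map $\tilde\jmath:C^{(I)}\to C^*$ such that for every finite subset $\{c_1,\dots,c_n\}$ of $C$ there is a $C^*$-$A$-bilinear $\psi:C^*\to C^{(I)}$ for which $e=\tilde\jmath(\psi(\varepsilon))$ satisfies $e\cdot c_k=c_k$ for all $k$; * (h) for the contravariant functors $\mathcal K^s={}_{C^*}{\rm Hom}_A(-,C^{(I)})$ and $\mathcal J={}_{C^*}{\rm Hom}_A(-,C^*)$ from $C^*$-$A$-bimodules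 to abelian groups, there is a natural transformation $\alpha:\mathcal K^s\to\mathcal J$ such that for every finite subset $\{c_1,\dots,c_n\}$ of $C$ there is a natural $\beta:\mathcal J\to\mathcal K^s$ for which $e=\big((\alpha\circ\beta)_{C^*}({\rm id})\big)(\varepsilon)$ satisfies $e\cdot c_k=c_k$ for all $k$; * (j) for the covariant functors $\widetilde{\mathcal K}^s={}_{C^*}{\rm Hom}_A(C^{(I)},-)$ and $\widetilde{\mathcal J}={}_{C^*}{\rm Hom}_A(C^*,-)$ from $C^*$-$A$-bimodules to abelian groups, there is a natural transformation $\alpha:\widetilde{\mathcal J}\to\widetilde{\mathcal K}^s$ such that for every finite subset $\{c_1,\dots,c_n\}$ of $C$ there is a natural $\beta:\widetilde{\mathcal K}^s\to\widetilde{\mathcal J}$ for which $e=\big((\beta\circ\alpha)_{C^*}({\rm id})\big)(\varepsilon)$ satisfies $e\cdot c_k=c_k$ for all $k$. **(ii)** The left-right dual of (i) holds. Suppose that $C$ is locally projective as a right $A$-module. Then for every set $I$, the following are equivalent: $C$ is right locally quasi-Frobenius with index set $I$; $F$ is a right $\mathcal M^C_{\rm fgp}$-locally quasi-adjoint for $G$;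 $G'$ is a left ${}^C_{\rm fgp}\mathcal M$-locally quasi-adjoint for $F'$; the dual of (d) (for $F,G,S$ and $\mathcal M^C_{\rm fgp}$); the dual of (f) (for $F',G',S'$ and ${}^C_{\rm fgp}\mathcal M$). These conditions imply that $C$ is locally projective as a left $A$-module; if $C$ is locally projective as a left $A$-module as well, they are also equivalent to the duals of (b), (c), (h), (j), in which $A$-${}^*C$-bilinear maps, ${}^*C$, its right action on right comodules, and $\mathcal M^C_{\rm fgp}$ replace $C^*$-$A$-bilinear maps, $C^*$, its left action on left comodules, and ${}^C_{\rm fgp}\mathcal M$. **(iii)** Suppose that $C$ is locally projective as a left $A$-module. For every set $I$ the following are equivalent: $C$ is left and right locally quasi-Frobenius with index set $I$; $(F,G)$ is an $\mathcal M^C_{\rm fgp}$-locally quasi-Frobenius pair with index set $I$; $(F',G')$ is a ${}^C_{\rm fgp}\mathcal M$-locally quasi-Frobenius pair with index set $I$. Consequently the following are equivalent: $C$ is left and right locally quasi-Frobenius; $(F,G)$ is an $\mathcal M^C_{\rm fgp}$-locally quasi-Frobenius pair with some index set; $(F',G')$ is a ${}^C_{\rm fgp}\mathcal M$-locally quasi-Frobenius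 pair with some index set. -/

import Mathlib

open CategoryTheory

universe u

namespace LQF

/-! ### The tensor product over a noncommutative ring -/

section BalancedTensor

variable (A : Type u) [Ring A]

/-- The relations `m a ⊗ n = m ⊗ a n`, for a right `A`-module `M` (a module over `Aᵐᵒᵖ`) and a
left `A`-module `N`. -/
def BT.rel (M N : Type u) [AddCommGroup M] [Module Aᵐᵒᵖ M] [AddCommGroup N] [Module A N] :
    AddSubgroup (TensorProduct ℤ M N) :=
  AddSubgroup.closure {x | ∃ (m : M) (a : A) (n : N),
    x = TensorProduct.tmul ℤ (MulOpposite.op a • m) n - TensorProduct.tmul ℤ m (a • n)}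

/-- The tensor product `M ⊗_A N` of a right and a left module over a (noncommutative) ring. -/
def BT (M N : Type u) [AddCommGroup M] [Module Aᵐᵒᵖ M] [AddCommGroup N] [Module A N] : Type u :=
  TensorProduct ℤ M N ⧸ BT.rel A M N

namespace BT

section Basic

variable {M M' N N' P : Type u} [AddCommGroup M] [Module Aᵐᵒᵖ M] [AddCommGroup M'] [Module Aᵐᵒᵖ M']
  [AddCommGroup N] [Module A N] [AddCommGroup N'] [Module A N'] [AddCommGroup P]

instance : AddCommGroup (BT A M N) :=
  inferInstanceAs (AddCommGroup (TensorProduct ℤ M N ⧸ BT.rel A M N))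

/-- The pure tensor `m ⊗_A n`. -/
def tmul (m : M) (n : N) : BT A M N :=
  QuotientAddGroup.mk' (BT.rel A M N) (TensorProduct.tmul ℤ m n)

variable {A}

theorem add_tmul (m m' : M) (n : N) : tmul A (m + m') n = tmul A m n + tmul A m' n := by
  simp only [tmul, TensorProduct.add_tmul, map_add]
  rfl

theorem tmul_add (m : M) (n n' : N) : tmul A m (n + n') = tmul A m n + tmul A m n' := by
  simp only [tmul, TensorProduct.tmul_add, map_add]
  rfl

theorem smul_tmul (m : M) (a : A) (n : N) :
    tmul A (MulOpposite.op a • m) n = tmul A m (a • n) :=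
  QuotientAddGroup.eq_iff_sub_mem.2 (AddSubgroup.subset_closure ⟨m, a, n, rfl⟩)

@[elab_as_elim]
theorem induction {p : BT A M N → Prop} (x : BT A M N) (h0 : p 0)
    (ht : ∀ m n, p (tmul A m n)) (ha : ∀ x y, p x → p y → p (x + y)) : p x := by
  obtain ⟨x, rfl⟩ := QuotientAddGroup.mk'_surjective (BT.rel A M N) x
  induction x using TensorProduct.induction_on with
  | zero => rw [map_zero]; exact h0
  | tmul m n => exact ht m n
  | add x y hx hy => rw [map_add]; exact ha _ _ hx hy

theorem hom_ext {f g : BT A M N →+ P} (h : ∀ m n, f (tmul A m n) = g (tmul A m n)) : f = g := by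
  ext x
  induction x using BT.induction with
  | h0 => simp
  | ht m n => exact h m n
  | ha x y hx hy => rw [map_add, map_add, hx, hy]

/-- The additive map out of `M ⊗_A N` given by a biadditive `A`-balanced map. -/
def lift (f : M → N → P) (hl : ∀ m m' n, f (m + m') n = f m n + f m' n)
    (hr : ∀ m n n', f m (n + n') = f m n + f m n')
    (hb : ∀ (m : M) (a : A) (n : N), f (MulOpposite.op a • m) n = f m (a • n)) : BT A M N →+ P :=
  QuotientAddGroup.lift (BT.rel A M N)
    (TensorProduct.liftAddHom
      (AddMonoidHom.mk' (fun m => AddMonoidHom.mk' (f m) (hr m))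
        (fun m m' => AddMonoidHom.ext (hl m m'))) (fun r m n => by
          rw [map_zsmul, map_zsmul]; rfl)) <| by
    rw [rel, AddSubgroup.closure_le]
    rintro _ ⟨m, a, n, rfl⟩
    simp [AddMonoidHom.mem_ker, hb]

@[simp] theorem lift_tmul (f : M → N → P) (hl : ∀ m m' n, f (m + m') n = f m n + f m' n)
    (hr : ∀ m n n', f m (n + n') = f m n + f m n')
    (hb : ∀ (m : M) (a : A) (n : N), f (MulOpposite.op a • m) n = f m (a • n)) (m : M) (n : N) :
    lift f hl hr hb (tmul A m n) = f m n := rfl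

/-- `m ⊗ -` as an additive map. -/
def mkL (m : M) : N →+ BT A M N := AddMonoidHom.mk' (fun n => tmul A m n) (tmul_add m)

/-- `- ⊗ n` as an additive map. -/
def mkR (n : N) : M →+ BT A M N := AddMonoidHom.mk' (fun m => tmul A m n) (fun m m' => add_tmul m m' n)

@[simp] theorem tmul_zero (m : M) : (tmul A m (0 : N)) = 0 := map_zero (mkL (A := A) m)

@[simp] theorem zero_tmul (n : N) : (tmul A (0 : M) n) = 0 := map_zero (mkR (A := A) n)

/-- The map `f ⊗_A g`. -/
def map (f : M →ₗ[Aᵐᵒᵖ] M') (g : N →ₗ[A] N') : BT A M N →+ BT A M' N' :=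
  lift (fun m n => tmul A (f m) (g n)) (fun m m' n => by rw [map_add, add_tmul])
    (fun m n n' => by rw [map_add, tmul_add]) (fun m a n => by rw [map_smul, map_smul, smul_tmul])

@[simp] theorem map_tmul (f : M →ₗ[Aᵐᵒᵖ] M') (g : N →ₗ[A] N') (m : M) (n : N) :
    map f g (tmul A m n) = tmul A (f m) (g n) := rfl

/-- The contraction `m ⊗ n ↦ f(m) n`. -/
def contrL (f : M →ₗ[Aᵐᵒᵖ] A) : BT A M N →+ N :=
  lift (fun m n => f m • n) (fun m m' n => by rw [map_add, add_smul])
    (fun m n n' => by rw [smul_add]) (fun m a n => by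
      rw [map_smul, MulOpposite.smul_eq_mul_unop, MulOpposite.unop_op, mul_smul])

@[simp] theorem contrL_tmul (f : M →ₗ[Aᵐᵒᵖ] A) (m : M) (n : N) :
    contrL f (tmul A m n) = f m • n := rfl

/-- The contraction `m ⊗ n ↦ m g(n)`. -/
def contrR (g : N →ₗ[A] A) : BT A M N →+ M :=
  lift (fun m n => MulOpposite.op (g n) • m) (fun m m' n => by rw [smul_add])
    (fun m n n' => by rw [map_add, MulOpposite.op_add, add_smul]) (fun m a n => by
      rw [map_smul, smul_eq_mul, MulOpposite.op_mul, mul_smul])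

@[simp] theorem contrR_tmul (g : N →ₗ[A] A) (m : M) (n : N) :
    contrR g (tmul A m n) = MulOpposite.op (g n) • m := rfl

theorem contrL_add (f g : M →ₗ[Aᵐᵒᵖ] A) (x : BT A M N) :
    contrL (f + g) x = contrL f x + contrL g x :=
  DFunLike.congr_fun (f := contrL (f + g)) (g := contrL f + contrL g)
    (hom_ext fun m n => by simp [add_smul]) x

theorem contrR_add (f g : N →ₗ[A] A) (x : BT A M N) :
    contrR (f + g) x = contrR f x + contrR g x :=
  DFunLike.congr_fun (f := contrR (f + g)) (g := contrR f + contrR g)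
    (hom_ext fun m n => by simp [add_smul]) x

end Basic

section Right

variable {A}
variable {M N : Type u} [AddCommGroup M] [Module Aᵐᵒᵖ M] [AddCommGroup N] [Module A N]
  [Module Aᵐᵒᵖ N] [SMulCommClass A Aᵐᵒᵖ N]

/-- The right action of `A` on `M ⊗_A N`, for an `A`-bimodule `N`. -/
def actR (a : Aᵐᵒᵖ) : BT A M N →+ BT A M N :=
  lift (fun m n => tmul A m (a • n)) (fun m m' n => add_tmul _ _ _)
    (fun m n n' => by rw [smul_add, tmul_add]) (fun m b n => by rw [smul_tmul, smul_comm])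

/-- If `N` is an `A`-bimodule, then `M ⊗_A N` is a right `A`-module. -/
instance instModuleRight : Module Aᵐᵒᵖ (BT A M N) where
  smul a x := actR a x
  one_smul x := DFunLike.congr_fun (f := actR 1) (g := AddMonoidHom.id _)
    (hom_ext fun m n => by simp [actR]) x
  mul_smul a b x := DFunLike.congr_fun (f := actR (a * b)) (g := (actR a).comp (actR b))
    (hom_ext fun m n => by simp [actR, mul_smul]) x
  smul_zero a := map_zero (actR a)
  smul_add a x y := map_add (actR a) x y
  add_smul a b x := DFunLike.congr_fun (f := actR (a + b)) (g := actR a + actR b)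
    (hom_ext fun m n => by simp [actR, add_smul, tmul_add]) x
  zero_smul x := DFunLike.congr_fun (f := actR 0) (g := 0)
    (hom_ext fun m n => by simp [actR]) x

theorem op_smul_tmul (a : Aᵐᵒᵖ) (m : M) (n : N) : a • tmul A m n = tmul A m (a • n) := rfl

end Right

section Left

variable {A}
variable {M N : Type u} [AddCommGroup M] [Module Aᵐᵒᵖ M] [AddCommGroup N] [Module A N]
  [Module A M] [SMulCommClass A Aᵐᵒᵖ M]

/-- The left action of `A` on `M ⊗_A N`, for an `A`-bimodule `M`. -/
def actL (a : A) : BT A M N →+ BT A M N :=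
  lift (fun m n => tmul A (a • m) n) (fun m m' n => by rw [smul_add, add_tmul])
    (fun m n n' => tmul_add _ _ _) (fun m b n => by rw [smul_comm, smul_tmul])

/-- If `M` is an `A`-bimodule, then `M ⊗_A N` is a left `A`-module. -/
instance instModuleLeft : Module A (BT A M N) where
  smul a x := actL a x
  one_smul x := DFunLike.congr_fun (f := actL 1) (g := AddMonoidHom.id _)
    (hom_ext fun m n => by simp [actL]) x
  mul_smul a b x := DFunLike.congr_fun (f := actL (a * b)) (g := (actL a).comp (actL b))
    (hom_ext fun m n => by simp [actL, mul_smul]) x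
  smul_zero a := map_zero (actL a)
  smul_add a x y := map_add (actL a) x y
  add_smul a b x := DFunLike.congr_fun (f := actL (a + b)) (g := actL a + actL b)
    (hom_ext fun m n => by simp [actL, add_smul, add_tmul]) x
  zero_smul x := DFunLike.congr_fun (f := actL 0) (g := 0)
    (hom_ext fun m n => by simp [actL]) x

theorem smul_tmul_left (a : A) (m : M) (n : N) : a • tmul A m n = tmul A (a • m) n := rfl

variable [Module Aᵐᵒᵖ N] [SMulCommClass A Aᵐᵒᵖ N]

instance : SMulCommClass A Aᵐᵒᵖ (BT A M N) where
  smul_comm a b x := by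
    induction x using BT.induction with
    | h0 => simp only [smul_zero]
    | ht m n => rfl
    | ha x y hx hy => simp only [smul_add, hx, hy]

end Left

section Assoc

variable {A}
variable {M N Q : Type u} [AddCommGroup M] [Module Aᵐᵒᵖ M] [AddCommGroup N] [Module A N]
  [Module Aᵐᵒᵖ N] [SMulCommClass A Aᵐᵒᵖ N] [AddCommGroup Q] [Module A Q]

/-- The associativity map `m ⊗ (n ⊗ q) ↦ (m ⊗ n) ⊗ q`. -/
def assocInv : BT A M (BT A N Q) →+ BT A (BT A M N) Q :=
  lift (fun m => lift (fun n q => tmul A (tmul A m n) q)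
      (fun n n' q => by rw [tmul_add, add_tmul]) (fun n q q' => tmul_add _ _ _)
      (fun n a q => by rw [← op_smul_tmul, smul_tmul]))
    (fun m m' x => by
      induction x using BT.induction with
      | h0 => simp only [map_zero, add_zero]
      | ht n q => simp only [lift_tmul, add_tmul]
      | ha x y hx hy => rw [map_add, map_add, map_add, hx, hy, add_add_add_comm])
    (fun m x x' => map_add _ x x')
    (fun m a x => by
      induction x using BT.induction with
      | h0 => simp only [smul_zero, map_zero]
      | ht n q => simp only [smul_tmul_left, lift_tmul, smul_tmul]
      | ha x y hx hy => simp only [smul_add, map_add, hx, hy])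

@[simp] theorem assocInv_tmul (m : M) (n : N) (q : Q) :
    assocInv (tmul A m (tmul A n q)) = tmul A (tmul A m n) q := rfl

/-- The associativity map `(m ⊗ n) ⊗ q ↦ m ⊗ (n ⊗ q)`. -/
def assoc : BT A (BT A M N) Q →+ BT A M (BT A N Q) :=
  lift (fun x q => lift (fun m n => tmul A m (tmul A n q))
      (fun m m' n => add_tmul _ _ _) (fun m n n' => by rw [add_tmul, tmul_add])
      (fun m a n => by rw [smul_tmul, smul_tmul_left]) x)
    (fun x x' q => map_add _ x x')
    (fun x q q' => by
      induction x using BT.induction with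
      | h0 => simp only [map_zero, add_zero]
      | ht m n => simp only [lift_tmul, tmul_add]
      | ha x y hx hy => rw [map_add, map_add, map_add, hx, hy, add_add_add_comm])
    (fun x a q => by
      induction x using BT.induction with
      | h0 => simp only [smul_zero, map_zero]
      | ht m n => simp only [op_smul_tmul, lift_tmul, smul_tmul]
      | ha x y hx hy => simp only [smul_add, map_add, hx, hy])

@[simp] theorem assoc_tmul (m : M) (n : N) (q : Q) :
    assoc (tmul A (tmul A m n) q) = tmul A m (tmul A n q) := rfl

theorem assocInv_assoc (x : BT A (BT A M N) Q) : assocInv (assoc x) = x :=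
  DFunLike.congr_fun (f := assocInv.comp assoc) (g := AddMonoidHom.id _)
    (hom_ext fun y q => by
      induction y using BT.induction with
      | h0 => simp
      | ht m n => rfl
      | ha x y hx hy => rw [add_tmul, map_add, map_add, hx, hy]) x

end Assoc

end BT

end BalancedTensor

/-! ### Corings and their dual rings -/

/-- An `A`-coring: a comonoid in the monoidal category of `A`-bimodules. -/
class Coring (A C : Type u) [Ring A] [AddCommGroup C] [Module A C] [Module Aᵐᵒᵖ C]
    [SMulCommClass A Aᵐᵒᵖ C] where
  /-- The comultiplication `C → C ⊗_A C`. -/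
  comul : C →ₗ[A] BT A C C
  comul_op_smul : ∀ (a : Aᵐᵒᵖ) (c : C), comul (a • c) = a • comul c
  /-- The counit `C → A`. -/
  counit : C →ₗ[A] A
  counit_op_smul : ∀ (a : Aᵐᵒᵖ) (c : C), counit (a • c) = a • counit c
  coassoc : ∀ c : C,
    BT.assoc (BT.map ⟨⟨comul, map_add comul⟩, comul_op_smul⟩ LinearMap.id (comul c)) =
      BT.map LinearMap.id comul (comul c)
  contrL_counit : ∀ c : C, BT.contrL ⟨⟨counit, map_add counit⟩, counit_op_smul⟩ (comul c) = c
  contrR_counit : ∀ c : C, BT.contrR counit (comul c) = c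

section Duals

variable (A C : Type u) [Ring A] [AddCommGroup C] [Module A C] [Module Aᵐᵒᵖ C]

/-- The right dual `C^* = Hom_A(C, A)`: the right `A`-linear maps `C → A`. -/
def RDual : Type u := C →ₗ[Aᵐᵒᵖ] A

/-- The left dual `^*C = _AHom(C, A)`: the left `A`-linear maps `C → A`. -/
def LDual : Type u := C →ₗ[A] A

instance : AddCommGroup (RDual A C) := inferInstanceAs (AddCommGroup (C →ₗ[Aᵐᵒᵖ] A))

instance : AddCommGroup (LDual A C) := inferInstanceAs (AddCommGroup (C →ₗ[A] A))

instance : FunLike (RDual A C) C A := inferInstanceAs (FunLike (C →ₗ[Aᵐᵒᵖ] A) C A)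

instance : FunLike (LDual A C) C A := inferInstanceAs (FunLike (C →ₗ[A] A) C A)

instance : AddMonoidHomClass (RDual A C) C A :=
  inferInstanceAs (AddMonoidHomClass (C →ₗ[Aᵐᵒᵖ] A) C A)

instance : AddMonoidHomClass (LDual A C) C A :=
  inferInstanceAs (AddMonoidHomClass (C →ₗ[A] A) C A)

variable {A C}

/-- An element of `C^*` as a linear map. -/
def RDual.lin (f : RDual A C) : C →ₗ[Aᵐᵒᵖ] A := f

/-- An element of `^*C` as a linear map. -/
def LDual.lin (f : LDual A C) : C →ₗ[A] A := f

theorem RDual.ext {f g : RDual A C} (h : ∀ c, f c = g c) : f = g := DFunLike.ext f g h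

theorem LDual.ext {f g : LDual A C} (h : ∀ c, f c = g c) : f = g := DFunLike.ext f g h

theorem RDual.map_op_smul (f : RDual A C) (a : A) (c : C) :
    f (MulOpposite.op a • c) = f c * a := map_smul f.lin (MulOpposite.op a) c

theorem LDual.map_smul (f : LDual A C) (a : A) (c : C) :
    f (a • c) = a * f c := _root_.map_smul f.lin a c

variable [SMulCommClass A Aᵐᵒᵖ C]

/-- Left multiplication by `a`, as a right linear map. -/
def lmul (a : A) : C →ₗ[Aᵐᵒᵖ] C where
  toFun c := a • c
  map_add' := smul_add a
  map_smul' b c := smul_comm a b c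

/-- Right multiplication by `a`, as a left linear map. -/
def rmul (a : A) : C →ₗ[A] C where
  toFun c := MulOpposite.op a • c
  map_add' := smul_add _
  map_smul' b c := (smul_comm b (MulOpposite.op a) c).symm

/-- The right `A`-action on `C^*`: `(f a)(c) = f(a c)`. -/
instance RDual.instModule : Module Aᵐᵒᵖ (RDual A C) where
  smul a f := f.lin.comp (lmul a.unop)
  one_smul f := RDual.ext fun c => congrArg f (one_smul A c)
  mul_smul a b f := RDual.ext fun c => congrArg f (mul_smul b.unop a.unop c)
  smul_zero _ := rfl
  smul_add _ _ _ := rfl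
  add_smul a b f := RDual.ext fun c => (congrArg f (add_smul a.unop b.unop c)).trans (map_add f _ _)
  zero_smul f := RDual.ext fun c => (congrArg f (zero_smul A c)).trans (map_zero f)

/-- The left `A`-action on `^*C`: `(a f)(c) = f(c a)`. -/
instance LDual.instModule : Module A (LDual A C) where
  smul a f := f.lin.comp (rmul a)
  one_smul f := LDual.ext fun c => congrArg f (one_smul Aᵐᵒᵖ c)
  mul_smul a b f := LDual.ext fun c =>
    congrArg f (mul_smul (MulOpposite.op b) (MulOpposite.op a) c)
  smul_zero _ := rfl
  smul_add _ _ _ := rfl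
  add_smul a b f := LDual.ext fun c =>
    (congrArg f (add_smul (MulOpposite.op a) (MulOpposite.op b) c)).trans (map_add f _ _)
  zero_smul f := LDual.ext fun c => (congrArg f (zero_smul Aᵐᵒᵖ c)).trans (map_zero f)

theorem RDual.smul_apply (a : A) (f : RDual A C) (c : C) :
    (MulOpposite.op a • f) c = f (a • c) := rfl

theorem LDual.smul_apply (a : A) (f : LDual A C) (c : C) :
    (a • f) c = f (MulOpposite.op a • c) := rfl

end Duals

section Contractions

variable {A C : Type u} [Ring A] [AddCommGroup C] [Module A C] [Module Aᵐᵒᵖ C]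
  [SMulCommClass A Aᵐᵒᵖ C]

theorem BT.contrL_op_smul (f : C →ₗ[Aᵐᵒᵖ] A) (a : Aᵐᵒᵖ) (x : BT A C C) :
    BT.contrL f (a • x) = a • BT.contrL f x := by
  induction x using BT.induction with
  | h0 => simp only [smul_zero, map_zero]
  | ht m n => exact smul_comm _ _ _
  | ha x y hx hy => simp only [smul_add, map_add, hx, hy]

theorem BT.contrR_smul (f : C →ₗ[A] A) (a : A) (x : BT A C C) :
    BT.contrR f (a • x) = a • BT.contrR f x := by
  induction x using BT.induction with
  | h0 => simp only [smul_zero, map_zero]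
  | ht m n => exact (smul_comm _ _ _).symm
  | ha x y hx hy => simp only [smul_add, map_add, hx, hy]

theorem BT.contrL_smul (f : RDual A C) (a : A) (x : BT A C C) :
    BT.contrL (RDual.lin (MulOpposite.op a • f)) x = BT.contrL f.lin (a • x) := by
  induction x using BT.induction with
  | h0 => simp only [smul_zero, map_zero]
  | ht m n => rfl
  | ha x y hx hy => simp only [smul_add, map_add, hx, hy]

theorem BT.contrR_op_smul (f : LDual A C) (a : A) (x : BT A C C) :
    BT.contrR (LDual.lin (a • f)) x = BT.contrR f.lin (MulOpposite.op a • x) := by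
  induction x using BT.induction with
  | h0 => simp only [smul_zero, map_zero]
  | ht m n => rfl
  | ha x y hx hy => simp only [smul_add, map_add, hx, hy]

end Contractions

section DualRings

variable {A C : Type u} [Ring A] [AddCommGroup C] [Module A C] [Module Aᵐᵒᵖ C]
  [SMulCommClass A Aᵐᵒᵖ C] [Coring A C]

variable (A C) in
/-- The comultiplication as a right linear map. -/
def comulR : C →ₗ[Aᵐᵒᵖ] BT A C C := ⟨⟨Coring.comul, map_add _⟩, Coring.comul_op_smul⟩

variable (A C) in
/-- The counit as a right linear map. -/
def counitR : C →ₗ[Aᵐᵒᵖ] A := ⟨⟨Coring.counit, map_add _⟩, Coring.counit_op_smul⟩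

namespace RDual

/-- The left action of `C^*` on `C`: `f · c = f(c₁) c₂`. -/
def act (f : RDual A C) : C →ₗ[Aᵐᵒᵖ] C where
  toFun c := BT.contrL f.lin (comulR A C c)
  map_add' c d := by rw [map_add, map_add]
  map_smul' a c := by
    rw [_root_.map_smul, BT.contrL_op_smul]
    rfl

/-- The product of `C^*`: `(f * g)(c) = f(g(c₁) c₂)`. -/
instance : Mul (RDual A C) where
  mul f g := f.lin.comp g.act

/-- The unit of `C^*` is the counit of `C`. -/
instance : One (RDual A C) where
  one := counitR A C

theorem mul_apply (f g : RDual A C) (c : C) : (f * g) c = f (g.act c) := rfl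

theorem one_apply (c : C) : (1 : RDual A C) c = Coring.counit c := rfl

theorem act_one (c : C) : (1 : RDual A C).act c = c := Coring.contrL_counit c

theorem act_add (f g : RDual A C) (c : C) : (f + g).act c = f.act c + g.act c :=
  BT.contrL_add _ _ _

theorem act_zero (c : C) : (0 : RDual A C).act c = 0 := by
  have := act_add (0 : RDual A C) 0 c
  rw [add_zero] at this
  exact left_eq_add.1 this

theorem act_mul (f g : RDual A C) (c : C) : (f * g).act c = f.act (g.act c) := by
  have h1 : ∀ x : BT A C C, Coring.comul (BT.contrL g.lin x) =
      BT.contrL g.lin (BT.map LinearMap.id (Coring.comul (A := A)) x) := by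
    intro x
    induction x using BT.induction with
    | h0 => simp only [map_zero]
    | ht m n => exact _root_.map_smul (Coring.comul (A := A) (C := C)) _ _
    | ha x y hx hy => simp only [map_add, hx, hy]
  have h2 : ∀ (x : BT A C C) (d : C), BT.contrL f.lin
      (BT.contrL g.lin (BT.assoc (BT.tmul A x d))) = f (BT.contrL g.lin x) • d := by
    intro x d
    induction x using BT.induction with
    | h0 => rw [BT.zero_tmul, map_zero, map_zero, map_zero, map_zero, map_zero, zero_smul]
    | ht m n => rfl
    | ha x y hx hy =>
      rw [BT.add_tmul, map_add, map_add, map_add, map_add, map_add, hx, hy, add_smul]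
  have h3 : ∀ x : BT A C C, BT.contrL f.lin
      (BT.contrL g.lin (BT.assoc (BT.map (comulR A C) LinearMap.id x))) =
      BT.contrL (f * g).lin x := by
    intro x
    induction x using BT.induction with
    | h0 => simp only [map_zero]
    | ht m n => exact h2 _ _
    | ha x y hx hy => simp only [map_add, hx, hy]
  change BT.contrL _ (Coring.comul c) =
    BT.contrL _ (Coring.comul (BT.contrL _ (Coring.comul c)))
  rw [h1, ← Coring.coassoc, ← h3]
  rfl

theorem counit_contrL (f : RDual A C) (x : BT A C C) :
    Coring.counit (A := A) (BT.contrL f.lin x) = f (BT.contrR (Coring.counit (A := A)) x) := by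
  induction x using BT.induction with
  | h0 => simp only [map_zero]
  | ht m n =>
    rw [BT.contrL_tmul, BT.contrR_tmul, map_op_smul, _root_.map_smul]
    rfl
  | ha x y hx hy => simp only [map_add, hx, hy]

/-- The ring `C^*`. -/
instance : Ring (RDual A C) :=
  { (inferInstance : AddCommGroup (RDual A C)), (inferInstance : Mul (RDual A C)),
    (inferInstance : One (RDual A C)) with
    left_distrib := fun f g h => RDual.ext fun c =>
      (congrArg f (act_add g h c)).trans (map_add f _ _)
    right_distrib := fun f g h => rfl
    zero_mul := fun f => rfl
    mul_zero := fun f => RDual.ext fun c => (congrArg f (act_zero c)).trans (map_zero f)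
    mul_assoc := fun f g h => RDual.ext fun c => (congrArg f (act_mul g h c)).symm
    one_mul := fun f => RDual.ext fun c =>
      (counit_contrL f _).trans (congrArg f (Coring.contrR_counit c))
    mul_one := fun f => RDual.ext fun c => congrArg f (act_one c) }

instance : Module (RDual A C) C where
  smul f c := f.act c
  one_smul := act_one
  mul_smul := act_mul
  smul_zero f := map_zero f.act
  smul_add f := map_add f.act
  add_smul := act_add
  zero_smul := act_zero

theorem smul_def (f : RDual A C) (c : C) : f • c = BT.contrL f.lin (Coring.comul c) := rfl

instance : SMulCommClass (RDual A C) Aᵐᵒᵖ C where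
  smul_comm f a c := _root_.map_smul f.act a c

instance : SMulCommClass (RDual A C) Aᵐᵒᵖ (RDual A C) where
  smul_comm f a g := RDual.ext fun c => congrArg f <| by
    change BT.contrL _ _ = BT.contrL _ (Coring.comul (a.unop • c))
    rw [_root_.map_smul]
    exact BT.contrL_smul g a.unop _

end RDual

namespace LDual

/-- The right action of `^*C` on `C`: `c · f = c₁ f(c₂)`. -/
def act (f : LDual A C) : C →ₗ[A] C where
  toFun c := BT.contrR f.lin (Coring.comul c)
  map_add' c d := by rw [map_add, map_add]
  map_smul' a c := by
    rw [_root_.map_smul, BT.contrR_smul]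
    rfl

/-- The product of `^*C`: `(f * g)(c) = g(c₁ f(c₂))`. -/
instance : Mul (LDual A C) where
  mul f g := g.lin.comp f.act

/-- The unit of `^*C` is the counit of `C`. -/
instance : One (LDual A C) where
  one := (Coring.counit : C →ₗ[A] A)

theorem mul_apply (f g : LDual A C) (c : C) : (f * g) c = g (f.act c) := rfl

theorem one_apply (c : C) : (1 : LDual A C) c = Coring.counit c := rfl

theorem act_one (c : C) : (1 : LDual A C).act c = c := Coring.contrR_counit c

theorem act_add (f g : LDual A C) (c : C) : (f + g).act c = f.act c + g.act c :=
  BT.contrR_add _ _ _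

theorem act_zero (c : C) : (0 : LDual A C).act c = 0 := by
  have := act_add (0 : LDual A C) 0 c
  rw [add_zero] at this
  exact left_eq_add.1 this

theorem act_mul (f g : LDual A C) (c : C) : (f * g).act c = g.act (f.act c) := by
  have h1 : ∀ x : BT A C C, comulR A C (BT.contrR f.lin x) =
      BT.contrR f.lin (BT.map (comulR A C) LinearMap.id x) := by
    intro x
    induction x using BT.induction with
    | h0 => simp only [map_zero]
    | ht m n => exact _root_.map_smul (comulR A C) _ _
    | ha x y hx hy => simp only [map_add, hx, hy]
  have h2 : ∀ (x : BT A C C) (d : C), BT.contrR g.lin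
      (BT.contrR f.lin (BT.assocInv (BT.tmul A d x))) =
      MulOpposite.op (g (BT.contrR f.lin x)) • d := by
    intro x d
    induction x using BT.induction with
    | h0 => rw [BT.tmul_zero, map_zero, map_zero, map_zero, map_zero, map_zero, MulOpposite.op_zero,
        zero_smul]
    | ht m n => rfl
    | ha x y hx hy =>
      rw [BT.tmul_add, map_add, map_add, map_add, map_add, map_add, hx, hy, MulOpposite.op_add,
        add_smul]
  have h3 : ∀ x : BT A C C, BT.contrR g.lin
      (BT.contrR f.lin (BT.assocInv (BT.map LinearMap.id (Coring.comul (A := A)) x))) =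
      BT.contrR (f * g).lin x := by
    intro x
    induction x using BT.induction with
    | h0 => simp only [map_zero]
    | ht m n => exact h2 _ _
    | ha x y hx hy => simp only [map_add, hx, hy]
  change BT.contrR _ (Coring.comul c) =
    BT.contrR _ (comulR A C (BT.contrR _ (Coring.comul c)))
  rw [h1, ← h3, ← Coring.coassoc, BT.assocInv_assoc]
  rfl

theorem counit_contrR (f : LDual A C) (x : BT A C C) :
    Coring.counit (A := A) (BT.contrR f.lin x) = f (BT.contrL (counitR A C) x) := by
  induction x using BT.induction with
  | h0 => simp only [map_zero]
  | ht m n =>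
    rw [BT.contrL_tmul, BT.contrR_tmul, map_smul, Coring.counit_op_smul]
    rfl
  | ha x y hx hy => simp only [map_add, hx, hy]

/-- The ring `^*C`. -/
instance : Ring (LDual A C) :=
  { (inferInstance : AddCommGroup (LDual A C)), (inferInstance : Mul (LDual A C)),
    (inferInstance : One (LDual A C)) with
    left_distrib := fun f g h => rfl
    right_distrib := fun f g h => LDual.ext fun c =>
      (congrArg h (act_add f g c)).trans (map_add h _ _)
    zero_mul := fun f => LDual.ext fun c => (congrArg f (act_zero c)).trans (map_zero f)
    mul_zero := fun f => rfl
    mul_assoc := fun f g h => LDual.ext fun c => congrArg h (act_mul f g c)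
    one_mul := fun f => LDual.ext fun c => congrArg f (act_one c)
    mul_one := fun f => LDual.ext fun c =>
      (counit_contrR f _).trans (congrArg f (Coring.contrL_counit c)) }

instance : Module (LDual A C)ᵐᵒᵖ C where
  smul f c := f.unop.act c
  one_smul := act_one
  mul_smul f g c := act_mul g.unop f.unop c
  smul_zero f := map_zero f.unop.act
  smul_add f := map_add f.unop.act
  add_smul f g c := act_add f.unop g.unop c
  zero_smul := act_zero

theorem op_smul_def (f : LDual A C) (c : C) :
    MulOpposite.op f • c = BT.contrR f.lin (Coring.comul c) := rfl

instance : SMulCommClass A (LDual A C)ᵐᵒᵖ C where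
  smul_comm a f c := (_root_.map_smul f.unop.act a c).symm

instance : SMulCommClass A (LDual A C)ᵐᵒᵖ (LDual A C) where
  smul_comm a g f := LDual.ext fun c => congrArg g.unop <| by
    change BT.contrR _ (Coring.comul (MulOpposite.op a • c)) = BT.contrR _ _
    rw [Coring.comul_op_smul]
    exact (BT.contrR_op_smul f a _).symm

end LDual

end DualRings

/-! ### Comodules -/

section Comodules

variable (A C : Type u) [Ring A] [AddCommGroup C] [Module A C] [Module Aᵐᵒᵖ C]
  [SMulCommClass A Aᵐᵒᵖ C]

variable {A} in
/-- The right linear map `f ⊗_A C`. -/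
def mapR {N N' : Type u} [AddCommGroup N] [Module Aᵐᵒᵖ N] [AddCommGroup N'] [Module Aᵐᵒᵖ N']
    (f : N →ₗ[Aᵐᵒᵖ] N') : BT A N C →ₗ[Aᵐᵒᵖ] BT A N' C where
  toFun := BT.map f LinearMap.id
  map_add' := map_add _
  map_smul' a x := by
    induction x using BT.induction with
    | h0 => simp only [smul_zero, map_zero]
    | ht m n => rfl
    | ha x y hx hy => simp only [smul_add, map_add, hx, hy]

variable {A} in
/-- The left linear map `C ⊗_A f`. -/
def mapL {N N' : Type u} [AddCommGroup N] [Module A N] [AddCommGroup N'] [Module A N']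
    (f : N →ₗ[A] N') : BT A C N →ₗ[A] BT A C N' where
  toFun := BT.map LinearMap.id f
  map_add' := map_add _
  map_smul' a x := by
    induction x using BT.induction with
    | h0 => simp only [smul_zero, map_zero]
    | ht m n => rfl
    | ha x y hx hy => simp only [smul_add, map_add, hx, hy]

/-- The functor `- ⊗_A C` on right `A`-modules. -/
def tensorRight : ModuleCat.{u} Aᵐᵒᵖ ⥤ ModuleCat.{u} Aᵐᵒᵖ where
  obj N := ModuleCat.of Aᵐᵒᵖ (BT A N C)
  map f := ModuleCat.ofHom (mapR C f.hom)
  map_id N := ModuleCat.hom_ext <| LinearMap.ext <|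
    DFunLike.congr_fun (f := BT.map (𝟙 N : N ⟶ N).hom (LinearMap.id (R := A) (M := C)))
      (g := AddMonoidHom.id _) <| BT.hom_ext fun _ _ => rfl
  map_comp f g := ModuleCat.hom_ext <| LinearMap.ext <|
    DFunLike.congr_fun (f := BT.map (f ≫ g).hom LinearMap.id)
      (g := (BT.map g.hom (LinearMap.id (R := A) (M := C))).comp
      (BT.map f.hom LinearMap.id)) <| BT.hom_ext fun _ _ => rfl

/-- The functor `C ⊗_A -` on left `A`-modules. -/
def tensorLeft : ModuleCat.{u} A ⥤ ModuleCat.{u} A where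
  obj N := ModuleCat.of A (BT A C N)
  map f := ModuleCat.ofHom (mapL C f.hom)
  map_id N := ModuleCat.hom_ext <| LinearMap.ext <|
    DFunLike.congr_fun (f := BT.map (LinearMap.id (R := Aᵐᵒᵖ) (M := C)) (𝟙 N : N ⟶ N).hom)
      (g := AddMonoidHom.id _) <| BT.hom_ext fun _ _ => rfl
  map_comp f g := ModuleCat.hom_ext <| LinearMap.ext <|
    DFunLike.congr_fun (f := BT.map LinearMap.id (f ≫ g).hom)
      (g := (BT.map (LinearMap.id (R := Aᵐᵒᵖ) (M := C)) g.hom).comp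
      (BT.map LinearMap.id f.hom)) <| BT.hom_ext fun _ _ => rfl

variable [Coring A C]

/-- `n ⊗ c ↦ (n ⊗ c₁) ⊗ c₂`. -/
def deltaR (N : Type u) [AddCommGroup N] [Module Aᵐᵒᵖ N] :
    BT A N C →ₗ[Aᵐᵒᵖ] BT A (BT A N C) C where
  toFun x := BT.assocInv (BT.map LinearMap.id (Coring.comul (A := A) (C := C)) x)
  map_add' x y := by rw [map_add, map_add]
  map_smul' a x := by
    have h : ∀ (n : N) (y : BT A C C), BT.assocInv (BT.tmul A n (a • y)) =
        a • BT.assocInv (BT.tmul A n y) := by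
      intro n y
      induction y using BT.induction with
      | h0 => simp only [smul_zero, BT.tmul_zero, map_zero]
      | ht m n => rfl
      | ha x y hx hy => simp only [smul_add, BT.tmul_add, map_add, hx, hy]
    induction x using BT.induction with
    | h0 => simp only [smul_zero, map_zero]
    | ht n c =>
      rw [BT.op_smul_tmul, BT.map_tmul, Coring.comul_op_smul]
      exact h n _
    | ha x y hx hy =>
      simp only [smul_add, map_add, hx, hy]

/-- `n ⊗ c ↦ n ε(c)`. -/
def epsR (N : Type u) [AddCommGroup N] [Module Aᵐᵒᵖ N] : BT A N C →ₗ[Aᵐᵒᵖ] N where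
  toFun x := BT.contrR (Coring.counit (A := A) (C := C)) x
  map_add' x y := map_add _ x y
  map_smul' a x := by
    induction x using BT.induction with
    | h0 => simp only [smul_zero, map_zero]
    | ht n c =>
      rw [BT.op_smul_tmul, BT.contrR_tmul, BT.contrR_tmul, Coring.counit_op_smul]
      exact mul_smul _ _ _
    | ha x y hx hy => simp only [smul_add, map_add, hx, hy]

/-- `c ⊗ n ↦ c₁ ⊗ (c₂ ⊗ n)`. -/
def deltaL (N : Type u) [AddCommGroup N] [Module A N] :
    BT A C N →ₗ[A] BT A C (BT A C N) where
  toFun x := BT.assoc (BT.map (comulR A C) LinearMap.id x)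
  map_add' x y := by rw [map_add, map_add]
  map_smul' a x := by
    have h : ∀ (n : N) (y : BT A C C), BT.assoc (BT.tmul A (a • y) n) =
        a • BT.assoc (BT.tmul A y n) := by
      intro n y
      induction y using BT.induction with
      | h0 => simp only [smul_zero, BT.zero_tmul, map_zero]
      | ht m n => rfl
      | ha x y hx hy => simp only [smul_add, BT.add_tmul, map_add, hx, hy]
    induction x using BT.induction with
    | h0 => simp only [smul_zero, map_zero]
    | ht c n =>
      rw [BT.smul_tmul_left, BT.map_tmul]
      change BT.assoc (BT.tmul A (Coring.comul (a • c)) n) = _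
      rw [map_smul]
      exact h n _
    | ha x y hx hy =>
      simp only [smul_add, map_add, hx, hy]

/-- `c ⊗ n ↦ ε(c) n`. -/
def epsL (N : Type u) [AddCommGroup N] [Module A N] : BT A C N →ₗ[A] N where
  toFun x := BT.contrL (counitR A C) x
  map_add' x y := map_add _ x y
  map_smul' a x := by
    induction x using BT.induction with
    | h0 => simp only [smul_zero, map_zero]
    | ht c n =>
      rw [BT.smul_tmul_left, BT.contrL_tmul, BT.contrL_tmul]
      change Coring.counit (a • c) • n = _
      rw [map_smul]
      exact mul_smul _ _ _
    | ha x y hx hy => simp only [smul_add, map_add, hx, hy]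

/-- The comonad `- ⊗_A C` on right `A`-modules, with comultiplication `n ⊗ c ↦ n ⊗ c₁ ⊗ c₂` and
counit `n ⊗ c ↦ n ε(c)`. -/
def rightComonad : Comonad (ModuleCat.{u} Aᵐᵒᵖ) where
  toFunctor := tensorRight A C
  ε :=
    { app := fun N => ModuleCat.ofHom (epsR A C N)
      naturality := fun N N' f => ModuleCat.hom_ext <| LinearMap.ext fun x => by
        change epsR A C N' (BT.map f.hom LinearMap.id x) = f.hom (epsR A C N x)
        induction x using BT.induction with
        | h0 => simp only [map_zero]
        | ht n c => exact (map_smul f.hom _ n).symm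
        | ha x y hx hy => simp only [map_add, hx, hy] }
  δ :=
    { app := fun N => ModuleCat.ofHom (deltaR A C N)
      naturality := fun N N' f => ModuleCat.hom_ext <| LinearMap.ext fun x => by
        change deltaR A C N' (BT.map f.hom LinearMap.id x) =
          BT.map (mapR C f.hom) LinearMap.id (deltaR A C N x)
        have h : ∀ (n : N) (y : BT A C C), BT.assocInv (BT.tmul A (f.hom n) y) =
            BT.map (mapR C f.hom) LinearMap.id (BT.assocInv (BT.tmul A n y)) := by
          intro n y
          induction y using BT.induction with
          | h0 => simp only [BT.tmul_zero, map_zero]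
          | ht m n => rfl
          | ha x y hx hy => rw [BT.tmul_add, BT.tmul_add, map_add, map_add, map_add, hx, hy]
        induction x using BT.induction with
        | h0 => simp only [map_zero]
        | ht n c => exact h n _
        | ha x y hx hy => simp only [map_add, hx, hy] }
  coassoc N := ModuleCat.hom_ext <| LinearMap.ext fun x => by
    change BT.map (deltaR A C N) LinearMap.id (deltaR A C N x) = deltaR A C (BT A N C) (deltaR A C N x)
    let i (n : N) : C →ₗ[Aᵐᵒᵖ] BT A N C := ⟨⟨BT.tmul A n, BT.tmul_add n⟩, fun _ _ => rfl⟩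
    have h1 : ∀ (n : N) (y : BT A C C) (d : C),
        BT.assocInv (BT.map (i n) LinearMap.id (BT.assoc (BT.tmul A y d))) =
        BT.tmul A (BT.assocInv (BT.tmul A n y)) d := by
      intro n y d
      induction y using BT.induction with
      | h0 => simp only [BT.zero_tmul, BT.tmul_zero, map_zero]
      | ht m n => rfl
      | ha x y hx hy =>
        rw [BT.add_tmul, map_add, map_add, map_add, hx, hy, BT.tmul_add, map_add, BT.add_tmul]
    have h2 : ∀ (n : N) (y : BT A C C),
        BT.map (deltaR A C N) LinearMap.id (BT.assocInv (BT.tmul A n y)) =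
        BT.assocInv (BT.map (i n) LinearMap.id (BT.assoc
          (BT.map (comulR A C) LinearMap.id y))) := by
      intro n y
      induction y using BT.induction with
      | h0 => simp only [BT.tmul_zero, map_zero]
      | ht c d => exact (h1 n _ d).symm
      | ha x y hx hy =>
        rw [BT.tmul_add, map_add, map_add, map_add, map_add, map_add, map_add, hx, hy]
    have h3 : ∀ (n : N) (y : BT A C C),
        deltaR A C (BT A N C) (BT.assocInv (BT.tmul A n y)) =
        BT.assocInv (BT.map (i n) LinearMap.id (BT.map LinearMap.id Coring.comul y)) := by
      intro n y
      induction y using BT.induction with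
      | h0 => simp only [BT.tmul_zero, map_zero]
      | ht c d => rfl
      | ha x y hx hy => rw [BT.tmul_add, map_add, map_add, map_add, map_add, map_add, hx, hy]
    induction x using BT.induction with
    | h0 => simp only [map_zero]
    | ht n c =>
      refine (h2 n _).trans (Eq.trans ?_ (h3 n _).symm)
      exact congrArg (fun z => BT.assocInv (BT.map (i n) LinearMap.id z)) (Coring.coassoc c)
    | ha x y hx hy => simp only [map_add, hx, hy]
  left_counit N := ModuleCat.hom_ext <| LinearMap.ext fun x => by
    change epsR A C (BT A N C) (deltaR A C N x) = x
    have h : ∀ (n : N) (y : BT A C C), epsR A C (BT A N C) (BT.assocInv (BT.tmul A n y)) =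
        BT.tmul A n (BT.contrR Coring.counit y) := by
      intro n y
      induction y using BT.induction with
      | h0 => simp only [BT.tmul_zero, map_zero]
      | ht m n => rfl
      | ha x y hx hy => rw [BT.tmul_add, map_add, map_add, map_add, hx, hy, BT.tmul_add]
    induction x using BT.induction with
    | h0 => simp only [map_zero]
    | ht n c => exact (h n _).trans (congrArg (BT.tmul A n) (Coring.contrR_counit c))
    | ha x y hx hy => rw [map_add, map_add, hx, hy]
  right_counit N := ModuleCat.hom_ext <| LinearMap.ext fun x => by
    change BT.map (epsR A C N) LinearMap.id (deltaR A C N x) = x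
    have h : ∀ (n : N) (y : BT A C C),
        BT.map (epsR A C N) LinearMap.id (BT.assocInv (BT.tmul A n y)) =
        BT.tmul A n (BT.contrL (counitR A C) y) := by
      intro n y
      induction y using BT.induction with
      | h0 => simp only [BT.tmul_zero, map_zero]
      | ht c d => exact BT.smul_tmul _ _ _
      | ha x y hx hy => rw [BT.tmul_add, map_add, map_add, map_add, hx, hy, BT.tmul_add]
    induction x using BT.induction with
    | h0 => simp only [map_zero]
    | ht n c => exact (h n _).trans (congrArg (BT.tmul A n) (Coring.contrL_counit c))
    | ha x y hx hy => rw [map_add, map_add, hx, hy]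

/-- The comonad `C ⊗_A -` on left `A`-modules, with comultiplication `c ⊗ n ↦ c₁ ⊗ c₂ ⊗ n` and
counit `c ⊗ n ↦ ε(c) n`. -/
def leftComonad : Comonad (ModuleCat.{u} A) where
  toFunctor := tensorLeft A C
  ε :=
    { app := fun N => ModuleCat.ofHom (epsL A C N)
      naturality := fun N N' f => ModuleCat.hom_ext <| LinearMap.ext fun x => by
        change epsL A C N' (BT.map LinearMap.id f.hom x) = f.hom (epsL A C N x)
        induction x using BT.induction with
        | h0 => simp only [map_zero]
        | ht c n => exact (map_smul f.hom _ n).symm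
        | ha x y hx hy => simp only [map_add, hx, hy] }
  δ :=
    { app := fun N => ModuleCat.ofHom (deltaL A C N)
      naturality := fun N N' f => ModuleCat.hom_ext <| LinearMap.ext fun x => by
        change deltaL A C N' (BT.map LinearMap.id f.hom x) =
          BT.map LinearMap.id (mapL C f.hom) (deltaL A C N x)
        have h : ∀ (n : N) (y : BT A C C), BT.assoc (BT.tmul A y (f.hom n)) =
            BT.map LinearMap.id (mapL C f.hom) (BT.assoc (BT.tmul A y n)) := by
          intro n y
          induction y using BT.induction with
          | h0 => simp only [BT.zero_tmul, map_zero]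
          | ht m n => rfl
          | ha x y hx hy => rw [BT.add_tmul, BT.add_tmul, map_add, map_add, map_add, hx, hy]
        induction x using BT.induction with
        | h0 => simp only [map_zero]
        | ht c n => exact h n _
        | ha x y hx hy => simp only [map_add, hx, hy] }
  coassoc N := ModuleCat.hom_ext <| LinearMap.ext fun x => by
    change BT.map LinearMap.id (deltaL A C N) (deltaL A C N x) = deltaL A C (BT A C N) (deltaL A C N x)
    let i (n : N) : C →ₗ[A] BT A C N :=
      ⟨⟨fun c => BT.tmul A c n, fun c d => BT.add_tmul c d n⟩, fun _ _ => rfl⟩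
    have h1 : ∀ (n : N) (y : BT A C C) (c : C),
        BT.assoc (BT.map LinearMap.id (i n) (BT.assocInv (BT.tmul A c y))) =
        BT.tmul A c (BT.assoc (BT.tmul A y n)) := by
      intro n y c
      induction y using BT.induction with
      | h0 => simp only [BT.zero_tmul, BT.tmul_zero, map_zero]
      | ht m n => rfl
      | ha x y hx hy =>
        rw [BT.tmul_add, map_add, map_add, map_add, hx, hy, BT.add_tmul, map_add, BT.tmul_add]
    have h2 : ∀ (n : N) (y : BT A C C),
        BT.map LinearMap.id (deltaL A C N) (BT.assoc (BT.tmul A y n)) =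
        BT.assoc (BT.map LinearMap.id (i n) (BT.assocInv
          (BT.map LinearMap.id Coring.comul y))) := by
      intro n y
      induction y using BT.induction with
      | h0 => simp only [BT.zero_tmul, map_zero]
      | ht c d => exact (h1 n _ c).symm
      | ha x y hx hy =>
        rw [BT.add_tmul, map_add, map_add, map_add, map_add, map_add, map_add, hx, hy]
    have h3 : ∀ (n : N) (y : BT A C C),
        deltaL A C (BT A C N) (BT.assoc (BT.tmul A y n)) =
        BT.assoc (BT.map LinearMap.id (i n) (BT.map (comulR A C) LinearMap.id y)) := by
      intro n y
      induction y using BT.induction with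
      | h0 => simp only [BT.zero_tmul, map_zero]
      | ht c d => rfl
      | ha x y hx hy => rw [BT.add_tmul, map_add, map_add, map_add, map_add, map_add, hx, hy]
    induction x using BT.induction with
    | h0 => simp only [map_zero]
    | ht c n =>
      refine (h2 n _).trans (Eq.trans ?_ (h3 n _).symm)
      refine congrArg (fun z => BT.assoc (BT.map LinearMap.id (i n) z)) ?_
      exact (congrArg BT.assocInv (Coring.coassoc c)).symm.trans (BT.assocInv_assoc _)
    | ha x y hx hy => simp only [map_add, hx, hy]
  left_counit N := ModuleCat.hom_ext <| LinearMap.ext fun x => by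
    change epsL A C (BT A C N) (deltaL A C N x) = x
    have h : ∀ (n : N) (y : BT A C C), epsL A C (BT A C N) (BT.assoc (BT.tmul A y n)) =
        BT.tmul A (BT.contrL (counitR A C) y) n := by
      intro n y
      induction y using BT.induction with
      | h0 => simp only [BT.zero_tmul, map_zero]
      | ht m n => rfl
      | ha x y hx hy => rw [BT.add_tmul, map_add, map_add, map_add, hx, hy, BT.add_tmul]
    induction x using BT.induction with
    | h0 => simp only [map_zero]
    | ht c n => exact (h n _).trans (congrArg (fun c => BT.tmul A c n) (Coring.contrL_counit c))
    | ha x y hx hy => rw [map_add, map_add, hx, hy]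
  right_counit N := ModuleCat.hom_ext <| LinearMap.ext fun x => by
    change BT.map LinearMap.id (epsL A C N) (deltaL A C N x) = x
    have h : ∀ (n : N) (y : BT A C C),
        BT.map LinearMap.id (epsL A C N) (BT.assoc (BT.tmul A y n)) =
        BT.tmul A (BT.contrR Coring.counit y) n := by
      intro n y
      induction y using BT.induction with
      | h0 => simp only [BT.zero_tmul, map_zero]
      | ht c d => exact (BT.smul_tmul _ _ _).symm
      | ha x y hx hy => rw [BT.add_tmul, map_add, map_add, map_add, hx, hy, BT.add_tmul]
    induction x using BT.induction with
    | h0 => simp only [map_zero]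
    | ht c n => exact (h n _).trans (congrArg (fun c => BT.tmul A c n) (Coring.contrR_counit c))
    | ha x y hx hy => rw [map_add, map_add, hx, hy]

end Comodules

/-! ### Comodule functors and finitely generated projective comodules -/

section ComoduleFunctors

variable (A C : Type u) [Ring A] [AddCommGroup C] [Module A C] [Module Aᵐᵒᵖ C]
  [SMulCommClass A Aᵐᵒᵖ C] [Coring A C]

/-- The category of right `C`-comodules. -/
abbrev RComod : Type (u + 1) := (rightComonad A C).Coalgebra

/-- The category of left `C`-comodules. -/
abbrev LComod : Type (u + 1) := (leftComonad A C).Coalgebra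

/-- The forgetful functor from right `C`-comodules to right `A`-modules. -/
abbrev forgetR : RComod A C ⥤ ModuleCat.{u} Aᵐᵒᵖ := (rightComonad A C).forget

/-- The induction functor `- ⊗_A C` from right `A`-modules to right `C`-comodules. -/
abbrev inductionR : ModuleCat.{u} Aᵐᵒᵖ ⥤ RComod A C := (rightComonad A C).cofree

/-- The forgetful functor from left `C`-comodules to left `A`-modules. -/
abbrev forgetL : LComod A C ⥤ ModuleCat.{u} A := (leftComonad A C).forget

/-- The induction functor `C ⊗_A -` from left `A`-modules to left `C`-comodules. -/
abbrev inductionL : ModuleCat.{u} A ⥤ LComod A C := (leftComonad A C).cofree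

/-- The right `C`-comodules that are finitely generated and projective as right `A`-modules. -/
def fgpR : ObjectProperty (RComod A C) := fun M =>
  Module.Finite Aᵐᵒᵖ M.A ∧ Module.Projective Aᵐᵒᵖ M.A

/-- The left `C`-comodules that are finitely generated and projective as left `A`-modules. -/
def fgpL : ObjectProperty (LComod A C) := fun M =>
  Module.Finite A M.A ∧ Module.Projective A M.A

variable {A C}

/-- The coaction of a right comodule, `m ↦ m₀ ⊗ m₁`. -/
def coactR (M : RComod A C) : M.A →ₗ[Aᵐᵒᵖ] BT A M.A C := M.a.hom

/-- The coaction of a left comodule, `m ↦ m₋₁ ⊗ m₀`. -/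
def coactL (M : LComod A C) : M.A →ₗ[A] BT A C M.A := M.a.hom

/-- The right action of `^*C` on a right comodule: `m · f = m₀ f(m₁)`. -/
def actOnR (M : RComod A C) (f : LDual A C) (m : M.A) : M.A := BT.contrR f.lin (coactR M m)

/-- The left action of `C^*` on a left comodule: `f · m = f(m₋₁) m₀`. -/
def actOnL (M : LComod A C) (f : RDual A C) (m : M.A) : M.A := BT.contrL f.lin (coactL M m)

end ComoduleFunctors

/-! ### Locally projective modules -/

/-- A module `M` is locally projective if for every finitely generated submodule `P` of `M`, every
surjection `f : N' → N` and every `g : M → N` there is `h : M → N'` with `f ∘ h = g` on `P`. -/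
def LocProj (R M : Type u) [Ring R] [AddCommGroup M] [Module R M] : Prop :=
  ∀ P : Submodule R M, P.FG → ∀ (N' N : Type u) [AddCommGroup N'] [Module R N']
    [AddCommGroup N] [Module R N] (f : N' →ₗ[R] N), Function.Surjective f →
    ∀ g : M →ₗ[R] N, ∃ h : M →ₗ[R] N', ∀ m ∈ P, f (h m) = g m

/-! ### Locally quasi-adjoint functors -/

section LocallyAdjoint

universe v₁ v₂ u₁ u₂ w

variable {X : Type u₁} [Category.{v₁} X] {Y : Type u₂} [Category.{v₂} Y]

/-- The composite `F → FGF → F` of `ηF` and `Fε`. -/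
def endLeft {F : X ⥤ Y} {G : Y ⥤ X} (ε : F ⋙ G ⟶ 𝟭 X) (η : 𝟭 Y ⟶ G ⋙ F) : F ⟶ F where
  app M := η.app (F.obj M) ≫ F.map (ε.app M)
  naturality M M' f := by
    have h1 := η.naturality (F.map f)
    have h2 := ε.naturality f
    simp only [Functor.id_map, Functor.comp_map] at h1 h2
    rw [← Category.assoc, h1, Category.assoc, Category.assoc, ← F.map_comp, ← F.map_comp, h2]

/-- The composite `G → GFG → G` of `Gη` and `εG`. -/
def endRight {F : X ⥤ Y} {G : Y ⥤ X} (ε : F ⋙ G ⟶ 𝟭 X) (η : 𝟭 Y ⟶ G ⋙ F) : G ⟶ G where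
  app N := G.map (η.app N) ≫ ε.app (G.obj N)
  naturality N N' f := by
    have h1 := η.naturality f
    have h2 := ε.naturality (G.map f)
    simp only [Functor.id_map, Functor.comp_map] at h1 h2
    rw [← Category.assoc, ← G.map_comp, h1, G.map_comp, Category.assoc, h2, Category.assoc]

/-- A set `R` of natural endomorphisms of `F : X ⥤ Y` acts unital on the class `E` of objects of
`X`: every morphism `F M ⟶ F M'` with `M` in `E` is fixed by some member of `R`. -/
def ActsUnitalFrom (E : ObjectProperty X) {F : X ⥤ Y} (R : Set (F ⟶ F)) : Prop :=
  ∀ M, E M → ∀ (M' : X) (f : F.obj M ⟶ F.obj M'), ∃ θ ∈ R, f ≫ θ.app M' = f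

/-- A set `R` of natural endomorphisms of `G : Y ⥤ X` acts unital on the class `E` of objects of
`X`: every morphism `M ⟶ G N` with `M` in `E` is fixed by some member of `R`. -/
def ActsUnitalInto (E : ObjectProperty X) {G : Y ⥤ X} (R : Set (G ⟶ G)) : Prop :=
  ∀ M, E M → ∀ (N : Y) (f : M ⟶ G.obj N), ∃ θ ∈ R, f ≫ θ.app N = f

/-- `G` is an `E`-locally left adjoint for `F`. -/
def IsLocallyLeftAdjoint (E : ObjectProperty X) (G : Y ⥤ X) (F : X ⥤ Y) : Prop :=
  ∃ ε : F ⋙ G ⟶ 𝟭 X, ∀ M, E M → ∀ (N : Y) (f : M ⟶ G.obj N),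
    ∃ η : 𝟭 Y ⟶ G ⋙ F, f ≫ G.map (η.app N) ≫ ε.app (G.obj N) = f

/-- `F` is an `E`-locally right adjoint for `G`. -/
def IsLocallyRightAdjoint (E : ObjectProperty X) (F : X ⥤ Y) (G : Y ⥤ X) : Prop :=
  ∃ ε : F ⋙ G ⟶ 𝟭 X, ∀ M, E M → ∀ (M' : X) (f : F.obj M ⟶ F.obj M'),
    ∃ η : 𝟭 Y ⟶ G ⋙ F, f ≫ η.app (F.obj M') ≫ F.map (ε.app M') = f

/-- The functor `N ↦ N^(I)`, the coproduct of `I` copies of `N`. -/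
noncomputable def copower (Y : Type u₂) [Category.{v₂} Y] (I : Type w)
    [Limits.HasCoproductsOfShape I Y] : Y ⥤ Y where
  obj N := ∐ fun _ : I => N
  map f := Limits.Sigma.map fun _ => f

variable (I : Type w) [Limits.HasCoproductsOfShape I Y]

/-- `G` is a left `E`-locally quasi-adjoint for `F`, relative to the index set `I`. -/
def IsLeftLocallyQuasiAdjoint (E : ObjectProperty X) (G : Y ⥤ X) (F : X ⥤ Y) : Prop :=
  IsLocallyLeftAdjoint E G (F ⋙ copower Y I)

/-- `F` is a right `E`-locally quasi-adjoint for `G`, relative to the index set `I`. -/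
def IsRightLocallyQuasiAdjoint (E : ObjectProperty X) (F : X ⥤ Y) (G : Y ⥤ X) : Prop :=
  IsLocallyRightAdjoint E F (copower Y I ⋙ G)

/-- `(F, G)` is an `E`-locally quasi-Frobenius pair, relative to the index set `I`: it is an
adjoint pair, `G` is a left `E`-locally quasi-adjoint for `F` and `F` is a right `E`-locally
quasi-adjoint for `G`. -/
def IsLocallyQuasiFrobeniusPair (E : ObjectProperty X) (F : X ⥤ Y) (G : Y ⥤ X) : Prop :=
  Nonempty (F ⊣ G) ∧ IsLeftLocallyQuasiAdjoint I E G F ∧ IsRightLocallyQuasiAdjoint I E F G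

/-- There is a natural transformation `J : G S F → 𝟭` such that the natural endomorphisms of `F`
induced by `J` and the natural transformations `𝟭 → F G S` act unital on `E`. -/
def HasUnitalEndLeft (E : ObjectProperty X) (F : X ⥤ Y) (G : Y ⥤ X) : Prop :=
  ∃ J : F ⋙ copower Y I ⋙ G ⟶ 𝟭 X, ActsUnitalFrom E
    {θ : F ⟶ F | ∃ β : 𝟭 Y ⟶ (copower Y I ⋙ G) ⋙ F, θ = endLeft J β}

/-- There is a natural transformation `J : G S F → 𝟭` such that the natural endomorphisms of `G`
induced by `J` and the natural transformations `𝟭 → S F G` act unital on `E`. -/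
def HasUnitalEndRight (E : ObjectProperty X) (F : X ⥤ Y) (G : Y ⥤ X) : Prop :=
  ∃ J : (F ⋙ copower Y I) ⋙ G ⟶ 𝟭 X, ActsUnitalInto E
    {θ : G ⟶ G | ∃ β : 𝟭 Y ⟶ G ⋙ F ⋙ copower Y I, θ = endRight J β}

/-- The endomorphisms of `N` that factor as `N ⟶ M ⟶ N` with second factor `j`. -/
def traceSet {M N : X} (j : M ⟶ N) : Set (N ⟶ N) := {φ | ∃ ψ : N ⟶ M, φ = ψ ≫ j}

/-- The endomorphisms of `M` that factor as `M ⟶ N ⟶ M` with first factor `j`. -/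
def cotraceSet {M N : X} (j : M ⟶ N) : Set (M ⟶ M) := {φ | ∃ ψ : N ⟶ M, φ = j ≫ ψ}

end LocallyAdjoint

/-! ### Bimodules -/

/-- The `R`-`S`-bimodules. -/
structure BimodCat (R S : Type u) [Ring R] [Ring S] where
  /-- The underlying type. -/
  carrier : Type u
  [addCommGroup : AddCommGroup carrier]
  [left : Module R carrier]
  [right : Module Sᵐᵒᵖ carrier]
  [comm : SMulCommClass R Sᵐᵒᵖ carrier]

namespace BimodCat

variable {R S : Type u} [Ring R] [Ring S]

instance : CoeSort (BimodCat R S) (Type u) := ⟨carrier⟩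

instance (M : BimodCat R S) : AddCommGroup M := M.addCommGroup

instance (M : BimodCat R S) : Module R M := M.left

instance (M : BimodCat R S) : Module Sᵐᵒᵖ M := M.right

instance (M : BimodCat R S) : SMulCommClass R Sᵐᵒᵖ M := M.comm

/-- The bimodule maps. -/
@[ext]
structure Hom (M N : BimodCat R S) where
  /-- The underlying left linear map. -/
  lin : M →ₗ[R] N
  map_op_smul : ∀ (s : Sᵐᵒᵖ) (m : M), lin (s • m) = s • lin m

instance : Category (BimodCat R S) where
  Hom := Hom
  id M := ⟨LinearMap.id, fun _ _ => rfl⟩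
  comp f g := ⟨g.lin.comp f.lin, fun s m =>
    (congrArg g.lin (f.map_op_smul s m)).trans (g.map_op_smul s _)⟩

/-- The bimodule given by a type with two commuting module structures. -/
abbrev of (R S M : Type u) [Ring R] [Ring S] [AddCommGroup M] [Module R M] [Module Sᵐᵒᵖ M]
    [SMulCommClass R Sᵐᵒᵖ M] : BimodCat R S := ⟨M⟩

/-- The map underlying a morphism of bimodules. -/
def app {M N : BimodCat R S} (f : M ⟶ N) (m : M) : N := f.lin m

@[ext]
theorem hom_ext {M N : BimodCat R S} {f g : M ⟶ N} (h : f.lin = g.lin) : f = g := Hom.ext h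

instance (M N : BimodCat R S) : Add (M ⟶ N) :=
  ⟨fun f g => ⟨f.lin + g.lin, fun s m => by
    rw [LinearMap.add_apply, LinearMap.add_apply, f.map_op_smul, g.map_op_smul, smul_add]⟩⟩

instance (M N : BimodCat R S) : Zero (M ⟶ N) :=
  ⟨⟨0, fun s m => by rw [LinearMap.zero_apply, LinearMap.zero_apply, smul_zero]⟩⟩

instance (M N : BimodCat R S) : Neg (M ⟶ N) :=
  ⟨fun f => ⟨-f.lin, fun s m => by
    rw [LinearMap.neg_apply, LinearMap.neg_apply, f.map_op_smul, smul_neg]⟩⟩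

instance (M N : BimodCat R S) : AddCommGroup (M ⟶ N) where
  add_assoc f g h := hom_ext (add_assoc f.lin g.lin h.lin)
  zero_add f := hom_ext (zero_add f.lin)
  add_zero f := hom_ext (add_zero f.lin)
  add_comm f g := hom_ext (add_comm f.lin g.lin)
  neg_add_cancel f := hom_ext (neg_add_cancel f.lin)
  nsmul := nsmulRec
  zsmul := zsmulRec

instance : Preadditive (BimodCat R S) where
  add_comp M N P f g h := hom_ext (LinearMap.ext fun m => map_add h.lin _ _)
  comp_add M N P f g h := hom_ext (LinearMap.ext fun m => rfl)

end BimodCat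

/-! ### Locally quasi-Frobenius corings -/

section QuasiFrobenius

variable (A C : Type u) [Ring A] [AddCommGroup C] [Module A C] [Module Aᵐᵒᵖ C]
  [SMulCommClass A Aᵐᵒᵖ C] [Coring A C] (I : Type u)

/-- `C^*` as a `C^*`-`A`-bimodule. -/
abbrev dualR : BimodCat (RDual A C) A := .of (RDual A C) A (RDual A C)

/-- `C^(I)` as a `C^*`-`A`-bimodule. -/
noncomputable abbrev sumR : BimodCat (RDual A C) A := .of (RDual A C) A (I →₀ C)

/-- `C` as a `C^*`-`A`-bimodule. -/
abbrev selfR : BimodCat (RDual A C) A := .of (RDual A C) A C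

/-- `(C^*)^I` as a `C^*`-`A`-bimodule. -/
abbrev powR : BimodCat (RDual A C) A := .of (RDual A C) A (I → RDual A C)

/-- `^*C` as an `A`-`^*C`-bimodule. -/
abbrev dualL : BimodCat A (LDual A C) := .of A (LDual A C) (LDual A C)

/-- `C^(I)` as an `A`-`^*C`-bimodule. -/
noncomputable abbrev sumL : BimodCat A (LDual A C) := .of A (LDual A C) (I →₀ C)

/-- `C` as an `A`-`^*C`-bimodule. -/
abbrev selfL : BimodCat A (LDual A C) := .of A (LDual A C) C

/-- `(^*C)^I` as an `A`-`^*C`-bimodule. -/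
abbrev powL : BimodCat A (LDual A C) := .of A (LDual A C) (I → LDual A C)

/-- The elements `z = (zᵢ)` of `(C^A)^(I)`: finitely supported families of elements `zᵢ` of `C`
with `a zᵢ = zᵢ a` for all `a`. -/
def invariants : Set (I →₀ C) := {z | ∀ (a : A) (i : I), a • z i = MulOpposite.op a • z i}

/-- `C` is left locally quasi-Frobenius with index set `I`: it is locally projective as a left
`A`-module, and there is an `A`-`^*C`-bilinear map `j : C → (^*C)^I` such that the maps
`c ↦ ∑ᵢ jᵢ(c)(zᵢ)` with `(zᵢ)` in `(C^A)^(I)` are dense, for the finite topology, in the bilinear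
maps `C → A`. -/
def LeftLQFOn : Prop :=
  LocProj A C ∧ ∃ j : selfL A C ⟶ powL A C I, ∀ (s : Finset C) (f : RDual A C),
    (∀ (a : A) (c : C), f (a • c) = a * f c) → ∃ z ∈ invariants A C I, ∀ c ∈ s,
      (z.sum fun i x => (BimodCat.app j c : I → LDual A C) i x) = f c

/-- `C` is right locally quasi-Frobenius with index set `I`. -/
def RightLQFOn : Prop :=
  LocProj Aᵐᵒᵖ C ∧ ∃ j : selfR A C ⟶ powR A C I, ∀ (s : Finset C) (f : LDual A C),
    (∀ (a : A) (c : C), f (MulOpposite.op a • c) = f c * a) → ∃ z ∈ invariants A C I, ∀ c ∈ s,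
      (z.sum fun i x => (BimodCat.app j c : I → RDual A C) i x) = f c

/-- `C` is left locally quasi-Frobenius. -/
def LeftLQF : Prop := ∃ I : Type u, LeftLQFOn A C I

/-- `C` is right locally quasi-Frobenius. -/
def RightLQF : Prop := ∃ I : Type u, RightLQFOn A C I

variable {A C I}

/-- The element `φ(ε)` of `C^*` that determines the bimodule endomorphism `φ` of `C^*`. -/
def evalR (φ : dualR A C ⟶ dualR A C) : RDual A C := BimodCat.app φ (1 : RDual A C)

/-- The element `φ(ε)` of `^*C` that determines the bimodule endomorphism `φ` of `^*C`. -/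
def evalL (φ : dualL A C ⟶ dualL A C) : LDual A C := BimodCat.app φ (1 : LDual A C)

/-- A set of elements of `C^*` acts with local units on `C`. -/
def LocalUnitsR (E : Set (RDual A C)) : Prop := ∀ s : Finset C, ∃ e ∈ E, ∀ c ∈ s, e • c = c

/-- A set of elements of `^*C` acts with local units on `C`. -/
def LocalUnitsL (E : Set (LDual A C)) : Prop :=
  ∀ s : Finset C, ∃ e ∈ E, ∀ c ∈ s, MulOpposite.op e • c = c

/-- A set of elements of `C^*` acts unital on every left comodule that is finitely generated and
projective over `A`. -/
def UnitalOnFgpL (E : Set (RDual A C)) : Prop :=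
  ∀ M : LComod A C, fgpL A C M → ∃ e ∈ E, ∀ m : M.A, actOnL M e m = m

/-- A set of elements of `^*C` acts unital on every right comodule that is finitely generated and
projective over `A`. -/
def UnitalOnFgpR (E : Set (LDual A C)) : Prop :=
  ∀ M : RComod A C, fgpR A C M → ∃ e ∈ E, ∀ m : M.A, actOnR M e m = m

variable (A C I)

/-- The functor `Hom(-, C^*)` on `C^*`-`A`-bimodules. -/
abbrev homIntoDualR := preadditiveYoneda.obj (dualR A C)

/-- The functor `Hom(-, C^(I))` on `C^*`-`A`-bimodules. -/
noncomputable abbrev homIntoSumR := preadditiveYoneda.obj (sumR A C I)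

/-- The functor `Hom(C^*, -)` on `C^*`-`A`-bimodules. -/
abbrev homFromDualR := preadditiveCoyoneda.obj (Opposite.op (dualR A C))

/-- The functor `Hom(C^(I), -)` on `C^*`-`A`-bimodules. -/
noncomputable abbrev homFromSumR := preadditiveCoyoneda.obj (Opposite.op (sumR A C I))

/-- The functor `Hom(-, ^*C)` on `A`-`^*C`-bimodules. -/
abbrev homIntoDualL := preadditiveYoneda.obj (dualL A C)

/-- The functor `Hom(-, C^(I))` on `A`-`^*C`-bimodules. -/
noncomputable abbrev homIntoSumL := preadditiveYoneda.obj (sumL A C I)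

/-- The functor `Hom(^*C, -)` on `A`-`^*C`-bimodules. -/
abbrev homFromDualL := preadditiveCoyoneda.obj (Opposite.op (dualL A C))

/-- The functor `Hom(C^(I), -)` on `A`-`^*C`-bimodules. -/
noncomputable abbrev homFromSumL := preadditiveCoyoneda.obj (Opposite.op (sumL A C I))

variable {A C}

/-- The endomorphism of `C^*` corresponding to an endomorphism of `Hom(-, C^*)`. -/
def endIntoR (θ : homIntoDualR A C ⟶ homIntoDualR A C) : dualR A C ⟶ dualR A C :=
  (θ.app (Opposite.op (dualR A C))).hom (𝟙 (dualR A C))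

/-- The endomorphism of `C^*` corresponding to an endomorphism of `Hom(C^*, -)`. -/
def endFromR (θ : homFromDualR A C ⟶ homFromDualR A C) : dualR A C ⟶ dualR A C :=
  (θ.app (dualR A C)).hom (𝟙 (dualR A C))

/-- The endomorphism of `^*C` corresponding to an endomorphism of `Hom(-, ^*C)`. -/
def endIntoL (θ : homIntoDualL A C ⟶ homIntoDualL A C) : dualL A C ⟶ dualL A C :=
  (θ.app (Opposite.op (dualL A C))).hom (𝟙 (dualL A C))

/-- The endomorphism of `^*C` corresponding to an endomorphism of `Hom(^*C, -)`. -/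
def endFromL (θ : homFromDualL A C ⟶ homFromDualL A C) : dualL A C ⟶ dualL A C :=
  (θ.app (dualL A C)).hom (𝟙 (dualL A C))

variable (A C)

/-- Some bilinear `j : C^(I) → C^*` has a set `{j ∘ ψ}` that acts unital on the left comodules that
are finitely generated and projective over `A`. -/
def TraceUnitalR : Prop :=
  ∃ j : sumR A C I ⟶ dualR A C, UnitalOnFgpL (evalR '' traceSet j)

/-- Some bilinear `j : C^(I) → C^*` has a set `{j ∘ ψ}` that acts with local units on `C`. -/
def TraceLocalUnitsR : Prop :=
  ∃ j : sumR A C I ⟶ dualR A C, LocalUnitsR (evalR '' traceSet j)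

/-- Some `α : Hom(-, C^(I)) → Hom(-, C^*)` has a set `{α ∘ β}` that acts with local units on
`C`. -/
def YonedaLocalUnitsR : Prop :=
  ∃ α : homIntoSumR A C I ⟶ homIntoDualR A C,
    LocalUnitsR ((fun θ => evalR (endIntoR θ)) '' traceSet α)

/-- Some `α : Hom(C^*, -) → Hom(C^(I), -)` has a set `{β ∘ α}` that acts with local units on
`C`. -/
def CoyonedaLocalUnitsR : Prop :=
  ∃ α : homFromDualR A C ⟶ homFromSumR A C I,
    LocalUnitsR ((fun θ => evalR (endFromR θ)) '' cotraceSet α)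

/-- Some bilinear `j : C^(I) → ^*C` has a set `{j ∘ ψ}` that acts unital on the right comodules
that are finitely generated and projective over `A`. -/
def TraceUnitalL : Prop :=
  ∃ j : sumL A C I ⟶ dualL A C, UnitalOnFgpR (evalL '' traceSet j)

/-- Some bilinear `j : C^(I) → ^*C` has a set `{j ∘ ψ}` that acts with local units on `C`. -/
def TraceLocalUnitsL : Prop :=
  ∃ j : sumL A C I ⟶ dualL A C, LocalUnitsL (evalL '' traceSet j)

/-- Some `α : Hom(-, C^(I)) → Hom(-, ^*C)` has a set `{α ∘ β}` that acts with local units on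
`C`. -/
def YonedaLocalUnitsL : Prop :=
  ∃ α : homIntoSumL A C I ⟶ homIntoDualL A C,
    LocalUnitsL ((fun θ => evalL (endIntoL θ)) '' traceSet α)

/-- Some `α : Hom(^*C, -) → Hom(C^(I), -)` has a set `{β ∘ α}` that acts with local units on
`C`. -/
def CoyonedaLocalUnitsL : Prop :=
  ∃ α : homFromDualL A C ⟶ homFromSumL A C I,
    LocalUnitsL ((fun θ => evalL (endFromL θ)) '' cotraceSet α)

end QuasiFrobenius

end LQF

/-!
Every condition in the theorem is a way to speak of families of *balanced forms*: bilinear maps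
`σ : C ⊗_A C → A` of `A`-bimodules with `x₁ σ(x₂, c) = σ(x, c₁) c₂` (`BalancedForm`). Put
`F : M^C → M_A` and `F' : ^CM → _AM` for the forgetful functors, `G` and `G'` for their right
adjoints.

* The identity of a balanced form implies that `c ↦ σ(-, c)` is `^*C`-linear, and also that
  `x ↦ σ(x, -)` is `C^*`-linear. If `^*C` (or `C^*`) separates the elements of `C`, which it does
  when `C` is locally projective on that side, then all bilinear maps `C → ^*C` (or `C → C^*`) arise
  in this way (`BalancedForm.ofL`, `BalancedForm.ofR`).
* A natural transformation `J : G S F → 1` is determined, by naturality for the coactions and for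
  the morphisms `n ⊗ - : C → N ⊗_A C`, by the forms `σᵢ(x, c) = ε(J_C(x ⊗ c))`, where `x` lies in
  the summand `i`; these are balanced since `J_C` is colinear. Conversely balanced forms define
  `J_M(m ⊗ c) = m₀ σᵢ(m₁, c)`. No local projectivity is needed here. The functors `F'`, `G'` give
  the same forms (`natTransR_eq`, `natTransOfFormR` and their left versions).
* The remaining data, that is, the natural transformations `β` out of an identity functor and the
  bilinear maps `ψ : C^* → C^(I)`, amount to finitely supported families `z = (zᵢ)` of elements of
  `C` with `a zᵢ = zᵢ a`: evaluate `β` at `A` and `ψ` at `ε`.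

In these terms each condition asks for a family `σ` such that every finite subset of `C` is fixed by
some `e = ∑ᵢ σᵢ(zᵢ, -)` in `C^*` (`LeftUnital`), or by some `∑ᵢ σᵢ(-, zᵢ)` in `^*C` for the dual
conditions (`RightUnital`). The composite of `J` and `β` is the action of this `e`. For `(F', G')`
that is an action on left comodules, but for `(F, G)` and a natural endomorphism of `G` it is
`N ⊗ e`, on the factor `C` of `N ⊗_A C`; this is why left local units are controlled both by `F'`
and by `G`.

Two finiteness arguments connect the conditions on comodules that are finitely generated and
projective over `A` with those on finite subsets of `C`. Elements of a tensor product involve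
finitely many pure tensors, so that `e` fixes given generators of a comodule as soon as it agrees
with `ε` on finitely many elements of `C` (`leftUnital_iff`). And since these comodules generate,
finite direct sums show that every finite subset of `C` lies in the image of one of them
(`exists_hom_of_isSeparating`).

Finally, `c = ∑ᵢ σᵢ(zᵢ, c₁) c₂ = ∑ᵢ zᵢ₁ σᵢ(zᵢ₂, c)` is a dual basis expansion for the right module
`C`, so left local units force local projectivity on the right (`LeftUnital.locProj`). For the pairs
of functors, both kinds of local units are combined into one index set by taking disjoint unions.
-/


namespace LQF

/-! ### Balanced forms -/

section BalancedForms

variable {A C : Type u} [Ring A] [AddCommGroup C] [Module A C] [Module Aᵐᵒᵖ C]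
  [SMulCommClass A Aᵐᵒᵖ C]

/-- Two additive maps out of `M ⊗_A N` agree at `y` as soon as they agree on the pure tensors
`m ⊗ n`, where `n` runs through a finite set that depends on `y` only. -/
theorem BT.exists_finset_right {M N : Type u} [AddCommGroup M] [Module Aᵐᵒᵖ M] [AddCommGroup N]
    [Module A N] (y : BT A M N) : ∃ s : Finset N, ∀ (P : Type u) [AddCommGroup P]
      (Φ Ψ : BT A M N →+ P), (∀ m, ∀ n ∈ s, Φ (BT.tmul A m n) = Ψ (BT.tmul A m n)) →
        Φ y = Ψ y := by
  classical
  induction y using BT.induction with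
  | h0 => exact ⟨∅, fun P _ Φ Ψ _ => by rw [map_zero, map_zero]⟩
  | ht m n => exact ⟨{n}, fun P _ Φ Ψ h => h m n (Finset.mem_singleton_self n)⟩
  | ha x y hx hy =>
    obtain ⟨s, hs⟩ := hx
    obtain ⟨t, ht⟩ := hy
    refine ⟨s ∪ t, fun P _ Φ Ψ h => ?_⟩
    rw [map_add, map_add, hs P Φ Ψ fun m n hn => h m n (Finset.mem_union_left t hn),
      ht P Φ Ψ fun m n hn => h m n (Finset.mem_union_right s hn)]

/-- Two additive maps out of `M ⊗_A N` agree at `y` as soon as they agree on the pure tensors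
`m ⊗ n`, where `m` runs through a finite set that depends on `y` only. -/
theorem BT.exists_finset_left {M N : Type u} [AddCommGroup M] [Module Aᵐᵒᵖ M] [AddCommGroup N]
    [Module A N] (y : BT A M N) : ∃ s : Finset M, ∀ (P : Type u) [AddCommGroup P]
      (Φ Ψ : BT A M N →+ P), (∀ m ∈ s, ∀ n, Φ (BT.tmul A m n) = Ψ (BT.tmul A m n)) →
        Φ y = Ψ y := by
  classical
  induction y using BT.induction with
  | h0 => exact ⟨∅, fun P _ Φ Ψ _ => by rw [map_zero, map_zero]⟩
  | ht m n => exact ⟨{m}, fun P _ Φ Ψ h => h m (Finset.mem_singleton_self m) n⟩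
  | ha x y hx hy =>
    obtain ⟨s, hs⟩ := hx
    obtain ⟨t, ht⟩ := hy
    refine ⟨s ∪ t, fun P _ Φ Ψ h => ?_⟩
    rw [map_add, map_add, hs P Φ Ψ fun m hm n => h m (Finset.mem_union_left t hm) n,
      ht P Φ Ψ fun m hm n => h m (Finset.mem_union_right s hm) n]

variable [Coring A C]

/-- Both sides are `f(c₁) g(c₂)`. -/
theorem LDual.apply_smul (g : LDual A C) (f : RDual A C) (c : C) :
    g (f • c) = f (MulOpposite.op g • c) := by
  rw [RDual.smul_def, LDual.op_smul_def]
  induction (Coring.comul c : BT A C C) using BT.induction with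
  | h0 => simp only [map_zero]
  | ht m n =>
    rw [BT.contrL_tmul, BT.contrR_tmul, RDual.map_op_smul, LDual.map_smul]
    rfl
  | ha x y hx hy => simp only [map_add, hx, hy]

theorem RDual.counit_smul (f : RDual A C) (c : C) :
    Coring.counit (A := A) (f • c) = f c := by
  have h := LDual.apply_smul (1 : LDual A C) f c
  rwa [MulOpposite.op_one, one_smul] at h

theorem LDual.counit_smul (g : LDual A C) (c : C) :
    Coring.counit (A := A) (MulOpposite.op g • c) = g c := by
  have h := LDual.apply_smul g (1 : RDual A C) c
  rw [one_smul] at h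
  exact h.symm

/-- The element `ε a` of `C^*` acts on `C` as left multiplication by `a`. -/
theorem RDual.op_smul_one_smul (a : A) (c : C) :
    (MulOpposite.op a • (1 : RDual A C)) • c = a • c := by
  rw [RDual.smul_def]
  refine (BT.contrL_smul _ _ _).trans ?_
  rw [← map_smul]
  exact RDual.act_one (a • c)

/-- The element `a ε` of `^*C` acts on `C` as right multiplication by `a`. -/
theorem LDual.op_smul_one_smul (a : A) (c : C) :
    MulOpposite.op (a • (1 : LDual A C)) • c = MulOpposite.op a • c := by
  rw [LDual.op_smul_def, BT.contrR_op_smul, ← Coring.comul_op_smul]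
  exact LDual.act_one (MulOpposite.op a • c)

theorem RDual.smul_smul_of_bilinear {f : RDual A C} (hf : ∀ (a : A) (c : C), f (a • c) = a * f c)
    (a : A) (c : C) : f • a • c = a • f • c := by
  rw [← RDual.op_smul_one_smul (A := A) a c, ← RDual.op_smul_one_smul (A := A) a (f • c), smul_smul,
    smul_smul]
  congr 1
  refine RDual.ext fun d => ?_
  rw [RDual.mul_apply, RDual.mul_apply]
  change f ((MulOpposite.op a • (1 : RDual A C)) • d) = Coring.counit (a • f • d)
  rw [RDual.op_smul_one_smul, hf, map_smul, RDual.counit_smul]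
  rfl

theorem LDual.smul_smul_of_bilinear {f : LDual A C}
    (hf : ∀ (a : A) (c : C), f (MulOpposite.op a • c) = f c * a)
    (a : A) (c : C) : MulOpposite.op f • MulOpposite.op a • c =
      MulOpposite.op a • MulOpposite.op f • c := by
  rw [← LDual.op_smul_one_smul (A := A) a c,
    ← LDual.op_smul_one_smul (A := A) a (MulOpposite.op f • c), smul_smul, smul_smul,
    ← MulOpposite.op_mul, ← MulOpposite.op_mul]
  congr 2
  refine LDual.ext fun d => ?_
  rw [LDual.mul_apply, LDual.mul_apply]
  change f (MulOpposite.op (a • (1 : LDual A C)) • d) =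
    Coring.counit (MulOpposite.op a • MulOpposite.op f • d)
  rw [LDual.op_smul_one_smul, hf, Coring.counit_op_smul, LDual.counit_smul]
  rfl

variable (A C) in
/-- A bilinear form `σ : C ⊗_A C → A` of `A`-bimodules with `x₁ σ(x₂, c) = σ(x, c₁) c₂`. It is
recorded by its partial maps: `L c = σ(-, c)` is left linear and `R x = σ(x, -)` is right linear,
and the displayed identity relates the actions of `^*C` and `C^*` on `C`. -/
structure BalancedForm where
  /-- `L c` is the left linear map `σ(-, c)`. -/
  L : C → LDual A C
  /-- `R x` is the right linear map `σ(x, -)`. -/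
  R : C → RDual A C
  L_apply : ∀ c x, L c x = R x c
  L_op_smul : ∀ (a : A) (c x : C), L c (MulOpposite.op a • x) = L (a • c) x
  op_L_smul : ∀ c x, MulOpposite.op (L c) • x = R x • c

namespace BalancedForm

variable (σ : BalancedForm A C)

theorem L_add (c d : C) : σ.L (c + d) = σ.L c + σ.L d := LDual.ext fun x => by
  change _ = σ.L c x + σ.L d x
  rw [σ.L_apply, σ.L_apply, σ.L_apply, map_add]

theorem R_add (x y : C) : σ.R (x + y) = σ.R x + σ.R y := RDual.ext fun c => by
  change _ = σ.R x c + σ.R y c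
  rw [← σ.L_apply, ← σ.L_apply, ← σ.L_apply, map_add]

theorem L_smul (a : A) (c : C) : σ.L (a • c) = a • σ.L c :=
  LDual.ext fun x => (σ.L_op_smul a c x).symm

theorem R_op_smul (a : A) (x : C) : σ.R (MulOpposite.op a • x) = MulOpposite.op a • σ.R x :=
  RDual.ext fun c => by
    rw [RDual.smul_apply, ← σ.L_apply, ← σ.L_apply, σ.L_op_smul]

/-- `L` is linear over `^*C`: `g(x₁ σ(x₂, c)) = g(σ(x, c₁) c₂) = σ(x, c₁ g(c₂))`. -/
theorem L_op_dual_smul (g : LDual A C) (c : C) : σ.L (MulOpposite.op g • c) = σ.L c * g :=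
  LDual.ext fun x => by
    change _ = g (MulOpposite.op (σ.L c) • x)
    rw [σ.op_L_smul, σ.L_apply, LDual.apply_smul]

/-- `R` is linear over `C^*`: `f(σ(x, c₁) c₂) = f(x₁ σ(x₂, c)) = σ(f(x₁) x₂, c)`. -/
theorem R_dual_smul (f : RDual A C) (x : C) : σ.R (f • x) = f * σ.R x :=
  RDual.ext fun c => by
    change _ = f (σ.R x • c)
    rw [← σ.op_L_smul, ← σ.L_apply, LDual.apply_smul]

theorem R_zero : σ.R 0 = 0 := RDual.ext fun c => by
  rw [← σ.L_apply, map_zero]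
  rfl

theorem L_zero : σ.L 0 = 0 := LDual.ext fun c => by
  rw [σ.L_apply, map_zero]
  rfl

/-- An `A`-`^*C`-bilinear map `C → ^*C` is the partial map `L` of a balanced form, if `^*C`
separates the elements of `C`. -/
def ofL (hsep : ∀ c d : C, (∀ g : LDual A C, g c = g d) → c = d) (j : C →+ LDual A C)
    (hs : ∀ (a : A) (c : C), j (a • c) = a • j c)
    (hd : ∀ (g : LDual A C) (c : C), j (MulOpposite.op g • c) = j c * g) : BalancedForm A C :=
  let R (x : C) : RDual A C := (show C →ₗ[Aᵐᵒᵖ] A from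
    { toFun := fun c => j c x
      map_add' := fun c d => by rw [map_add]; rfl
      map_smul' := fun a c => by
        induction a using MulOpposite.rec' with
        | h a =>
          change j (MulOpposite.op a • c) x = j c x * a
          rw [← LDual.op_smul_one_smul, hd]
          change Coring.counit (MulOpposite.op a • MulOpposite.op (j c) • x) = _
          rw [Coring.counit_op_smul, LDual.counit_smul]
          rfl })
  { L := j
    R := R
    L_apply := fun c x => rfl
    L_op_smul := fun a c x => by rw [hs]; rfl
    op_L_smul := fun c x => hsep _ _ fun g => by
      rw [LDual.apply_smul]
      change _ = j (MulOpposite.op g • c) x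
      rw [hd]
      rfl }

/-- A `C^*`-`A`-bilinear map `C → C^*` is the partial map `R` of a balanced form, if `C^*`
separates the elements of `C`. -/
def ofR (hsep : ∀ c d : C, (∀ f : RDual A C, f c = f d) → c = d) (j : C →+ RDual A C)
    (hs : ∀ (a : A) (c : C), j (MulOpposite.op a • c) = MulOpposite.op a • j c)
    (hd : ∀ (f : RDual A C) (c : C), j (f • c) = f * j c) : BalancedForm A C :=
  let L (c : C) : LDual A C := (show C →ₗ[A] A from
    { toFun := fun x => j x c
      map_add' := fun x y => by rw [map_add]; rfl
      map_smul' := fun a x => by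
        rw [← RDual.op_smul_one_smul, hd]
        change Coring.counit (a • j x • c) = _
        rw [map_smul, RDual.counit_smul]
        rfl })
  { L := L
    R := j
    L_apply := fun c x => rfl
    L_op_smul := fun a c x => by
      change j (MulOpposite.op a • x) c = _
      rw [hs]; rfl
    op_L_smul := fun c x => hsep _ _ fun f => by
      rw [← LDual.apply_smul]
      change j (f • x) c = _
      rw [hd]
      rfl }

end BalancedForm

/-! ### Local units -/

variable (A C) in
theorem smul_mem_invariants {I : Type u} {f : RDual A C}
    (hf : ∀ (a : A) (c : C), f (a • c) = a * f c) {z : I →₀ C} (hz : z ∈ invariants A C I) :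
    f • z ∈ invariants A C I := fun a i => by
  rw [Finsupp.smul_apply, ← RDual.smul_smul_of_bilinear hf, hz a i, smul_comm]

variable (A C) in
theorem op_smul_mem_invariants {I : Type u} {f : LDual A C}
    (hf : ∀ (a : A) (c : C), f (MulOpposite.op a • c) = f c * a) {z : I →₀ C}
    (hz : z ∈ invariants A C I) : MulOpposite.op f • z ∈ invariants A C I := fun a i => by
  rw [Finsupp.smul_apply, ← LDual.smul_smul_of_bilinear hf, ← hz a i, smul_comm]

variable {I : Type u}

/-- The element `∑ᵢ σᵢ(zᵢ, -)` of `C^*`. -/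
noncomputable def sumFormR (σ : I → BalancedForm A C) (z : I →₀ C) : RDual A C :=
  z.sum fun i x => (σ i).R x

/-- The element `∑ᵢ σᵢ(-, zᵢ)` of `^*C`. -/
noncomputable def sumFormL (σ : I → BalancedForm A C) (z : I →₀ C) : LDual A C :=
  z.sum fun i x => (σ i).L x

/-- Evaluation at `c` as an additive map on `C^*`. -/
def RDual.evalAt (c : C) : RDual A C →+ A := AddMonoidHom.mk' (fun f => f c) fun _ _ => rfl

/-- Evaluation at `c` as an additive map on `^*C`. -/
def LDual.evalAt (c : C) : LDual A C →+ A := AddMonoidHom.mk' (fun f => f c) fun _ _ => rfl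

theorem sumFormR_apply (σ : I → BalancedForm A C) (z : I →₀ C) (c : C) :
    sumFormR σ z c = z.sum fun i x => (σ i).R x c :=
  map_finsuppSum (RDual.evalAt c) z _

theorem sumFormL_apply (σ : I → BalancedForm A C) (z : I →₀ C) (c : C) :
    sumFormL σ z c = z.sum fun i x => (σ i).L x c :=
  map_finsuppSum (LDual.evalAt c) z _

theorem sumFormR_smul (σ : I → BalancedForm A C) (z : I →₀ C) (c : C) :
    sumFormR σ z • c = z.sum fun i x => (σ i).R x • c :=
  map_finsuppSum ((smulAddHom (RDual A C) C).flip c) z _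

theorem sumFormL_smul (σ : I → BalancedForm A C) (z : I →₀ C) (c : C) :
    MulOpposite.op (sumFormL σ z) • c = z.sum fun i x => MulOpposite.op ((σ i).L x) • c :=
  map_finsuppSum (((smulAddHom (LDual A C)ᵐᵒᵖ C).flip c).comp
    (MulOpposite.opAddEquiv : LDual A C ≃+ _).toAddMonoidHom) z _

theorem sumFormR_bilinear (σ : I → BalancedForm A C) {z : I →₀ C} (hz : z ∈ invariants A C I)
    (a : A) (c : C) : sumFormR σ z (a • c) = a * sumFormR σ z c := by
  rw [sumFormR_apply, sumFormR_apply, Finsupp.sum, Finsupp.sum, Finset.mul_sum]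
  refine Finset.sum_congr rfl fun i _ => ?_
  rw [← RDual.smul_apply, ← (σ i).R_op_smul, ← hz a i, ← (σ i).L_apply, LDual.map_smul,
    (σ i).L_apply]

theorem sumFormL_bilinear (σ : I → BalancedForm A C) {z : I →₀ C} (hz : z ∈ invariants A C I)
    (a : A) (c : C) : sumFormL σ z (MulOpposite.op a • c) = sumFormL σ z c * a := by
  rw [sumFormL_apply, sumFormL_apply, Finsupp.sum, Finsupp.sum, Finset.sum_mul]
  refine Finset.sum_congr rfl fun i _ => ?_
  rw [← LDual.smul_apply, ← (σ i).L_smul, hz a i, (σ i).L_apply, RDual.map_op_smul,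
    (σ i).L_apply]

/-- The elements `∑ᵢ σᵢ(zᵢ, -)` of `C^*`, with `(zᵢ)` invariant, act with local units on `C`. -/
def LeftUnital (σ : I → BalancedForm A C) : Prop :=
  ∀ s : Finset C, ∃ z ∈ invariants A C I, ∀ c ∈ s, sumFormR σ z • c = c

/-- The elements `∑ᵢ σᵢ(-, zᵢ)` of `^*C`, with `(zᵢ)` invariant, act with local units on `C`. -/
def RightUnital (σ : I → BalancedForm A C) : Prop :=
  ∀ s : Finset C, ∃ z ∈ invariants A C I, ∀ c ∈ s, MulOpposite.op (sumFormL σ z) • c = c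

/-- To act as a local unit it suffices to agree with the counit on a finite set: on `c` the action
is determined by the values on the first tensor factors of `c₁ ⊗ c₂`. -/
theorem leftUnital_iff (σ : I → BalancedForm A C) : LeftUnital σ ↔
    ∀ s : Finset C, ∃ z ∈ invariants A C I, ∀ c ∈ s, sumFormR σ z c = Coring.counit c := by
  classical
  constructor
  · intro h s
    obtain ⟨z, hz, hs⟩ := h s
    exact ⟨z, hz, fun c hc => by rw [← RDual.counit_smul, hs c hc]⟩
  · intro h s
    choose t ht using fun c : C => BT.exists_finset_left (Coring.comul (A := A) c)
    obtain ⟨z, hz, hs⟩ := h (s.biUnion t)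
    refine ⟨z, hz, fun c hc => ?_⟩
    refine Eq.trans ?_ (one_smul (RDual A C) c)
    refine ht c C (BT.contrL (sumFormR σ z).lin) (BT.contrL (1 : RDual A C).lin) fun m hm n => ?_
    exact congrArg (· • n) (hs m (Finset.mem_biUnion.2 ⟨c, hc, hm⟩))

theorem rightUnital_iff (σ : I → BalancedForm A C) : RightUnital σ ↔
    ∀ s : Finset C, ∃ z ∈ invariants A C I, ∀ c ∈ s, sumFormL σ z c = Coring.counit c := by
  classical
  constructor
  · intro h s
    obtain ⟨z, hz, hs⟩ := h s
    exact ⟨z, hz, fun c hc => by rw [← LDual.counit_smul, hs c hc]⟩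
  · intro h s
    choose t ht using fun c : C => BT.exists_finset_right (Coring.comul (A := A) c)
    obtain ⟨z, hz, hs⟩ := h (s.biUnion t)
    refine ⟨z, hz, fun c hc => ?_⟩
    refine Eq.trans ?_ (one_smul (LDual A C)ᵐᵒᵖ c)
    refine ht c C (BT.contrR (sumFormL σ z).lin) (BT.contrR (1 : LDual A C).lin) fun m n hn => ?_
    exact congrArg (fun a => MulOpposite.op a • m) (hs n (Finset.mem_biUnion.2 ⟨c, hc, hn⟩))

end BalancedForms

/-! ### Local projectivity -/

/-- The dual of a locally projective module separates its elements. -/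
theorem LocProj.eq_of_dual {R M : Type u} [Ring R] [AddCommGroup M] [Module R M]
    (h : LocProj R M) {x y : M} (hxy : ∀ φ : M →ₗ[R] R, φ x = φ y) : x = y := by
  -- lift the identity of `M` through the canonical map from a free module onto `M`
  obtain ⟨k, hk⟩ := h (Submodule.span R {x - y}) (Submodule.fg_span_singleton _) (M →₀ R) M
    (Finsupp.linearCombination R id) (Finsupp.linearCombination_id_surjective R M) LinearMap.id
  have h0 : k (x - y) = 0 := Finsupp.ext fun m => by
    rw [map_sub, Finsupp.sub_apply, Finsupp.zero_apply, sub_eq_zero]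
    exact hxy ((Finsupp.lapply m).comp k)
  have h1 := hk _ (Submodule.mem_span_singleton_self (x - y))
  rw [h0, map_zero] at h1
  exact sub_eq_zero.1 h1.symm

section

theorem LocProj.eq_of_lDual {A C : Type u} [Ring A] [AddCommGroup C] [Module A C]
    (h : LocProj A C) (c d : C) (hcd : ∀ g : LDual A C, g c = g d) : c = d :=
  h.eq_of_dual hcd

theorem LocProj.eq_of_rDual {A C : Type u} [Ring A] [AddCommGroup C] [Module Aᵐᵒᵖ C]
    (h : LocProj Aᵐᵒᵖ C) (c d : C) (hcd : ∀ f : RDual A C, f c = f d) : c = d :=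
  h.eq_of_dual fun φ => by
    let f : C →ₗ[Aᵐᵒᵖ] A := ((MulOpposite.opLinearEquiv Aᵐᵒᵖ (M := A)).symm.toLinearMap).comp φ
    exact MulOpposite.unop_injective (hcd f)

variable {A C : Type u} [Ring A] [AddCommGroup C] [Module A C] [Module Aᵐᵒᵖ C]
  [SMulCommClass A Aᵐᵒᵖ C] [Coring A C] {I : Type u}

/-- For `y = ∑ m ⊗ n`, the right linear map `c ↦ ∑ g(m) σ(n, c)` lifts through a surjection `f`:
replace the finitely many values `g(m)` by preimages. -/
theorem BalancedForm.exists_lift_R (σ : BalancedForm A C) {N' N : Type u} [AddCommGroup N']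
    [Module Aᵐᵒᵖ N'] [AddCommGroup N] [Module Aᵐᵒᵖ N] {f : N' →ₗ[Aᵐᵒᵖ] N}
    (hf : Function.Surjective f) (g : C →ₗ[Aᵐᵒᵖ] N) (y : BT A C C) :
    ∃ h : C →ₗ[Aᵐᵒᵖ] N', ∀ c, f (h c) = g (BT.contrR (σ.L c).lin y) := by
  induction y using BT.induction with
  | h0 => exact ⟨0, fun c => by simp only [LinearMap.zero_apply, map_zero]⟩
  | ht m n =>
    obtain ⟨n', hn'⟩ := hf (g m)
    refine ⟨⟨⟨fun c => MulOpposite.op (σ.R n c) • n', fun c d => ?_⟩, fun a c => ?_⟩, fun c => ?_⟩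
    · rw [map_add, MulOpposite.op_add, add_smul]
    · induction a using MulOpposite.rec' with
      | h a =>
        change MulOpposite.op (σ.R n (MulOpposite.op a • c)) • n' = _
        rw [RDual.map_op_smul, MulOpposite.op_mul, mul_smul]
        rfl
    · change f (MulOpposite.op (σ.R n c) • n') = g (MulOpposite.op (σ.L c n) • m)
      rw [map_smul, map_smul, hn', σ.L_apply]
  | ha x y hx hy =>
    obtain ⟨h, hh⟩ := hx
    obtain ⟨k, hk⟩ := hy
    exact ⟨h + k, fun c => by rw [LinearMap.add_apply, map_add, map_add, map_add, hh, hk]⟩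

theorem BalancedForm.exists_lift_L (σ : BalancedForm A C) {N' N : Type u} [AddCommGroup N']
    [Module A N'] [AddCommGroup N] [Module A N] {f : N' →ₗ[A] N}
    (hf : Function.Surjective f) (g : C →ₗ[A] N) (y : BT A C C) :
    ∃ h : C →ₗ[A] N', ∀ c, f (h c) = g (BT.contrL (σ.R c).lin y) := by
  induction y using BT.induction with
  | h0 => exact ⟨0, fun c => by simp only [LinearMap.zero_apply, map_zero]⟩
  | ht m n =>
    obtain ⟨n', hn'⟩ := hf (g n)
    refine ⟨⟨⟨fun c => σ.L m c • n', fun c d => ?_⟩, fun a c => ?_⟩, fun c => ?_⟩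
    · rw [map_add, add_smul]
    · change σ.L m (a • c) • n' = _
      rw [LDual.map_smul, mul_smul]
      rfl
    · change f (σ.L m c • n') = g (σ.R c m • n)
      rw [map_smul, map_smul, hn', σ.L_apply]
  | ha x y hx hy =>
    obtain ⟨h, hh⟩ := hx
    obtain ⟨k, hk⟩ := hy
    exact ⟨h + k, fun c => by rw [LinearMap.add_apply, map_add, map_add, map_add, hh, hk]⟩

/-- If `c = ∑ᵢ σᵢ(zᵢ, c₁) c₂` then `c = ∑ᵢ zᵢ₁ σᵢ(zᵢ₂, c)`, and this expansion of `c` as a right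
linear combination of fixed elements is linear in `c`: it is a local dual basis. -/
theorem LeftUnital.locProj {σ : I → BalancedForm A C} (h : LeftUnital σ) : LocProj Aᵐᵒᵖ C := by
  rintro P ⟨s, rfl⟩ N' N _ _ _ _ f hf g
  obtain ⟨z, -, hz⟩ := h s
  choose k hk using fun i => (σ i).exists_lift_R hf g (Coring.comul (A := A) (z i))
  have key : ∀ c, f ((∑ i ∈ z.support, k i) c) = g (sumFormR σ z • c) := fun c => by
    rw [sumFormR_smul, Finsupp.sum, map_sum, LinearMap.sum_apply, map_sum]
    refine Finset.sum_congr rfl fun i _ => ?_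
    rw [hk, ← (σ i).op_L_smul]
    rfl
  refine ⟨∑ i ∈ z.support, k i, fun m hm => ?_⟩
  exact LinearMap.eqOn_span (f := f.comp (∑ i ∈ z.support, k i)) (g := g)
    (fun c hc => (key c).trans (congrArg g (hz c hc))) hm

theorem RightUnital.locProj {σ : I → BalancedForm A C} (h : RightUnital σ) : LocProj A C := by
  rintro P ⟨s, rfl⟩ N' N _ _ _ _ f hf g
  obtain ⟨z, -, hz⟩ := h s
  choose k hk using fun i => (σ i).exists_lift_L hf g (Coring.comul (A := A) (z i))
  have key : ∀ c, f ((∑ i ∈ z.support, k i) c) =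
      g (MulOpposite.op (sumFormL σ z) • c) := fun c => by
    rw [sumFormL_smul, Finsupp.sum, map_sum, LinearMap.sum_apply, map_sum]
    refine Finset.sum_congr rfl fun i _ => ?_
    rw [hk, (σ i).op_L_smul]
    rfl
  refine ⟨∑ i ∈ z.support, k i, fun m hm => ?_⟩
  exact LinearMap.eqOn_span (f := f.comp (∑ i ∈ z.support, k i)) (g := g)
    (fun c hc => (key c).trans (congrArg g (hz c hc))) hm

/-! ### Locally quasi-Frobenius corings and balanced forms -/

theorem sumFormR_dual_smul (σ : I → BalancedForm A C) (f : RDual A C) (z : I →₀ C) :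
    sumFormR σ (f • z) = f * sumFormR σ z := by
  rw [sumFormR, Finsupp.sum_smul_index' fun i => (σ i).R_zero]
  simp only [BalancedForm.R_dual_smul]
  exact (map_finsuppSum (AddMonoidHom.mulLeft f) z _).symm

theorem sumFormL_dual_smul (σ : I → BalancedForm A C) (g : LDual A C) (z : I →₀ C) :
    sumFormL σ (MulOpposite.op g • z) = sumFormL σ z * g := by
  rw [sumFormL, Finsupp.sum_smul_index' fun i => (σ i).L_zero]
  simp only [BalancedForm.L_op_dual_smul]
  exact (map_finsuppSum (AddMonoidHom.mulRight g) z _).symm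

/-- If `e = ∑ᵢ σᵢ(zᵢ, -)` acts as a local unit, then a bilinear map `f` is approximated by
`f e = ∑ᵢ σᵢ(f · zᵢ, -)`, so that density has to be checked at the counit only. -/
theorem leftLQFOn_iff (h : LocProj A C) :
    LeftLQFOn A C I ↔ ∃ σ : I → BalancedForm A C, LeftUnital σ := by
  constructor
  · rintro ⟨-, j, hj⟩
    let jj (i : I) : C →+ LDual A C := AddMonoidHom.mk'
      (fun c => (BimodCat.app j c : I → LDual A C) i) fun c d => congrFun (map_add j.lin c d) i
    refine ⟨fun i => BalancedForm.ofL h.eq_of_lDual (jj i)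
      (fun a c => congrFun (map_smul j.lin a c) i)
      fun g c => congrFun (j.map_op_smul (MulOpposite.op g) c) i, ?_⟩
    rw [leftUnital_iff]
    intro s
    obtain ⟨z, hz, hs⟩ := hj s 1 fun a c => map_smul (Coring.counit (A := A) (C := C)) a c
    refine ⟨z, hz, fun c hc => ?_⟩
    rw [sumFormR_apply]
    exact hs c hc
  · rintro ⟨σ, hσ⟩
    refine ⟨h, (⟨⟨⟨fun c i => (σ i).L c, fun c d => funext fun i => (σ i).L_add c d⟩,
      fun a c => funext fun i => (σ i).L_smul a c⟩,
      fun g c => funext fun i => (σ i).L_op_dual_smul g.unop c⟩ : BimodCat.Hom _ _), ?_⟩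
    intro s f hf
    obtain ⟨z, hz, hs⟩ := hσ s
    refine ⟨f • z, smul_mem_invariants A C hf hz, fun c hc => ?_⟩
    have h1 := congrArg (fun k : RDual A C => k c) (sumFormR_dual_smul σ f z)
    simp only [sumFormR_apply] at h1
    refine Eq.trans (Finsupp.sum_congr fun i _ => (σ i).L_apply c _) (h1.trans ?_)
    exact congrArg f (hs c hc)

theorem rightLQFOn_iff (h : LocProj Aᵐᵒᵖ C) :
    RightLQFOn A C I ↔ ∃ σ : I → BalancedForm A C, RightUnital σ := by
  constructor
  · rintro ⟨-, j, hj⟩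
    let jj (i : I) : C →+ RDual A C := AddMonoidHom.mk'
      (fun c => (BimodCat.app j c : I → RDual A C) i) fun c d => congrFun (map_add j.lin c d) i
    refine ⟨fun i => BalancedForm.ofR h.eq_of_rDual (jj i)
      (fun a c => congrFun (j.map_op_smul (MulOpposite.op a) c) i)
      fun f c => congrFun (map_smul j.lin f c) i, ?_⟩
    rw [rightUnital_iff]
    intro s
    obtain ⟨z, hz, hs⟩ := hj s 1 fun a c => Coring.counit_op_smul (MulOpposite.op a) c
    refine ⟨z, hz, fun c hc => ?_⟩
    rw [sumFormL_apply]
    exact hs c hc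
  · rintro ⟨σ, hσ⟩
    refine ⟨h, (⟨⟨⟨fun c i => (σ i).R c, fun c d => funext fun i => (σ i).R_add c d⟩,
      fun f c => funext fun i => (σ i).R_dual_smul f c⟩,
      fun a c => funext fun i => (σ i).R_op_smul a.unop c⟩ : BimodCat.Hom _ _), ?_⟩
    intro s f hf
    obtain ⟨z, hz, hs⟩ := hσ s
    refine ⟨MulOpposite.op f • z, op_smul_mem_invariants A C hf hz, fun c hc => ?_⟩
    have h1 := congrArg (fun k : LDual A C => k c) (sumFormL_dual_smul σ f z)
    simp only [sumFormL_apply] at h1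
    refine Eq.trans (Finsupp.sum_congr fun i _ => ((σ i).L_apply _ c).symm) (h1.trans ?_)
    exact congrArg f (hs c hc)

theorem sumFormR_single (σ : I → BalancedForm A C) (i : I) (x : C) :
    sumFormR σ (Finsupp.single i x) = (σ i).R x :=
  Finsupp.sum_single_index (σ i).R_zero

theorem sumFormL_single (σ : I → BalancedForm A C) (i : I) (x : C) :
    sumFormL σ (Finsupp.single i x) = (σ i).L x :=
  Finsupp.sum_single_index (σ i).L_zero

/-! ### Bilinear endomorphisms of the dual rings that factor through `C^(I)` -/

/-- A family of balanced forms as a bilinear map `C^(I) → C^*`. -/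
noncomputable def sumFormRHom (σ : I → BalancedForm A C) : sumR A C I ⟶ dualR A C :=
  (⟨⟨⟨sumFormR σ, fun z w => Finsupp.sum_add_index' (fun i => (σ i).R_zero)
      fun i => (σ i).R_add⟩,
    sumFormR_dual_smul σ⟩, fun a z => by
      change sumFormR σ (a • z) = a • sumFormR σ z
      rw [sumFormR, Finsupp.sum_smul_index' fun i => (σ i).R_zero]
      have h (i : I) (x : C) : (σ i).R (a • x) = a • (σ i).R x := (σ i).R_op_smul a.unop x
      simp only [h]
      exact (map_finsuppSum (DistribSMul.toAddMonoidHom (RDual A C) a) z _).symm⟩ :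
    BimodCat.Hom _ _)

/-- A family of balanced forms as a bilinear map `C^(I) → ^*C`. -/
noncomputable def sumFormLHom (σ : I → BalancedForm A C) : sumL A C I ⟶ dualL A C :=
  (⟨⟨⟨sumFormL σ, fun z w => Finsupp.sum_add_index' (fun i => (σ i).L_zero)
      fun i => (σ i).L_add⟩,
    fun a z => by
      change sumFormL σ (a • z) = a • sumFormL σ z
      rw [sumFormL, Finsupp.sum_smul_index' fun i => (σ i).L_zero]
      simp only [BalancedForm.L_smul]
      exact (map_finsuppSum (DistribSMul.toAddMonoidHom (LDual A C) a) z _).symm⟩,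
    fun g z => sumFormL_dual_smul σ g.unop z⟩ : BimodCat.Hom _ _)

/-- If `C^*` separates the elements of `C`, every bilinear map `C^(I) → C^*` comes from balanced
forms. -/
theorem exists_sumFormRHom (h : LocProj Aᵐᵒᵖ C) (j : sumR A C I ⟶ dualR A C) :
    ∃ σ : I → BalancedForm A C, sumFormRHom σ = j := by
  classical
  let J : (I →₀ C) →+ RDual A C := j.lin.toAddMonoidHom
  let jj (i : I) : C →+ RDual A C := J.comp (Finsupp.singleAddHom i)
  refine ⟨fun i => BalancedForm.ofR h.eq_of_rDual (jj i) (fun a c => ?_) (fun f c => ?_), ?_⟩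
  · refine Eq.trans (congrArg J ?_) (j.map_op_smul (MulOpposite.op a) (Finsupp.single i c))
    exact (Finsupp.smul_single _ _ _).symm
  · refine Eq.trans (congrArg J ?_) (map_smul j.lin f (Finsupp.single i c))
    exact (Finsupp.smul_single _ _ _).symm
  · refine BimodCat.hom_ext (LinearMap.ext fun z => ?_)
    exact (map_finsuppSum J z Finsupp.single).symm.trans (congrArg J (Finsupp.sum_single z))

/-- If `^*C` separates the elements of `C`, every bilinear map `C^(I) → ^*C` comes from balanced
forms. -/
theorem exists_sumFormLHom (h : LocProj A C) (j : sumL A C I ⟶ dualL A C) :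
    ∃ σ : I → BalancedForm A C, sumFormLHom σ = j := by
  classical
  let J : (I →₀ C) →+ LDual A C := j.lin.toAddMonoidHom
  let jj (i : I) : C →+ LDual A C := J.comp (Finsupp.singleAddHom i)
  refine ⟨fun i => BalancedForm.ofL h.eq_of_lDual (jj i) (fun a c => ?_) (fun g c => ?_), ?_⟩
  · refine Eq.trans (congrArg J ?_) (map_smul j.lin a (Finsupp.single i c))
    exact (Finsupp.smul_single _ _ _).symm
  · refine Eq.trans (congrArg J ?_) (j.map_op_smul (MulOpposite.op g) (Finsupp.single i c))
    exact (Finsupp.smul_single _ _ _).symm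
  · refine BimodCat.hom_ext (LinearMap.ext fun z => ?_)
    exact (map_finsuppSum J z Finsupp.single).symm.trans (congrArg J (Finsupp.sum_single z))

/-- The bilinear maps `C^* → C^(I)` are the maps `f ↦ f z` with `z` invariant: right linearity at
the unit says `a z = z a`. -/
theorem evalR_image_traceSet (σ : I → BalancedForm A C) :
    evalR '' traceSet (sumFormRHom σ) = sumFormR σ '' invariants A C I := by
  ext e
  constructor
  · rintro ⟨_, ⟨ψ, rfl⟩, rfl⟩
    let z : I →₀ C := ψ.lin (1 : RDual A C)
    refine ⟨z, fun a i => ?_, rfl⟩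
    have h1 : (MulOpposite.op a • (1 : RDual A C)) • z = MulOpposite.op a • z := by
      refine (map_smul ψ.lin (MulOpposite.op a • (1 : RDual A C)) (1 : RDual A C)).symm.trans ?_
      refine Eq.trans (congrArg ψ.lin ?_) (ψ.map_op_smul (MulOpposite.op a) (1 : RDual A C))
      exact mul_one (MulOpposite.op a • (1 : RDual A C))
    have h2 := DFunLike.congr_fun h1 i
    rwa [Finsupp.smul_apply, Finsupp.smul_apply, RDual.op_smul_one_smul] at h2
  · rintro ⟨z, hz, rfl⟩
    let ψ : dualR A C ⟶ sumR A C I := (⟨LinearMap.toSpanSingleton (RDual A C) (I →₀ C) z,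
      fun a f => by
        induction a using MulOpposite.rec' with
        | h a =>
          change (MulOpposite.op a • f) • z = MulOpposite.op a • f • z
          have h1 : MulOpposite.op a • f = f * (MulOpposite.op a • (1 : RDual A C)) :=
            (congrArg (MulOpposite.op a • ·) (mul_one f)).symm.trans
              (smul_comm f (MulOpposite.op a) (1 : RDual A C)).symm
          rw [h1, mul_smul, ← smul_comm f]
          refine congrArg (f • ·) (Finsupp.ext fun i => ?_)
          rw [Finsupp.smul_apply, Finsupp.smul_apply, RDual.op_smul_one_smul, hz a i]⟩ :
      BimodCat.Hom _ _)
    exact ⟨_, ⟨ψ, rfl⟩, congrArg (sumFormR σ) (one_smul (RDual A C) z)⟩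

theorem evalL_image_traceSet (σ : I → BalancedForm A C) :
    evalL '' traceSet (sumFormLHom σ) = sumFormL σ '' invariants A C I := by
  ext e
  constructor
  · rintro ⟨_, ⟨ψ, rfl⟩, rfl⟩
    let z : I →₀ C := ψ.lin (1 : LDual A C)
    refine ⟨z, fun a i => ?_, rfl⟩
    have h1 : MulOpposite.op (a • (1 : LDual A C)) • z = a • z := by
      refine (ψ.map_op_smul (MulOpposite.op (a • (1 : LDual A C))) (1 : LDual A C)).symm.trans ?_
      refine Eq.trans (congrArg ψ.lin ?_) (map_smul ψ.lin a (1 : LDual A C))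
      exact one_mul (a • (1 : LDual A C))
    have h2 := DFunLike.congr_fun h1 i
    rw [Finsupp.smul_apply, Finsupp.smul_apply, LDual.op_smul_one_smul] at h2
    exact h2.symm
  · rintro ⟨z, hz, rfl⟩
    let ψ : dualL A C ⟶ sumL A C I := (⟨⟨⟨fun f => MulOpposite.op f • z, fun f g => by
        rw [MulOpposite.op_add, add_smul]⟩,
      fun a f => by
        change MulOpposite.op (a • f) • z = a • MulOpposite.op f • z
        have h1 : a • f = (a • (1 : LDual A C)) * f :=
          (congrArg (a • ·) (one_mul f)).symm.trans
            (smul_comm a (MulOpposite.op f) (1 : LDual A C))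
        rw [h1, MulOpposite.op_mul, mul_smul, smul_comm a]
        refine congrArg (MulOpposite.op f • ·) (Finsupp.ext fun i => ?_)
        rw [Finsupp.smul_apply, Finsupp.smul_apply, LDual.op_smul_one_smul, hz a i]⟩,
      fun g f => mul_smul g (MulOpposite.op f) z⟩ : BimodCat.Hom _ _)
    exact ⟨_, ⟨ψ, rfl⟩, congrArg (sumFormL σ) (one_smul (LDual A C)ᵐᵒᵖ z)⟩

theorem traceLocalUnitsR_iff (h : LocProj Aᵐᵒᵖ C) :
    TraceLocalUnitsR A C I ↔ ∃ σ : I → BalancedForm A C, LeftUnital σ := by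
  constructor
  · rintro ⟨j, hj⟩
    obtain ⟨σ, rfl⟩ := exists_sumFormRHom h j
    rw [evalR_image_traceSet] at hj
    refine ⟨σ, fun s => ?_⟩
    obtain ⟨_, ⟨z, hz, rfl⟩, hs⟩ := hj s
    exact ⟨z, hz, hs⟩
  · rintro ⟨σ, hσ⟩
    refine ⟨sumFormRHom σ, ?_⟩
    rw [evalR_image_traceSet]
    intro s
    obtain ⟨z, hz, hs⟩ := hσ s
    exact ⟨_, ⟨z, hz, rfl⟩, hs⟩

theorem traceLocalUnitsL_iff (h : LocProj A C) :
    TraceLocalUnitsL A C I ↔ ∃ σ : I → BalancedForm A C, RightUnital σ := by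
  constructor
  · rintro ⟨j, hj⟩
    obtain ⟨σ, rfl⟩ := exists_sumFormLHom h j
    rw [evalL_image_traceSet] at hj
    refine ⟨σ, fun s => ?_⟩
    obtain ⟨_, ⟨z, hz, rfl⟩, hs⟩ := hj s
    exact ⟨z, hz, hs⟩
  · rintro ⟨σ, hσ⟩
    refine ⟨sumFormLHom σ, ?_⟩
    rw [evalL_image_traceSet]
    intro s
    obtain ⟨z, hz, hs⟩ := hσ s
    exact ⟨_, ⟨z, hz, rfl⟩, hs⟩

end

/-! ### Natural transformations between represented functors -/

section Yoneda

universe v w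

variable {D : Type w} [Category.{v} D] [Preadditive D]

/-- The Yoneda lemma matches the factorizations through `Hom(-, j)` with those through `j`. -/
theorem image_traceSet_preadditiveYoneda {M N : D} (j : M ⟶ N) :
    (fun θ : preadditiveYoneda.obj N ⟶ preadditiveYoneda.obj N =>
      (θ.app (Opposite.op N)).hom (𝟙 N)) '' traceSet (preadditiveYoneda.map j) = traceSet j := by
  ext φ
  constructor
  · rintro ⟨_, ⟨β, rfl⟩, rfl⟩
    exact ⟨preadditiveYoneda.preimage β, by
      conv_lhs => rw [← preadditiveYoneda.map_preimage β, ← Functor.map_comp]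
      exact Category.id_comp _⟩
  · rintro ⟨ψ, rfl⟩
    exact ⟨_, ⟨preadditiveYoneda.map ψ, rfl⟩, by
      rw [← Functor.map_comp]
      exact Category.id_comp _⟩

theorem image_cotraceSet_preadditiveCoyoneda {M N : D} (j : M ⟶ N) :
    (fun θ : preadditiveCoyoneda.obj (Opposite.op N) ⟶ preadditiveCoyoneda.obj (Opposite.op N) =>
      (θ.app N).hom (𝟙 N)) '' cotraceSet (preadditiveCoyoneda.map j.op) = traceSet j := by
  ext φ
  constructor
  · rintro ⟨_, ⟨β, rfl⟩, rfl⟩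
    exact ⟨(preadditiveCoyoneda.preimage β).unop, by
      conv_lhs => rw [← preadditiveCoyoneda.map_preimage β, ← Functor.map_comp]
      exact Category.comp_id _⟩
  · rintro ⟨ψ, rfl⟩
    exact ⟨_, ⟨preadditiveCoyoneda.map ψ.op, rfl⟩, by
      rw [← Functor.map_comp]
      exact Category.comp_id _⟩

end Yoneda

section

variable {A C : Type u} [Ring A] [AddCommGroup C] [Module A C] [Module Aᵐᵒᵖ C]
  [SMulCommClass A Aᵐᵒᵖ C] [Coring A C] {I : Type u}

theorem yonedaLocalUnitsR_iff : YonedaLocalUnitsR A C I ↔ TraceLocalUnitsR A C I := by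
  have key (j : sumR A C I ⟶ dualR A C) : (fun θ => evalR (endIntoR θ)) ''
      traceSet (preadditiveYoneda.map j) = evalR '' traceSet j :=
    (Set.image_image evalR endIntoR _).symm.trans
      (congrArg (evalR '' ·) (image_traceSet_preadditiveYoneda j))
  constructor
  · rintro ⟨α, hα⟩
    refine ⟨preadditiveYoneda.preimage α, ?_⟩
    rw [← key, preadditiveYoneda.map_preimage]
    exact hα
  · rintro ⟨j, hj⟩
    refine ⟨preadditiveYoneda.map j, ?_⟩
    rw [key]
    exact hj

theorem yonedaLocalUnitsL_iff : YonedaLocalUnitsL A C I ↔ TraceLocalUnitsL A C I := by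
  have key (j : sumL A C I ⟶ dualL A C) : (fun θ => evalL (endIntoL θ)) ''
      traceSet (preadditiveYoneda.map j) = evalL '' traceSet j :=
    (Set.image_image evalL endIntoL _).symm.trans
      (congrArg (evalL '' ·) (image_traceSet_preadditiveYoneda j))
  constructor
  · rintro ⟨α, hα⟩
    refine ⟨preadditiveYoneda.preimage α, ?_⟩
    rw [← key, preadditiveYoneda.map_preimage]
    exact hα
  · rintro ⟨j, hj⟩
    refine ⟨preadditiveYoneda.map j, ?_⟩
    rw [key]
    exact hj

theorem coyonedaLocalUnitsR_iff : CoyonedaLocalUnitsR A C I ↔ TraceLocalUnitsR A C I := by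
  have key (j : sumR A C I ⟶ dualR A C) : (fun θ => evalR (endFromR θ)) ''
      cotraceSet (preadditiveCoyoneda.map j.op) = evalR '' traceSet j :=
    (Set.image_image evalR endFromR _).symm.trans
      (congrArg (evalR '' ·) (image_cotraceSet_preadditiveCoyoneda j))
  constructor
  · rintro ⟨α, hα⟩
    refine ⟨(preadditiveCoyoneda.preimage α).unop, ?_⟩
    rw [← key, Quiver.Hom.op_unop, preadditiveCoyoneda.map_preimage]
    exact hα
  · rintro ⟨j, hj⟩
    refine ⟨preadditiveCoyoneda.map j.op, ?_⟩
    rw [key]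
    exact hj

theorem coyonedaLocalUnitsL_iff : CoyonedaLocalUnitsL A C I ↔ TraceLocalUnitsL A C I := by
  have key (j : sumL A C I ⟶ dualL A C) : (fun θ => evalL (endFromL θ)) ''
      cotraceSet (preadditiveCoyoneda.map j.op) = evalL '' traceSet j :=
    (Set.image_image evalL endFromL _).symm.trans
      (congrArg (evalL '' ·) (image_cotraceSet_preadditiveCoyoneda j))
  constructor
  · rintro ⟨α, hα⟩
    refine ⟨(preadditiveCoyoneda.preimage α).unop, ?_⟩
    rw [← key, Quiver.Hom.op_unop, preadditiveCoyoneda.map_preimage]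
    exact hα
  · rintro ⟨j, hj⟩
    refine ⟨preadditiveCoyoneda.map j.op, ?_⟩
    rw [key]
    exact hj

end

/-! ### Coalgebras of a comonad on modules -/

section Comonad

variable {R : Type u} [Ring R] {T : Comonad (ModuleCat.{u} R)}

/-- The coalgebra structure on the direct sum of two coalgebras. -/
noncomputable def coalgebraSum (M N : T.Coalgebra) : T.Coalgebra where
  A := M.A ⊞ N.A
  a := Limits.biprod.desc (M.a ≫ T.map Limits.biprod.inl) (N.a ≫ T.map Limits.biprod.inr)
  counit := by
    apply Limits.biprod.hom_ext'
    · simp [M.counit_assoc]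
    · simp [N.counit_assoc]
  coassoc := by
    apply Limits.biprod.hom_ext'
    · simp [M.coassoc_assoc, ← Functor.map_comp]
    · simp [N.coassoc_assoc, ← Functor.map_comp]

/-- The morphism out of a direct sum of coalgebras with given components. -/
noncomputable def coalgebraSumDesc {M N X : T.Coalgebra} (f : M ⟶ X) (g : N ⟶ X) :
    coalgebraSum M N ⟶ X where
  f := Limits.biprod.desc f.f g.f
  h := by
    apply Limits.biprod.hom_ext'
    · simp [coalgebraSum, ← Functor.map_comp]
    · simp [coalgebraSum, ← Functor.map_comp]

theorem coalgebraSumDesc_inl {M N X : T.Coalgebra} (f : M ⟶ X) (g : N ⟶ X) (m : M.A) :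
    (coalgebraSumDesc f g).f.hom ((Limits.biprod.inl : M.A ⟶ M.A ⊞ N.A).hom m) = f.f.hom m :=
  congrArg (fun k => k.hom m) (Limits.biprod.inl_desc f.f g.f)

theorem coalgebraSumDesc_inr {M N X : T.Coalgebra} (f : M ⟶ X) (g : N ⟶ X) (n : N.A) :
    (coalgebraSumDesc f g).f.hom ((Limits.biprod.inr : N.A ⟶ M.A ⊞ N.A).hom n) = g.f.hom n :=
  congrArg (fun k => k.hom n) (Limits.biprod.inr_desc f.f g.f)

variable (T) in
/-- The zero coalgebra. -/
def zeroCoalgebra : T.Coalgebra where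
  A := ModuleCat.of R PUnit.{u + 1}
  a := 0
  counit := (ModuleCat.isZero_of_subsingleton _).eq_of_src _ _
  coassoc := (ModuleCat.isZero_of_subsingleton _).eq_of_src _ _

variable (T) in
/-- The coalgebras that are finitely generated and projective as modules. -/
def fgpCoalgebra : ObjectProperty T.Coalgebra := fun M =>
  Module.Finite R M.A ∧ Module.Projective R M.A

/-- The submodule of the elements in the image of some morphism from a coalgebra that is finitely
generated and projective as a module. -/
def fgpTrace (X : T.Coalgebra) : Submodule R X.A where
  carrier := {x | ∃ M, fgpCoalgebra T M ∧ ∃ (f : M ⟶ X) (m : M.A), f.f.hom m = x}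
  zero_mem' := ⟨zeroCoalgebra T,
    ⟨inferInstanceAs (Module.Finite R PUnit.{u + 1}),
      inferInstanceAs (Module.Projective R PUnit.{u + 1})⟩,
    ⟨0, (ModuleCat.isZero_of_subsingleton (ModuleCat.of R PUnit.{u + 1})).eq_of_src _ _⟩, 0,
    map_zero _⟩
  add_mem' := by
    rintro _ _ ⟨M, ⟨_, _⟩, f, m, rfl⟩ ⟨N, ⟨_, _⟩, g, n, rfl⟩
    let e := (ModuleCat.biprodIsoProd M.A N.A).toLinearEquiv.symm
    refine ⟨coalgebraSum M N, ⟨Module.Finite.equiv e, Module.Projective.of_equiv e⟩,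
      coalgebraSumDesc f g,
      (Limits.biprod.inl : M.A ⟶ M.A ⊞ N.A).hom m +
        (Limits.biprod.inr : N.A ⟶ M.A ⊞ N.A).hom n, ?_⟩
    exact (map_add (coalgebraSumDesc f g).f.hom _ _).trans
      (congrArg₂ (· + ·) (coalgebraSumDesc_inl f g m) (coalgebraSumDesc_inr f g n))
  smul_mem' := by
    rintro r _ ⟨M, hM, f, m, rfl⟩
    exact ⟨M, hM, f, r • m, map_smul _ _ _⟩

variable [T.toFunctor.PreservesZeroMorphisms]

/-- The coalgebra structure on the quotient by `fgpTrace`. -/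
def fgpQuotient (X : T.Coalgebra) : T.Coalgebra where
  A := ModuleCat.of R (X.A ⧸ fgpTrace X)
  a := ModuleCat.ofHom ((fgpTrace X).liftQ
    (X.a ≫ T.map (ModuleCat.ofHom (fgpTrace X).mkQ)).hom (by
      rintro _ ⟨M, hM, f, m, rfl⟩
      have h0 : f.f ≫ ModuleCat.ofHom (fgpTrace X).mkQ = 0 := by
        ext m
        exact (Submodule.Quotient.mk_eq_zero _).2 ⟨M, hM, f, m, rfl⟩
      have h1 : f.f ≫ X.a ≫ T.map (ModuleCat.ofHom (fgpTrace X).mkQ) = 0 := by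
        rw [← f.h_assoc, ← Functor.map_comp, h0, Functor.map_zero, Limits.comp_zero]
      exact congrArg (fun k => k.hom m) h1))
  counit := by
    have hq : Epi (ModuleCat.ofHom (fgpTrace X).mkQ) :=
      (ModuleCat.epi_iff_surjective _).2 (Submodule.mkQ_surjective _)
    rw [← cancel_epi (ModuleCat.ofHom (fgpTrace X).mkQ)]
    have h1 : ∀ g : X.A ⟶ T.obj (ModuleCat.of R (X.A ⧸ fgpTrace X)), ∀ h,
      ModuleCat.ofHom (fgpTrace X).mkQ ≫ ModuleCat.ofHom ((fgpTrace X).liftQ g.hom h) = g :=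
        fun g h => rfl
    rw [← Category.assoc, h1, Category.assoc, T.ε.naturality, X.counit_assoc]
    rfl
  coassoc := by
    have hq : Epi (ModuleCat.ofHom (fgpTrace X).mkQ) :=
      (ModuleCat.epi_iff_surjective _).2 (Submodule.mkQ_surjective _)
    rw [← cancel_epi (ModuleCat.ofHom (fgpTrace X).mkQ)]
    have h1 : ∀ g : X.A ⟶ T.obj (ModuleCat.of R (X.A ⧸ fgpTrace X)), ∀ h,
      ModuleCat.ofHom (fgpTrace X).mkQ ≫ ModuleCat.ofHom ((fgpTrace X).liftQ g.hom h) = g :=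
        fun g h => rfl
    rw [← Category.assoc, ← Category.assoc, h1, Category.assoc, Category.assoc, T.δ.naturality,
      X.coassoc_assoc, ← Functor.map_comp, h1, Functor.comp_map, Functor.map_comp]

/-- If the coalgebras that are finitely generated and projective as modules generate, then every
finite subset of a coalgebra lies in the image of a single one of them: otherwise the quotient by
the images of all of them would be a nonzero coalgebra that no morphism from them detects. -/
theorem exists_hom_of_isSeparating (h : (fgpCoalgebra T).IsSeparating) (X : T.Coalgebra)
    (s : Finset X.A) : ∃ M, fgpCoalgebra T M ∧ ∃ f : M ⟶ X, ∀ x ∈ s, ∃ m, f.f.hom m = x := by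
  classical
  let q : X ⟶ fgpQuotient X := ⟨ModuleCat.ofHom (fgpTrace X).mkQ, rfl⟩
  let o : X ⟶ fgpQuotient X := ⟨0, by rw [Functor.map_zero, Limits.comp_zero, Limits.zero_comp]⟩
  have hqo : q = o := h q o fun M hM f => by
    ext m
    exact (Submodule.Quotient.mk_eq_zero _).2 ⟨M, hM, f, m, rfl⟩
  have hx (x : X.A) : x ∈ fgpTrace X :=
    (Submodule.Quotient.mk_eq_zero _).1 (congrArg (fun k : X ⟶ fgpQuotient X => k.f.hom x) hqo)
  induction s using Finset.induction_on with
  | empty =>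
    obtain ⟨M, hM, f, -⟩ := hx 0
    exact ⟨M, hM, f, fun x hx => absurd hx (Finset.notMem_empty x)⟩
  | insert a s _ ih =>
    obtain ⟨M, ⟨_, _⟩, f, m, hm⟩ := hx a
    obtain ⟨N, ⟨_, _⟩, g, hg⟩ := ih
    let e := (ModuleCat.biprodIsoProd M.A N.A).toLinearEquiv.symm
    refine ⟨coalgebraSum M N, ⟨Module.Finite.equiv e, Module.Projective.of_equiv e⟩,
      coalgebraSumDesc f g, fun x hx => ?_⟩
    obtain rfl | hx := Finset.mem_insert.1 hx
    · exact ⟨(Limits.biprod.inl : M.A ⟶ M.A ⊞ N.A).hom m,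
        (coalgebraSumDesc_inl f g m).trans hm⟩
    · obtain ⟨n, hn⟩ := hg x hx
      exact ⟨(Limits.biprod.inr : N.A ⟶ M.A ⊞ N.A).hom n,
        (coalgebraSumDesc_inr f g n).trans hn⟩

end Comonad

/-! ### Copowers of modules -/

section Copower

variable {R : Type u} [Ring R] {I : Type u}

/-- The inclusion of the summand with index `i` in `N^(I)`. -/
noncomputable def copowerι (N : ModuleCat.{u} R) (i : I) :
    N →ₗ[R] (copower (ModuleCat.{u} R) I).obj N :=
  (Limits.Sigma.ι (fun _ : I => N) i).hom

/-- The coordinates of an element of `N^(I)`. -/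
noncomputable def copowerCoord (N : ModuleCat.{u} R) :
    (copower (ModuleCat.{u} R) I).obj N →ₗ[R] (I →₀ N) :=
  (Limits.Sigma.desc (f := fun _ : I => N) (P := ModuleCat.of R (I →₀ N)) fun i =>
    ModuleCat.ofHom (Finsupp.lsingle i)).hom

@[simp] theorem copowerCoord_ι (N : ModuleCat.{u} R) (i : I) (n : N) :
    copowerCoord N (copowerι N i n) = Finsupp.single i n :=
  congrArg (fun k => k.hom n) (Limits.Sigma.ι_desc (f := fun _ : I => N)
    (P := ModuleCat.of R (I →₀ N)) (fun i => ModuleCat.ofHom (Finsupp.lsingle i)) i)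

theorem copower_map_ι {N N' : ModuleCat.{u} R} (f : N ⟶ N') (i : I) (n : N) :
    ((copower (ModuleCat.{u} R) I).map f).hom (copowerι N i n) = copowerι N' i (f.hom n) :=
  congrArg (fun k => k.hom n) (Limits.Sigma.ι_map (fun _ : I => f) i)

theorem sum_copowerCoord (N : ModuleCat.{u} R) (w : (copower (ModuleCat.{u} R) I).obj N) :
    (copowerCoord N w).sum (fun i n => copowerι N i n) = w := by
  have h : ModuleCat.ofHom ((Finsupp.lsum ℕ fun i => copowerι N i).comp (copowerCoord N)) =
      𝟙 ((copower (ModuleCat.{u} R) I).obj N) := by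
    refine Limits.Sigma.hom_ext (f := fun _ : I => N) _ _ fun i => ?_
    ext n
    refine (congrArg (Finsupp.lsum ℕ fun i => copowerι N i) (copowerCoord_ι N i n)).trans ?_
    rw [Finsupp.lsum_single]
    rfl
  exact congrArg (fun k => k.hom w) h

theorem copower_addHom_ext {N : ModuleCat.{u} R} {P : Type u} [AddCommGroup P]
    {Φ Ψ : (copower (ModuleCat.{u} R) I).obj N →+ P}
    (h : ∀ i n, Φ (copowerι N i n) = Ψ (copowerι N i n)) : Φ = Ψ := by
  ext w
  rw [← sum_copowerCoord N w, Finsupp.sum, map_sum, map_sum]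
  exact Finset.sum_congr rfl fun i _ => h i _

end Copower

/-! ### Conditions on functors -/

section Unfold

universe v₁ v₂ u₁ u₂ w

variable {X : Type u₁} [Category.{v₁} X] {Y : Type u₂} [Category.{v₂} Y] (I : Type w)
  [Limits.HasCoproductsOfShape I Y] (E : ObjectProperty X)

theorem hasUnitalEndLeft_iff (F : X ⥤ Y) (G : Y ⥤ X) :
    HasUnitalEndLeft I E F G ↔ IsRightLocallyQuasiAdjoint I E F G := by
  refine exists_congr fun J => ⟨fun h M hM M' f => ?_, fun h M hM M' f => ?_⟩
  · obtain ⟨_, ⟨β, rfl⟩, hβ⟩ := h M hM M' f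
    exact ⟨β, hβ⟩
  · obtain ⟨β, hβ⟩ := h M hM M' f
    exact ⟨_, ⟨β, rfl⟩, hβ⟩

theorem hasUnitalEndRight_iff (F : X ⥤ Y) (G : Y ⥤ X) :
    HasUnitalEndRight I E F G ↔ IsLeftLocallyQuasiAdjoint I E G F := by
  refine exists_congr fun J => ⟨fun h M hM N f => ?_, fun h M hM N f => ?_⟩
  · obtain ⟨_, ⟨β, rfl⟩, hβ⟩ := h M hM N f
    exact ⟨β, hβ⟩
  · obtain ⟨β, hβ⟩ := h M hM N f
    exact ⟨_, ⟨β, rfl⟩, hβ⟩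

end Unfold

/-! ### Natural transformations on right comodules -/

section RightComodules

theorem BT.contrR_op_smul_lin {A C M : Type u} [Ring A] [AddCommGroup C] [Module A C]
    [Module Aᵐᵒᵖ C] [SMulCommClass A Aᵐᵒᵖ C] [AddCommGroup M] [Module Aᵐᵒᵖ M] (f : LDual A C)
    (a : A) (x : BT A M C) :
    BT.contrR f.lin (MulOpposite.op a • x) = BT.contrR (LDual.lin (a • f)) x := by
  induction x using BT.induction with
  | h0 => simp only [smul_zero, map_zero]
  | ht m n => rfl
  | ha x y hx hy => simp only [smul_add, map_add, hx, hy]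

theorem BT.copower_left_hom_ext {A C : Type u} [Ring A] [AddCommGroup C] [Module A C]
    {I : Type u} {N : ModuleCat.{u} Aᵐᵒᵖ} {P : Type u} [AddCommGroup P]
    {Φ Ψ : BT A ((copower (ModuleCat.{u} Aᵐᵒᵖ) I).obj N) C →+ P}
    (h : ∀ i n c, Φ (BT.tmul A (copowerι N i n) c) = Ψ (BT.tmul A (copowerι N i n) c)) :
    Φ = Ψ := by
  refine BT.hom_ext fun w c => ?_
  exact DFunLike.congr_fun (copower_addHom_ext (Φ := Φ.comp (BT.mkR c)) (Ψ := Ψ.comp (BT.mkR c))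
    fun i n => h i n c) w

variable {A C : Type u} [Ring A] [AddCommGroup C] [Module A C] [Module Aᵐᵒᵖ C]
  [SMulCommClass A Aᵐᵒᵖ C] [Coring A C]

instance : (rightComonad A C).toFunctor.PreservesZeroMorphisms where
  map_zero M N := by
    ext x
    change BT.map 0 LinearMap.id x = 0
    induction x using BT.induction with
    | h0 => rw [map_zero]
    | ht m n => exact BT.zero_tmul n
    | ha x y hx hy => rw [map_add, hx, hy, add_zero]

variable (A C) in
/-- The coring `C` as a right comodule over itself. -/
def selfRComod : RComod A C where
  A := ModuleCat.of Aᵐᵒᵖ C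
  a := ModuleCat.ofHom (comulR A C)
  counit := ModuleCat.hom_ext <| LinearMap.ext fun c => Coring.contrR_counit (A := A) c
  coassoc := ModuleCat.hom_ext <| LinearMap.ext fun c =>
    (congrArg BT.assocInv (Coring.coassoc (A := A) c)).symm.trans (BT.assocInv_assoc _)

/-- Left multiplication by `a` as an endomorphism of the right comodule `C`. -/
def lmulRComod (a : A) : selfRComod A C ⟶ selfRComod A C where
  f := ModuleCat.ofHom (lmul a)
  h := ModuleCat.hom_ext <| LinearMap.ext fun (c : C) => by
    change BT.map (lmul a) LinearMap.id (Coring.comul c) = Coring.comul (a • c)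
    rw [map_smul]
    induction (Coring.comul c : BT A C C) using BT.induction with
    | h0 => rw [map_zero, smul_zero]
    | ht m n => rfl
    | ha x y hx hy => rw [map_add, hx, hy, smul_add]

/-- The map `n ⊗ -` as a morphism of right comodules `C → N ⊗_A C`. -/
def tmulRComod {N : ModuleCat.{u} Aᵐᵒᵖ} (n : N) :
    selfRComod A C ⟶ (inductionR A C).obj N where
  f := ModuleCat.ofHom ⟨⟨BT.tmul A n, BT.tmul_add n⟩, fun _ _ => rfl⟩
  h := ModuleCat.hom_ext <| LinearMap.ext fun (c : C) => by
    change BT.map (⟨⟨BT.tmul A n, BT.tmul_add n⟩, fun _ _ => rfl⟩ : C →ₗ[Aᵐᵒᵖ] BT A N C)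
      LinearMap.id (Coring.comul c) = BT.assocInv (BT.tmul A n (Coring.comul c))
    induction (Coring.comul c : BT A C C) using BT.induction with
    | h0 => rw [map_zero, BT.tmul_zero, map_zero]
    | ht m n => rfl
    | ha x y hx hy => rw [map_add, hx, hy, BT.tmul_add, map_add]

/-- The coaction as a morphism of right comodules `M → M ⊗_A C`. -/
def coactRHom (M : RComod A C) : M ⟶ (inductionR A C).obj M.A where
  f := M.a
  h := M.coassoc.symm

theorem contrR_counit_coactR (M : RComod A C) (m : M.A) :
    BT.contrR (Coring.counit (A := A)) (coactR M m) = m :=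
  congrArg (fun k => k.hom m) M.counit

theorem actOnR_one (M : RComod A C) (m : M.A) : actOnR M 1 m = m := contrR_counit_coactR M m

/-- The right action of `^*C` on a comodule as an additive map in the scalar. -/
def actOnRHom (M : RComod A C) (m : M.A) : LDual A C →+ M.A :=
  AddMonoidHom.mk' (fun g => actOnR M g m) fun _ _ => BT.contrR_add _ _ _

theorem actOnR_add (M : RComod A C) (g : LDual A C) (m n : M.A) :
    actOnR M g (m + n) = actOnR M g m + actOnR M g n := by
  rw [actOnR, map_add, map_add]
  rfl

theorem actOnR_zero (M : RComod A C) (g : LDual A C) : actOnR M g 0 = 0 := by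
  rw [actOnR, map_zero, map_zero]

/-- By coassociativity, the coaction of `m₀ g(m₁)` is `m₀ ⊗ m₁₁ g(m₁₂)`. -/
theorem coactR_actOnR (M : RComod A C) (g : LDual A C) (m : M.A) :
    coactR M (actOnR M g m) = BT.map LinearMap.id g.act (coactR M m) := by
  have h1 : ∀ y : BT A M.A C, coactR M (BT.contrR g.lin y) =
      BT.contrR g.lin (BT.map (coactR M) LinearMap.id y) := fun y => by
    induction y using BT.induction with
    | h0 => simp only [map_zero]
    | ht n c => exact map_smul (coactR M) _ _
    | ha x y hx hy => simp only [map_add, hx, hy]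
  have h2 : ∀ (n : M.A) (y : BT A C C), BT.contrR g.lin (BT.assocInv (BT.tmul A n y)) =
      BT.tmul A n (BT.contrR g.lin y) := fun n y => by
    induction y using BT.induction with
    | h0 => simp only [BT.tmul_zero, map_zero]
    | ht c d => rfl
    | ha x y hx hy => rw [BT.tmul_add, map_add, map_add, hx, hy, map_add, BT.tmul_add]
  have h3 : ∀ y : BT A M.A C, BT.contrR g.lin (deltaR A C M.A y) =
      BT.map LinearMap.id g.act y := fun y => by
    induction y using BT.induction with
    | h0 => simp only [map_zero]
    | ht n c => exact h2 n _
    | ha x y hx hy => simp only [map_add, hx, hy]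
  have h4 : deltaR A C M.A (coactR M m) = BT.map (coactR M) LinearMap.id (coactR M m) :=
    congrArg (fun k => k.hom m) M.coassoc
  rw [actOnR, h1, ← h4, h3]

theorem actOnR_hom {M M' : RComod A C} (f : M ⟶ M') (g : LDual A C) (m : M.A) :
    actOnR M' g (f.f.hom m) = f.f.hom (actOnR M g m) := by
  have h : coactR M' (f.f.hom m) = BT.map f.f.hom LinearMap.id (coactR M m) :=
    (congrArg (fun k => k.hom m) f.h).symm
  rw [actOnR, actOnR, h]
  induction (coactR M m) using BT.induction with
  | h0 => simp only [map_zero]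
  | ht n c => exact (map_smul f.f.hom _ _).symm
  | ha x y hx hy => simp only [map_add, hx, hy]

theorem actOnR_induction (N : ModuleCat.{u} Aᵐᵒᵖ) (g : LDual A C) (n : N) (c : C) :
    actOnR ((inductionR A C).obj N) g (BT.tmul A n c) = BT.tmul A n (MulOpposite.op g • c) :=
  actOnR_hom (tmulRComod n) g c

/-- The right action is right linear for the bilinear elements of `^*C`. -/
theorem actOnR_op_smul (M : RComod A C) {g : LDual A C}
    (hg : ∀ (a : A) (c : C), g (MulOpposite.op a • c) = g c * a) (a : A) (m : M.A) :
    actOnR M g (MulOpposite.op a • m) = MulOpposite.op a • actOnR M g m := by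
  rw [actOnR, actOnR, map_smul]
  induction (coactR M m) using BT.induction with
  | h0 => simp only [smul_zero, map_zero]
  | ht n c =>
    change MulOpposite.op (g (MulOpposite.op a • c)) • n = _
    rw [hg, MulOpposite.op_mul, mul_smul]
    rfl
  | ha x y hx hy => simp only [smul_add, map_add, hx, hy]

variable {I : Type u}

section OfNatTrans

variable (J : forgetR A C ⋙ copower (ModuleCat.{u} Aᵐᵒᵖ) I ⋙ inductionR A C ⟶ 𝟭 (RComod A C))

/-- The value `J_M(m ⊗ c)`, for `m` in the summand of `M^(I)` with index `i`. -/
noncomputable def natTransR (M : RComod A C) (i : I) (c : C) : M.A →+ M.A :=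
  (J.app M).f.hom.toAddMonoidHom.comp
    ((BT.mkR (A := A) c).comp (copowerι (I := I) M.A i).toAddMonoidHom)

theorem natTransR_naturality {M M' : RComod A C} (f : M ⟶ M') (i : I) (c : C) (m : M.A) :
    natTransR J M' i c (f.f.hom m) = f.f.hom (natTransR J M i c m) := by
  have h := congrArg (fun k => k.f.hom (BT.tmul A (copowerι M.A i m) c)) (J.naturality f)
  refine Eq.trans ?_ h
  change (J.app M').f.hom (BT.tmul A (copowerι M'.A i (f.f.hom m)) c) =
    (J.app M').f.hom (BT.tmul A (((copower (ModuleCat.{u} Aᵐᵒᵖ) I).map f.f).hom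
      (copowerι M.A i m)) c)
  rw [copower_map_ι]

/-- The map `x ↦ J_C(x ⊗ c)`, which is left linear by naturality. -/
noncomputable def natTransSelfR (i : I) (c : C) : C →ₗ[A] C where
  toFun := natTransR J (selfRComod A C) i c
  map_add' := map_add (natTransR J (selfRComod A C) i c)
  map_smul' a x := natTransR_naturality J (lmulRComod a) i c x

theorem natTransR_induction (N : ModuleCat.{u} Aᵐᵒᵖ) (i : I) (c : C) (y : BT A N C) :
    natTransR J ((inductionR A C).obj N) i c y = BT.map LinearMap.id (natTransSelfR J i c) y := by
  refine DFunLike.congr_fun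
    (f := (natTransR J ((inductionR A C).obj N) i c : BT A N C →+ BT A N C))
    (BT.hom_ext fun n x => ?_) y
  exact natTransR_naturality J (tmulRComod n) i c x

/-- The map `J_C : C^(I) ⊗_A C → C`. -/
noncomputable def natTransSelfMapR :
    BT A ((copower (ModuleCat.{u} Aᵐᵒᵖ) I).obj (ModuleCat.of Aᵐᵒᵖ C)) C →ₗ[Aᵐᵒᵖ] C :=
  (J.app (selfRComod A C)).f.hom

/-- The partial maps `c ↦ ε(J_C(x ⊗ c))`. -/
noncomputable def natTransFormR (i : I) (x : C) : RDual A C :=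
  (counitR A C).comp ((natTransSelfMapR J).comp
    (⟨⟨BT.tmul A (copowerι (ModuleCat.of Aᵐᵒᵖ C) i x), BT.tmul_add _⟩, fun _ _ => rfl⟩ :
      C →ₗ[Aᵐᵒᵖ] BT A ((copower (ModuleCat.{u} Aᵐᵒᵖ) I).obj (ModuleCat.of Aᵐᵒᵖ C)) C))

/-- `J_C(x ⊗ c) = x₁ ε(J_C(x₂ ⊗ c))`, by naturality for the comultiplication `C → C ⊗_A C`. -/
theorem natTransSelfR_eq_left (i : I) (x c : C) :
    MulOpposite.op (show LDual A C from Coring.counit.comp (natTransSelfR J i c)) • x =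
      natTransSelfR J i c x := by
  have h := natTransR_naturality J (coactRHom (selfRComod A C)) i c x
  have h2 := (natTransR_induction J (ModuleCat.of Aᵐᵒᵖ C) i c (Coring.comul x)).symm.trans h
  have h3 := congrArg (BT.contrR (Coring.counit (A := A))) h2
  refine Eq.trans ?_ (h3.trans (Coring.contrR_counit _))
  rw [LDual.op_smul_def]
  induction (Coring.comul x : BT A C C) using BT.induction with
  | h0 => simp only [map_zero]
  | ht n c => rfl
  | ha x y hx hy => simp only [map_add, hx, hy]

/-- `J_C(x ⊗ c) = ε(J_C(x ⊗ c₁)) c₂`, since `J_C` is a morphism of comodules. -/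
theorem natTransSelfR_eq_right (i : I) (x c : C) :
    natTransFormR J i x • c = natTransSelfR J i c x := by
  have h : BT.map (natTransSelfMapR J) LinearMap.id
      (BT.assocInv (BT.tmul A (copowerι (ModuleCat.of Aᵐᵒᵖ C) i x) (Coring.comul c))) =
      Coring.comul (natTransSelfR J i c x) :=
    congrArg (fun k => k.hom (BT.tmul A (copowerι (ModuleCat.of Aᵐᵒᵖ C) i x) c))
      (J.app (selfRComod A C)).h
  have h3 := congrArg (BT.contrL (counitR A C)) h
  refine Eq.trans ?_ (h3.trans (Coring.contrL_counit _))
  rw [RDual.smul_def]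
  induction (Coring.comul c : BT A C C) using BT.induction with
  | h0 => simp only [map_zero, BT.tmul_zero]
  | ht n c => rfl
  | ha x y hx hy => simp only [map_add, BT.tmul_add, hx, hy]

/-- The balanced forms `σᵢ(x, c) = ε(J_C(x ⊗ c))` of a natural transformation `J`, where `x` is
taken in the summand of `C^(I)` with index `i`. -/
noncomputable def BalancedForm.ofNatTransR (i : I) : BalancedForm A C where
  L c := Coring.counit.comp (natTransSelfR J i c)
  R := natTransFormR J i
  L_apply c x := rfl
  L_op_smul a c x := by
    refine congrArg (fun w => Coring.counit (A := A) (natTransSelfMapR J w)) ?_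
    exact (congrArg (fun w => BT.tmul A w c)
      (map_smul (copowerι (ModuleCat.of Aᵐᵒᵖ C) i) (MulOpposite.op a) x)).trans
        (BT.smul_tmul _ _ _)
  op_L_smul c x := (natTransSelfR_eq_left J i x c).trans (natTransSelfR_eq_right J i x c).symm

/-- `J_M(m ⊗ c) = m₀ σᵢ(m₁, c)`, by naturality for the coaction `M → M ⊗_A C`. -/
theorem natTransR_eq (M : RComod A C) (i : I) (c : C) (m : M.A) :
    natTransR J M i c m = actOnR M ((BalancedForm.ofNatTransR J i).L c) m := by
  have h := natTransR_naturality J (coactRHom M) i c m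
  have h2 := (natTransR_induction J M.A i c (coactR M m)).symm.trans h
  have h3 := congrArg (BT.contrR (Coring.counit (A := A))) h2
  refine ((contrR_counit_coactR M _).symm.trans h3.symm).trans ?_
  rw [actOnR]
  induction (coactR M m) using BT.induction with
  | h0 => simp only [map_zero]
  | ht n c => rfl
  | ha x y hx hy => simp only [map_add, hx, hy]

end OfNatTrans

section ToNatTrans

variable (σ : I → BalancedForm A C)

/-- The map `m ⊗ c ↦ ∑ᵢ mᵢ₀ σᵢ(mᵢ₁, c)`. -/
noncomputable def formMapR (M : RComod A C) :
    BT A ((copower (ModuleCat.{u} Aᵐᵒᵖ) I).obj M.A) C →+ M.A :=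
  BT.lift (fun w c => (copowerCoord M.A w).sum fun i m => actOnR M ((σ i).L c) m)
    (fun w w' c => by
      rw [map_add]
      exact Finsupp.sum_add_index' (fun i => actOnR_zero M _) fun i => actOnR_add M _)
    (fun w c d => by
      rw [← Finsupp.sum_add]
      refine Finsupp.sum_congr fun i _ => ?_
      rw [(σ i).L_add]
      exact map_add (actOnRHom M _) _ _)
    (fun w a c => by
      rw [map_smul, Finsupp.sum_smul_index' fun i => actOnR_zero M _]
      refine Finsupp.sum_congr fun i _ => ?_
      rw [(σ i).L_smul, actOnR, actOnR, map_smul, BT.contrR_op_smul_lin])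

theorem formMapR_ι (M : RComod A C) (i : I) (m : M.A) (c : C) :
    formMapR σ M (BT.tmul A (copowerι M.A i m) c) = actOnR M ((σ i).L c) m := by
  change (copowerCoord M.A (copowerι M.A i m)).sum _ = _
  rw [copowerCoord_ι, Finsupp.sum_single_index]
  exact actOnR_zero M _

/-- For `y = ∑ c ⊗ d`, the left linear map `x ↦ ∑ σ(x, c) d`. -/
def BalancedForm.contrRight (τ : BalancedForm A C) (y : BT A C C) : C →ₗ[A] C where
  toFun x := BT.contrL (τ.R x).lin y
  map_add' x x' := by
    rw [τ.R_add]
    exact BT.contrL_add _ _ _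
  map_smul' a x := by
    induction y using BT.induction with
    | h0 => simp only [map_zero, smul_zero]
    | ht c d =>
      change τ.R (a • x) c • d = a • τ.R x c • d
      rw [← τ.L_apply, LDual.map_smul, τ.L_apply, mul_smul]
    | ha x y hx hy =>
      simp only [map_add, smul_add, hx, hy]

/-- The map `formMapR ⊗ C` sends `(m ⊗ c) ⊗ d` to `m₀ ⊗ σᵢ(m₁, c) d`. -/
theorem map_formMapR_assocInv (M : RComod A C)
    (f : BT A ((copower (ModuleCat.{u} Aᵐᵒᵖ) I).obj M.A) C →ₗ[Aᵐᵒᵖ] M.A)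
    (hf : ∀ x, f x = formMapR σ M x) (i : I) (m : M.A) (y : BT A C C) :
    BT.map f LinearMap.id (BT.assocInv (BT.tmul A (copowerι M.A i m) y)) =
      BT.map LinearMap.id ((σ i).contrRight y) (coactR M m) := by
  induction y using BT.induction with
  | h0 =>
    rw [BT.tmul_zero, map_zero, map_zero]
    induction (coactR M m) using BT.induction with
    | h0 => rw [map_zero]
    | ht n x => exact (BT.tmul_zero n).symm
    | ha x y hx hy => rw [map_add, ← hx, ← hy, add_zero]
  | ht c d =>
    change BT.tmul A (f _) d = _
    rw [hf, formMapR_ι, actOnR]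
    induction (coactR M m) using BT.induction with
    | h0 => rw [map_zero, map_zero, BT.zero_tmul]
    | ht n x =>
      refine (BT.smul_tmul _ _ _).trans ?_
      rw [BT.map_tmul]
      exact congrArg (fun a : A => BT.tmul A n (a • d)) ((σ i).L_apply c x)
    | ha x y hx hy => rw [map_add, map_add, BT.add_tmul, hx, hy]
  | ha y z hy hz =>
    rw [BT.tmul_add, map_add, map_add, hy, hz]
    induction (coactR M m) using BT.induction with
    | h0 => simp only [map_zero, add_zero]
    | ht n x =>
      refine (BT.tmul_add _ _ _).symm.trans (congrArg (BT.tmul A n) ?_)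
      exact (map_add (BT.contrL ((σ i).R x).lin) y z).symm
    | ha x y hx hy => simp only [map_add, ← hx, ← hy]; abel

/-- The natural transformation `J_M(m ⊗ c) = ∑ᵢ mᵢ₀ σᵢ(mᵢ₁, c)` given by balanced forms. It is
colinear by the identity `x₁ σ(x₂, c) = σ(x, c₁) c₂`. -/
noncomputable def natTransOfFormR :
    forgetR A C ⋙ copower (ModuleCat.{u} Aᵐᵒᵖ) I ⋙ inductionR A C ⟶ 𝟭 (RComod A C) where
  app M :=
    { f := ModuleCat.ofHom
        { toFun := formMapR σ M
          map_add' := map_add _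
          map_smul' := fun a x => by
            induction a using MulOpposite.rec' with
            | h a =>
            refine DFunLike.congr_fun (f := (formMapR σ M).comp (BT.actR (MulOpposite.op a)))
              (g := (DistribSMul.toAddMonoidHom M.A (MulOpposite.op a)).comp (formMapR σ M))
              (BT.copower_left_hom_ext fun i n c => ?_) x
            change formMapR σ M (BT.tmul A (copowerι M.A i n) (MulOpposite.op a • c)) =
              MulOpposite.op a • formMapR σ M (BT.tmul A (copowerι M.A i n) c)
            rw [formMapR_ι, formMapR_ι, actOnR, actOnR]
            induction (coactR M n) using BT.induction with
            | h0 => simp only [map_zero, smul_zero]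
            | ht n d =>
              change MulOpposite.op ((σ i).L (MulOpposite.op a • c) d) • n = _
              rw [(σ i).L_apply, RDual.map_op_smul, ← (σ i).L_apply, MulOpposite.op_mul, mul_smul]
              rfl
            | ha x y hx hy => simp only [map_add, smul_add, hx, hy] }
      h := ModuleCat.hom_ext <| LinearMap.ext
          fun (x : BT A ((copower (ModuleCat.{u} Aᵐᵒᵖ) I).obj M.A) C) => by
        change BT.map _ LinearMap.id (deltaR A C _ x) = coactR M (formMapR σ M x)
        refine DFunLike.congr_fun (f := (BT.map _ LinearMap.id).comp (deltaR A C _).toAddMonoidHom)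
          (g := (coactR M).toAddMonoidHom.comp (formMapR σ M))
          (BT.copower_left_hom_ext fun i m c => ?_) x
        refine (map_formMapR_assocInv σ M _ (fun _ => rfl) i m (Coring.comul c)).trans ?_
        change _ = coactR M (formMapR σ M (BT.tmul A (copowerι M.A i m) c))
        rw [formMapR_ι, coactR_actOnR]
        congr 2
        exact LinearMap.ext fun x => ((σ i).op_L_smul c x).symm }
  naturality M M' f := Comonad.Coalgebra.Hom.ext' _ _ _ _ <| ModuleCat.hom_ext <| LinearMap.ext
      fun (x : BT A ((copower (ModuleCat.{u} Aᵐᵒᵖ) I).obj M.A) C) => by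
    refine DFunLike.congr_fun
      (f := (formMapR σ M').comp
        (BT.map ((copower (ModuleCat.{u} Aᵐᵒᵖ) I).map f.f).hom LinearMap.id))
      (g := f.f.hom.toAddMonoidHom.comp (formMapR σ M))
      (BT.copower_left_hom_ext fun i m c => ?_) x
    change formMapR σ M' (BT.tmul A (((copower (ModuleCat.{u} Aᵐᵒᵖ) I).map f.f).hom
      (copowerι M.A i m)) c) = f.f.hom (formMapR σ M (BT.tmul A (copowerι M.A i m) c))
    rw [copower_map_ι, formMapR_ι, formMapR_ι, actOnR_hom]

theorem natTransR_natTransOfFormR (M : RComod A C) (i : I) (c : C) (m : M.A) :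
    natTransR (natTransOfFormR σ) M i c m = actOnR M ((σ i).L c) m :=
  formMapR_ι σ M i m c

end ToNatTrans

end RightComodules

/-! ### Local units and quasi-adjoints on right comodules -/

section RightUnits

variable {A C : Type u} [Ring A] [AddCommGroup C] [Module A C] {I : Type u}

/-- The right linear map `a ↦ n a` from `A`. -/
def toSpanR {N : ModuleCat.{u} Aᵐᵒᵖ} (n : N) : ModuleCat.of Aᵐᵒᵖ A ⟶ N :=
  ModuleCat.ofHom
    { toFun := fun a => MulOpposite.op a • n
      map_add' := fun a b => by rw [MulOpposite.op_add, add_smul]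
      map_smul' := fun b a => by
        rw [MulOpposite.smul_eq_mul_unop, MulOpposite.op_mul, mul_smul]
        rfl }

theorem toSpanR_one {N : ModuleCat.{u} Aᵐᵒᵖ} (n : N) : (toSpanR n).hom (1 : A) = n :=
  one_smul Aᵐᵒᵖ n

/-- Left multiplication by `a` as an endomorphism of the right module `A`. -/
def lmulModR (a : A) : ModuleCat.of Aᵐᵒᵖ A ⟶ ModuleCat.of Aᵐᵒᵖ A :=
  toSpanR (N := ModuleCat.of Aᵐᵒᵖ A) a

variable (A C I) in
/-- The map `A^(I) ⊗_A C → C^(I)`. -/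
noncomputable def tensorCopowerR :
    BT A ((copower (ModuleCat.{u} Aᵐᵒᵖ) I).obj (ModuleCat.of Aᵐᵒᵖ A)) C →+ (I →₀ C) :=
  BT.lift (fun w c => Finsupp.mapRange.addMonoidHom ((smulAddHom A C).flip c)
      (copowerCoord (ModuleCat.of Aᵐᵒᵖ A) w : I →₀ A))
    (fun w w' c => by rw [map_add]; exact map_add _ _ _)
    (fun w c d => Finsupp.ext fun i => smul_add _ c d)
    (fun w a c => by
      rw [map_smul]
      exact Finsupp.ext fun i => mul_smul _ a c)

theorem tensorCopowerR_ι (i : I) (a : A) (c : C) :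
    tensorCopowerR A C I (BT.tmul A (copowerι (ModuleCat.of Aᵐᵒᵖ A) i a) c) =
      Finsupp.single i (a • c) := by
  change Finsupp.mapRange.addMonoidHom ((smulAddHom A C).flip c)
    (copowerCoord (ModuleCat.of Aᵐᵒᵖ A) (copowerι (ModuleCat.of Aᵐᵒᵖ A) i a) : I →₀ A) = _
  rw [copowerCoord_ι]
  exact Finsupp.mapRange_single (hf := map_zero _)

variable [Module Aᵐᵒᵖ C] [SMulCommClass A Aᵐᵒᵖ C]

variable (A C I) in
/-- The map `(A ⊗_A C)^(I) → C^(I)`. -/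
noncomputable def copowerTensorR :
    (copower (ModuleCat.{u} Aᵐᵒᵖ) I).obj (ModuleCat.of Aᵐᵒᵖ (BT A (ModuleCat.of Aᵐᵒᵖ A) C)) →+
      (I →₀ C) :=
  (Finsupp.mapRange.addMonoidHom (BT.contrL (LinearMap.id : A →ₗ[Aᵐᵒᵖ] A))).comp
    (copowerCoord (ModuleCat.of Aᵐᵒᵖ (BT A (ModuleCat.of Aᵐᵒᵖ A) C))).toAddMonoidHom

theorem copowerTensorR_ι (i : I) (y : BT A A C) :
    copowerTensorR A C I (copowerι (ModuleCat.of Aᵐᵒᵖ (BT A (ModuleCat.of Aᵐᵒᵖ A) C)) i y) =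
      Finsupp.single i (BT.contrL (LinearMap.id : A →ₗ[Aᵐᵒᵖ] A) y) := by
  change Finsupp.mapRange.addMonoidHom (BT.contrL (LinearMap.id : A →ₗ[Aᵐᵒᵖ] A))
    (copowerCoord (ModuleCat.of Aᵐᵒᵖ (BT A (ModuleCat.of Aᵐᵒᵖ A) C)) _ : I →₀ BT A A C) = _
  rw [copowerCoord_ι]
  exact Finsupp.mapRange_single (hf := map_zero _)

/-- Two additive maps out of `(A ⊗_A C)^(I)` agree if they agree on the elements `1 ⊗ c` of each
summand. -/
theorem copower_tensor_hom_ext {P : Type u} [AddCommGroup P]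
    {Φ Ψ : (copower (ModuleCat.{u} Aᵐᵒᵖ) I).obj
      (ModuleCat.of Aᵐᵒᵖ (BT A (ModuleCat.of Aᵐᵒᵖ A) C)) →+ P}
    (h : ∀ i c, Φ (copowerι (ModuleCat.of Aᵐᵒᵖ (BT A (ModuleCat.of Aᵐᵒᵖ A) C)) i
        (BT.tmul A (1 : A) c)) =
      Ψ (copowerι (ModuleCat.of Aᵐᵒᵖ (BT A (ModuleCat.of Aᵐᵒᵖ A) C)) i (BT.tmul A (1 : A) c))) :
    Φ = Ψ := by
  refine copower_addHom_ext fun i y => ?_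
  let k : BT A A C →+ _ :=
    (copowerι (I := I) (ModuleCat.of Aᵐᵒᵖ (BT A (ModuleCat.of Aᵐᵒᵖ A) C)) i).toAddMonoidHom
  refine DFunLike.congr_fun (f := Φ.comp k) (g := Ψ.comp k) (BT.hom_ext fun a c => ?_) y
  have h1 : BT.tmul A a c = BT.tmul A (1 : A) (a • c) := by
    rw [← BT.smul_tmul]
    exact congrArg (fun b : A => BT.tmul A b c) (one_mul a).symm
  rw [h1]
  exact h i (a • c)

variable [Coring A C]

section Left

/-- The natural transformation `n ↦ ∑ᵢ n ⊗ zᵢ` given by an invariant family. -/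
noncomputable def tensorInvariantsR (z : I →₀ C) (hz : z ∈ invariants A C I) :
    𝟭 (ModuleCat.{u} Aᵐᵒᵖ) ⟶
      (copower (ModuleCat.{u} Aᵐᵒᵖ) I ⋙ inductionR A C) ⋙ forgetR A C where
  app N := ModuleCat.ofHom
    { toFun := fun n => (z.sum fun i x => BT.tmul A (copowerι N i n) x :
        BT A ((copower (ModuleCat.{u} Aᵐᵒᵖ) I).obj N) C)
      map_add' := fun m n => by
        refine Eq.trans ?_ Finsupp.sum_add
        refine Finsupp.sum_congr fun i _ => ?_
        rw [map_add, BT.add_tmul]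
      map_smul' := fun a n => by
        induction a using MulOpposite.rec' with
        | h a =>
          refine Eq.trans ?_ (map_finsuppSum (BT.actR (MulOpposite.op a)) z _).symm
          refine Finsupp.sum_congr fun i _ => ?_
          rw [map_smul, BT.smul_tmul, hz a i]
          rfl }
  naturality N N' f := ModuleCat.hom_ext <| LinearMap.ext fun n => by
    refine Eq.trans ?_ (map_finsuppSum
      (BT.map ((copower (ModuleCat.{u} Aᵐᵒᵖ) I).map f).hom LinearMap.id) z _).symm
    refine Finsupp.sum_congr fun i _ => ?_
    rw [BT.map_tmul, copower_map_ι]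
    rfl

variable (β : 𝟭 (ModuleCat.{u} Aᵐᵒᵖ) ⟶
  (copower (ModuleCat.{u} Aᵐᵒᵖ) I ⋙ inductionR A C) ⋙ forgetR A C)

/-- The map `β_N` with values in the tensor product. -/
noncomputable def tensorAppR (N : ModuleCat.{u} Aᵐᵒᵖ) :
    N →ₗ[Aᵐᵒᵖ] BT A ((copower (ModuleCat.{u} Aᵐᵒᵖ) I).obj N) C := (β.app N).hom

theorem tensorAppR_naturality {N N' : ModuleCat.{u} Aᵐᵒᵖ} (f : N ⟶ N') (n : N) :
    tensorAppR β N' (f.hom n) =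
      BT.map ((copower (ModuleCat.{u} Aᵐᵒᵖ) I).map f).hom LinearMap.id (tensorAppR β N n) :=
  congrArg (fun k => k.hom n) (β.naturality f)

/-- The invariant family `β_A(1)` given by a natural transformation `β`. -/
noncomputable def tensorFamilyR : I →₀ C :=
  tensorCopowerR A C I (tensorAppR β (ModuleCat.of Aᵐᵒᵖ A) (1 : A))

theorem tensorFamilyR_mem : tensorFamilyR β ∈ invariants A C I := fun a i => by
  have h1 : tensorAppR β (ModuleCat.of Aᵐᵒᵖ A) ((lmulModR a).hom (1 : A)) =
      MulOpposite.op a • tensorAppR β (ModuleCat.of Aᵐᵒᵖ A) (1 : A) := by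
    rw [← map_smul]
    refine congrArg (tensorAppR β (ModuleCat.of Aᵐᵒᵖ A)) ((toSpanR_one _).trans ?_)
    exact (one_mul a).symm
  rw [tensorAppR_naturality] at h1
  have h2 : ∀ w : BT A ((copower (ModuleCat.{u} Aᵐᵒᵖ) I).obj (ModuleCat.of Aᵐᵒᵖ A)) C,
      tensorCopowerR A C I (BT.map ((copower (ModuleCat.{u} Aᵐᵒᵖ) I).map (lmulModR a)).hom
        LinearMap.id w) = a • tensorCopowerR A C I w := fun w => by
    refine DFunLike.congr_fun (f := (tensorCopowerR A C I).comp (BT.map _ LinearMap.id))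
      (g := (DistribSMul.toAddMonoidHom (I →₀ C) a).comp (tensorCopowerR A C I))
      (BT.copower_left_hom_ext fun i b c => ?_) w
    change tensorCopowerR A C I (BT.tmul A (((copower (ModuleCat.{u} Aᵐᵒᵖ) I).map (lmulModR a)).hom
      (copowerι (ModuleCat.of Aᵐᵒᵖ A) i b)) c) = a • tensorCopowerR A C I (BT.tmul A _ c)
    rw [copower_map_ι, tensorCopowerR_ι, tensorCopowerR_ι, Finsupp.smul_single]
    exact congrArg (Finsupp.single i) (mul_smul a b c)
  have h3 : ∀ w : BT A ((copower (ModuleCat.{u} Aᵐᵒᵖ) I).obj (ModuleCat.of Aᵐᵒᵖ A)) C,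
      tensorCopowerR A C I (MulOpposite.op a • w) = MulOpposite.op a • tensorCopowerR A C I w :=
      fun w => by
    refine DFunLike.congr_fun (f := (tensorCopowerR A C I).comp (BT.actR (MulOpposite.op a)))
      (g := (DistribSMul.toAddMonoidHom (I →₀ C) (MulOpposite.op a)).comp (tensorCopowerR A C I))
      (BT.copower_left_hom_ext fun i b c => ?_) w
    change tensorCopowerR A C I (BT.tmul A _ (MulOpposite.op a • c)) =
      MulOpposite.op a • tensorCopowerR A C I (BT.tmul A _ c)
    rw [tensorCopowerR_ι, tensorCopowerR_ι, Finsupp.smul_single, smul_comm]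
  have h4 := congrArg (tensorCopowerR A C I) h1
  rw [h2, h3] at h4
  exact DFunLike.congr_fun h4 i

variable {J : forgetR A C ⋙ copower (ModuleCat.{u} Aᵐᵒᵖ) I ⋙ inductionR A C ⟶ 𝟭 (RComod A C)}
  {σ : I → BalancedForm A C}
  (hJ : ∀ (M : RComod A C) i c m, natTransR J M i c m = actOnR M ((σ i).L c) m)

/-- The map `J_M` as an additive map out of the tensor product. -/
noncomputable def natTransMapR
    (J : forgetR A C ⋙ copower (ModuleCat.{u} Aᵐᵒᵖ) I ⋙ inductionR A C ⟶ 𝟭 (RComod A C))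
    (M : RComod A C) : BT A ((copower (ModuleCat.{u} Aᵐᵒᵖ) I).obj M.A) C →+ M.A :=
  (J.app M).f.hom.toAddMonoidHom

include hJ in
theorem natTransMapR_tensorInvariantsR (z : I →₀ C) (hz : z ∈ invariants A C I) (M : RComod A C)
    (m : M.A) : natTransMapR J M (tensorAppR (tensorInvariantsR z hz) M.A m) =
      actOnR M (sumFormL σ z) m := by
  refine (map_finsuppSum (natTransMapR J M) z _).trans ?_
  refine Eq.trans ?_ (map_finsuppSum (actOnRHom M m) z _).symm
  exact Finsupp.sum_congr fun i _ => hJ M i (z i) m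

include hJ in
/-- The composite `J_M ∘ β_M` is the action of `∑ᵢ σᵢ(-, zᵢ)`, where `z = β_A(1)`: by naturality,
`β_M(m)` is the image of `β_A(1)` under `a ↦ m a`. -/
theorem natTransMapR_tensorAppR (M : RComod A C) (m : M.A) :
    natTransMapR J M (tensorAppR β M.A m) = actOnR M (sumFormL σ (tensorFamilyR β)) m := by
  have h1 := tensorAppR_naturality β (toSpanR m) (1 : A)
  rw [toSpanR_one] at h1
  rw [h1]
  refine DFunLike.congr_fun (f := (natTransMapR J M).comp (BT.map _ LinearMap.id))
    (g := (actOnRHom M m).comp ((sumFormLHom σ).lin.toAddMonoidHom.comp (tensorCopowerR A C I)))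
    (BT.copower_left_hom_ext fun i a c => ?_) _
  change natTransMapR J M (BT.tmul A (((copower (ModuleCat.{u} Aᵐᵒᵖ) I).map (toSpanR m)).hom
      (copowerι (ModuleCat.of Aᵐᵒᵖ A) i a)) c) =
    actOnR M (sumFormL σ (tensorCopowerR A C I (BT.tmul A _ c))) m
  rw [copower_map_ι, tensorCopowerR_ι, sumFormL_single, (σ i).L_smul]
  refine (hJ M i c _).trans ?_
  refine (congrArg (BT.contrR _) (map_smul (coactR M) (MulOpposite.op a) m)).trans ?_
  exact BT.contrR_op_smul_lin _ _ _

variable (A C I) in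
/-- The condition that `F` be a right locally quasi-adjoint for `G` amounts to the existence of
local units of the form `∑ᵢ σᵢ(-, zᵢ)`. -/
theorem hasUnitalEndLeft_fgpR_iff (hgen : (fgpR A C).IsSeparating) :
    HasUnitalEndLeft I (fgpR A C) (forgetR A C) (inductionR A C) ↔
      ∃ σ : I → BalancedForm A C, RightUnital σ := by
  classical
  rw [hasUnitalEndLeft_iff]
  constructor
  · rintro ⟨J, h⟩
    refine ⟨BalancedForm.ofNatTransR J, fun s => ?_⟩
    obtain ⟨M, hM, f, hf⟩ := exists_hom_of_isSeparating hgen (selfRComod A C) s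
    obtain ⟨β, hβ⟩ := h M hM (selfRComod A C) f.f
    refine ⟨tensorFamilyR β, tensorFamilyR_mem β, fun c hc => ?_⟩
    obtain ⟨m, hm⟩ := hf c hc
    have h1 : natTransMapR J _ (tensorAppR β _ (f.f.hom m)) = f.f.hom m :=
      congrArg (fun k => k.hom m) hβ
    rw [natTransMapR_tensorAppR β (natTransR_eq J), hm] at h1
    exact h1
  · rintro ⟨σ, hσ⟩
    refine ⟨natTransOfFormR σ, fun M hM M' f => ?_⟩
    obtain ⟨t, ht⟩ := hM.1
    choose s hs using fun m : M.A => BT.exists_finset_right (coactR M' (f.hom m))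
    obtain ⟨z, hz, hzs⟩ := (rightUnital_iff σ).1 hσ (t.biUnion s)
    refine ⟨tensorInvariantsR z hz, ModuleCat.hom_ext (LinearMap.ext_on ht fun m hm => ?_)⟩
    refine (natTransMapR_tensorInvariantsR (natTransR_natTransOfFormR σ) z hz M' (f.hom m)).trans ?_
    refine Eq.trans ?_ (actOnR_one M' (f.hom m))
    refine hs m _ (BT.contrR (sumFormL σ z).lin) (BT.contrR (1 : LDual A C).lin) fun n c hc => ?_
    exact congrArg (fun a => MulOpposite.op a • n) (hzs c (Finset.mem_biUnion.2 ⟨m, hm, hc⟩))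

end Left

section Right

/-- The natural transformation `n ↦ ∑ᵢ n ⊗ zᵢ` given by an invariant family. -/
noncomputable def copowerInvariantsR (z : I →₀ C) (hz : z ∈ invariants A C I) :
    𝟭 (ModuleCat.{u} Aᵐᵒᵖ) ⟶
      inductionR A C ⋙ forgetR A C ⋙ copower (ModuleCat.{u} Aᵐᵒᵖ) I where
  app N := ModuleCat.ofHom
    { toFun := fun n => (z.sum fun i x =>
        copowerι (ModuleCat.of Aᵐᵒᵖ (BT A N C)) i (BT.tmul A n x) :
        (copower (ModuleCat.{u} Aᵐᵒᵖ) I).obj (ModuleCat.of Aᵐᵒᵖ (BT A N C)))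
      map_add' := fun m n => by
        refine Eq.trans ?_ Finsupp.sum_add
        refine Finsupp.sum_congr fun i _ => ?_
        rw [BT.add_tmul]
        exact map_add _ _ _
      map_smul' := fun a n => by
        induction a using MulOpposite.rec' with
        | h a =>
          refine Eq.trans ?_ (map_finsuppSum (DistribSMul.toAddMonoidHom
            ((copower (ModuleCat.{u} Aᵐᵒᵖ) I).obj (ModuleCat.of Aᵐᵒᵖ (BT A N C)))
            (MulOpposite.op a)) z _).symm
          refine Finsupp.sum_congr fun i _ => ?_
          rw [BT.smul_tmul, hz a i]
          exact map_smul (copowerι (ModuleCat.of Aᵐᵒᵖ (BT A N C)) i) (MulOpposite.op a)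
            (BT.tmul A n (z i)) }
  naturality N N' f := ModuleCat.hom_ext <| LinearMap.ext fun n => by
    refine Eq.trans ?_ (map_finsuppSum
      ((copower (ModuleCat.{u} Aᵐᵒᵖ) I).map ((tensorRight A C).map f)).hom z
      fun i x => copowerι (ModuleCat.of Aᵐᵒᵖ (BT A N C)) i (BT.tmul A n x)).symm
    exact Finset.sum_congr rfl fun i _ =>
      (copower_map_ι ((tensorRight A C).map f) i (BT.tmul A n (z i))).symm

variable (β : 𝟭 (ModuleCat.{u} Aᵐᵒᵖ) ⟶
  inductionR A C ⋙ forgetR A C ⋙ copower (ModuleCat.{u} Aᵐᵒᵖ) I)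

/-- The map `β_N` with values in the copower of the tensor product. -/
noncomputable def copowerAppR (N : ModuleCat.{u} Aᵐᵒᵖ) :
    N →ₗ[Aᵐᵒᵖ] (copower (ModuleCat.{u} Aᵐᵒᵖ) I).obj (ModuleCat.of Aᵐᵒᵖ (BT A N C)) := (β.app N).hom

theorem copowerAppR_naturality {N N' : ModuleCat.{u} Aᵐᵒᵖ} (f : N ⟶ N') (n : N) :
    copowerAppR β N' (f.hom n) =
      ((copower (ModuleCat.{u} Aᵐᵒᵖ) I).map ((tensorRight A C).map f)).hom (copowerAppR β N n) :=
  congrArg (fun k => k.hom n) (β.naturality f)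

/-- The invariant family `β_A(1)` given by a natural transformation `β`. -/
noncomputable def copowerFamilyR : I →₀ C :=
  copowerTensorR A C I (copowerAppR β (ModuleCat.of Aᵐᵒᵖ A) (1 : A))

theorem copowerFamilyR_mem : copowerFamilyR β ∈ invariants A C I := fun a i => by
  have h1 : copowerAppR β (ModuleCat.of Aᵐᵒᵖ A) ((lmulModR a).hom (1 : A)) =
      MulOpposite.op a • copowerAppR β (ModuleCat.of Aᵐᵒᵖ A) (1 : A) := by
    rw [← map_smul]
    refine congrArg (copowerAppR β (ModuleCat.of Aᵐᵒᵖ A)) ((toSpanR_one _).trans ?_)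
    exact (one_mul a).symm
  rw [copowerAppR_naturality] at h1
  have h2 : ∀ w, copowerTensorR A C I (((copower (ModuleCat.{u} Aᵐᵒᵖ) I).map
      ((tensorRight A C).map (lmulModR a))).hom w) = a • copowerTensorR A C I w := fun w => by
    refine DFunLike.congr_fun (f := (copowerTensorR A C I).comp
        ((copower (ModuleCat.{u} Aᵐᵒᵖ) I).map
          ((tensorRight A C).map (lmulModR a))).hom.toAddMonoidHom)
      (g := (DistribSMul.toAddMonoidHom (I →₀ C) a).comp (copowerTensorR A C I))
      (copower_tensor_hom_ext fun i c => ?_) w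
    refine (congrArg (copowerTensorR A C I)
      (copower_map_ι ((tensorRight A C).map (lmulModR a)) i (BT.tmul A (1 : A) c))).trans ?_
    refine (copowerTensorR_ι i _).trans ?_
    refine Eq.trans ?_ (congrArg (a • ·) (copowerTensorR_ι i (BT.tmul A (1 : A) c)).symm)
    rw [Finsupp.smul_single]
    refine congrArg (Finsupp.single i) ?_
    change (a * 1) • c = a • (1 : A) • c
    rw [mul_one, one_smul]
  have h3 : ∀ w, copowerTensorR A C I (MulOpposite.op a • w) =
      MulOpposite.op a • copowerTensorR A C I w := fun w => by
    refine DFunLike.congr_fun (f := (copowerTensorR A C I).comp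
        (DistribSMul.toAddMonoidHom _ (MulOpposite.op a)))
      (g := (DistribSMul.toAddMonoidHom (I →₀ C) (MulOpposite.op a)).comp (copowerTensorR A C I))
      (copower_tensor_hom_ext fun i c => ?_) w
    refine (congrArg (copowerTensorR A C I) (map_smul (copowerι (ModuleCat.of Aᵐᵒᵖ
      (BT A (ModuleCat.of Aᵐᵒᵖ A) C)) i) (MulOpposite.op a) (BT.tmul A (1 : A) c)).symm).trans ?_
    refine (copowerTensorR_ι i _).trans ?_
    refine Eq.trans ?_ (congrArg (MulOpposite.op a • ·)
      (copowerTensorR_ι i (BT.tmul A (1 : A) c)).symm)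
    rw [Finsupp.smul_single]
    refine congrArg (Finsupp.single i) ?_
    exact smul_comm (1 : A) (MulOpposite.op a) c
  exact DFunLike.congr_fun
    ((h2 _).symm.trans ((congrArg (copowerTensorR A C I) h1).trans (h3 _))) i

variable {J : forgetR A C ⋙ copower (ModuleCat.{u} Aᵐᵒᵖ) I ⋙ inductionR A C ⟶ 𝟭 (RComod A C)}
  {σ : I → BalancedForm A C}
  (hJ : ∀ (M : RComod A C) i c m, natTransR J M i c m = actOnR M ((σ i).L c) m)

/-- The map `J` at the comodule `N ⊗_A C`. -/
noncomputable def natTransIndR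
    (J : forgetR A C ⋙ copower (ModuleCat.{u} Aᵐᵒᵖ) I ⋙ inductionR A C ⟶ 𝟭 (RComod A C))
    (N : ModuleCat.{u} Aᵐᵒᵖ) :
    BT A ((copower (ModuleCat.{u} Aᵐᵒᵖ) I).obj (ModuleCat.of Aᵐᵒᵖ (BT A N C))) C →+ BT A N C :=
  natTransMapR J ((inductionR A C).obj N)

include hJ in
theorem natTransIndR_ι (N : ModuleCat.{u} Aᵐᵒᵖ) (i : I) (n : N) (x c : C) :
    natTransIndR J N (BT.tmul A (copowerι (ModuleCat.of Aᵐᵒᵖ (BT A N C)) i (BT.tmul A n x)) c) =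
      BT.tmul A n ((σ i).R x • c) := by
  rw [← (σ i).op_L_smul]
  exact (hJ ((inductionR A C).obj N) i c (BT.tmul A n x)).trans (actOnR_induction N _ n x)

include hJ in
theorem natTransIndR_copowerInvariantsR (z : I →₀ C) (hz : z ∈ invariants A C I)
    (N : ModuleCat.{u} Aᵐᵒᵖ) (n : N) (c : C) :
    natTransIndR J N (BT.tmul A (copowerAppR (copowerInvariantsR z hz) N n) c) =
      BT.tmul A n (sumFormR σ z • c) := by
  rw [sumFormR_smul]
  refine (map_finsuppSum ((natTransIndR J N).comp (BT.mkR c)) z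
    fun i x => copowerι (ModuleCat.of Aᵐᵒᵖ (BT A N C)) i (BT.tmul A n x)).trans ?_
  refine Eq.trans ?_ (map_finsuppSum (BT.mkL (A := A) (N := C) n) z _).symm
  exact Finsupp.sum_congr fun i _ => natTransIndR_ι hJ N i n (z i) c

include hJ in
/-- The composite of `β_N ⊗ C` and `J` is `N ⊗ e`, where `e = ∑ᵢ σᵢ(zᵢ, -)` and `z = β_A(1)`: by
naturality, `β_N(n)` is the image of `β_A(1)` under `a ↦ n a`. -/
theorem natTransIndR_copowerAppR (N : ModuleCat.{u} Aᵐᵒᵖ) (n : N) (c : C) :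
    natTransIndR J N (BT.tmul A (copowerAppR β N n) c) =
      BT.tmul A n (sumFormR σ (copowerFamilyR β) • c) := by
  have h1 := copowerAppR_naturality β (toSpanR n) (1 : A)
  rw [toSpanR_one] at h1
  rw [h1]
  refine DFunLike.congr_fun (f := (natTransIndR J N).comp ((BT.mkR c).comp
      ((copower (ModuleCat.{u} Aᵐᵒᵖ) I).map
        ((tensorRight A C).map (toSpanR n))).hom.toAddMonoidHom))
    (g := (BT.mkL n).comp (((smulAddHom (RDual A C) C).flip c).comp
      ((sumFormRHom σ).lin.toAddMonoidHom.comp (copowerTensorR A C I))))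
    (copower_tensor_hom_ext fun i x => ?_) _
  change natTransIndR J N (BT.tmul A (((copower (ModuleCat.{u} Aᵐᵒᵖ) I).map
      ((tensorRight A C).map (toSpanR n))).hom (copowerι (ModuleCat.of Aᵐᵒᵖ
        (BT A (ModuleCat.of Aᵐᵒᵖ A) C)) i (BT.tmul A (1 : A) x))) c) =
    BT.tmul A n (sumFormR σ (copowerTensorR A C I _) • c)
  rw [copowerTensorR_ι, BT.contrL_tmul, sumFormR_single]
  refine (congrArg (fun w => natTransIndR J N (BT.tmul A w c)) (copower_map_ι
    ((tensorRight A C).map (toSpanR n)) i (BT.tmul A (1 : A) x))).trans ?_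
  refine Eq.trans (congrArg (fun m => natTransIndR J N (BT.tmul A (copowerι (ModuleCat.of Aᵐᵒᵖ
    (BT A N C)) i (BT.tmul A m x)) c)) (toSpanR_one n)) ?_
  rw [natTransIndR_ι hJ]
  exact congrArg (fun y : C => BT.tmul A n ((σ i).R y • c)) (one_smul A x).symm

variable (A C I) in
/-- The condition that `G` be a left locally quasi-adjoint for `F` amounts to the existence of
local units of the form `∑ᵢ σᵢ(zᵢ, -)`. -/
theorem hasUnitalEndRight_fgpR_iff (hgen : (fgpR A C).IsSeparating) :
    HasUnitalEndRight I (fgpR A C) (forgetR A C) (inductionR A C) ↔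
      ∃ σ : I → BalancedForm A C, LeftUnital σ := by
  classical
  rw [hasUnitalEndRight_iff]
  constructor
  · rintro ⟨J, h⟩
    refine ⟨BalancedForm.ofNatTransR J, fun s => ?_⟩
    obtain ⟨M, hM, f, hf⟩ := exists_hom_of_isSeparating hgen (selfRComod A C) s
    -- the comodule `C` is induced from the module `A`
    obtain ⟨β, hβ⟩ := h M hM (ModuleCat.of Aᵐᵒᵖ A)
      (f ≫ tmulRComod (N := ModuleCat.of Aᵐᵒᵖ A) (1 : A))
    refine ⟨copowerFamilyR β, copowerFamilyR_mem β, fun c hc => ?_⟩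
    obtain ⟨m, hm⟩ := hf c hc
    let d : C := f.f.hom m
    have h1 : natTransIndR J (ModuleCat.of Aᵐᵒᵖ A) (BT.tmul A (copowerAppR β _ (1 : A)) d) =
        BT.tmul A (1 : A) d :=
      congrArg (fun k => k.f.hom m) hβ
    rw [show d = c from hm] at h1
    have h2 : ∀ d : C, BT.contrL (LinearMap.id : A →ₗ[Aᵐᵒᵖ] A) (BT.tmul A (1 : A) d) = d :=
      one_smul A
    have h3 :=
      (natTransIndR_copowerAppR β (natTransR_eq J) (ModuleCat.of Aᵐᵒᵖ A) (1 : A) c).symm.trans h1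
    exact (h2 _).symm.trans ((congrArg (BT.contrL (LinearMap.id : A →ₗ[Aᵐᵒᵖ] A)) h3).trans (h2 c))
  · rintro ⟨σ, hσ⟩
    refine ⟨natTransOfFormR σ, fun M hM N f => ?_⟩
    obtain ⟨t, ht⟩ := hM.1
    let ff : M.A →ₗ[Aᵐᵒᵖ] BT A N C := f.f.hom
    choose s hs using fun m : M.A => BT.exists_finset_right (ff m)
    obtain ⟨z, hz, hzs⟩ := hσ (t.biUnion s)
    refine ⟨copowerInvariantsR z hz, Comonad.Coalgebra.Hom.ext' _ _ _ _
      (ModuleCat.hom_ext (LinearMap.ext_on ht fun m hm => ?_))⟩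
    refine hs m _ ((natTransIndR (natTransOfFormR σ) N).comp
      (BT.map (copowerAppR (copowerInvariantsR z hz) N) LinearMap.id)) (AddMonoidHom.id _)
      fun n c hc => ?_
    refine (natTransIndR_copowerInvariantsR (natTransR_natTransOfFormR σ) z hz N n c).trans ?_
    rw [hzs c (Finset.mem_biUnion.2 ⟨m, hm, hc⟩)]
    rfl

end Right

end RightUnits

/-! ### Natural transformations on left comodules -/

section LeftComodules

theorem BT.contrL_smul_lin {A C M : Type u} [Ring A] [AddCommGroup C] [Module A C]
    [Module Aᵐᵒᵖ C] [SMulCommClass A Aᵐᵒᵖ C] [AddCommGroup M] [Module A M] (f : RDual A C)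
    (a : A) (x : BT A C M) :
    BT.contrL f.lin (a • x) = BT.contrL (RDual.lin (MulOpposite.op a • f)) x := by
  induction x using BT.induction with
  | h0 => simp only [smul_zero, map_zero]
  | ht m n => rfl
  | ha x y hx hy => simp only [smul_add, map_add, hx, hy]

theorem BT.copower_right_hom_ext {A C : Type u} [Ring A] [AddCommGroup C] [Module Aᵐᵒᵖ C]
    {I : Type u} {N : ModuleCat.{u} A} {P : Type u} [AddCommGroup P]
    {Φ Ψ : BT A C ((copower (ModuleCat.{u} A) I).obj N) →+ P}
    (h : ∀ i n c, Φ (BT.tmul A c (copowerι N i n)) = Ψ (BT.tmul A c (copowerι N i n))) :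
    Φ = Ψ := by
  refine BT.hom_ext fun c w => ?_
  exact DFunLike.congr_fun (copower_addHom_ext (Φ := Φ.comp (BT.mkL c)) (Ψ := Ψ.comp (BT.mkL c))
    fun i n => h i n c) w

variable {A C : Type u} [Ring A] [AddCommGroup C] [Module A C] [Module Aᵐᵒᵖ C]
  [SMulCommClass A Aᵐᵒᵖ C] [Coring A C]

instance : (leftComonad A C).toFunctor.PreservesZeroMorphisms where
  map_zero M N := by
    ext x
    change BT.map LinearMap.id 0 x = 0
    induction x using BT.induction with
    | h0 => rw [map_zero]
    | ht m n => exact BT.tmul_zero m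
    | ha x y hx hy => rw [map_add, hx, hy, add_zero]

variable (A C) in
/-- The coring `C` as a left comodule over itself. -/
def selfLComod : LComod A C where
  A := ModuleCat.of A C
  a := ModuleCat.ofHom Coring.comul
  counit := ModuleCat.hom_ext <| LinearMap.ext fun c => Coring.contrL_counit (A := A) c
  coassoc := ModuleCat.hom_ext <| LinearMap.ext fun c => Coring.coassoc (A := A) c

/-- Right multiplication by `a` as an endomorphism of the left comodule `C`. -/
def rmulLComod (a : A) : selfLComod A C ⟶ selfLComod A C where
  f := ModuleCat.ofHom (rmul a)
  h := ModuleCat.hom_ext <| LinearMap.ext fun (c : C) => by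
    change BT.map LinearMap.id (rmul a) (Coring.comul c) = Coring.comul (MulOpposite.op a • c)
    rw [Coring.comul_op_smul]
    induction (Coring.comul c : BT A C C) using BT.induction with
    | h0 => rw [map_zero, smul_zero]
    | ht m n => rfl
    | ha x y hx hy => rw [map_add, hx, hy, smul_add]

/-- The map `- ⊗ n` as a morphism of left comodules `C → C ⊗_A N`. -/
def tmulLComod {N : ModuleCat.{u} A} (n : N) :
    selfLComod A C ⟶ (inductionL A C).obj N where
  f := ModuleCat.ofHom ⟨⟨fun c => BT.tmul A c n, fun c d => BT.add_tmul c d n⟩, fun _ _ => rfl⟩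
  h := ModuleCat.hom_ext <| LinearMap.ext fun (c : C) => by
    change BT.map LinearMap.id (⟨⟨fun c => BT.tmul A c n, fun c d => BT.add_tmul c d n⟩,
      fun _ _ => rfl⟩ : C →ₗ[A] BT A C N) (Coring.comul c) =
        BT.assoc (BT.tmul A (Coring.comul c) n)
    induction (Coring.comul c : BT A C C) using BT.induction with
    | h0 => rw [map_zero, BT.zero_tmul, map_zero]
    | ht m n => rfl
    | ha x y hx hy => rw [map_add, hx, hy, BT.add_tmul, map_add]

/-- The coaction as a morphism of left comodules `M → C ⊗_A M`. -/
def coactLHom (M : LComod A C) : M ⟶ (inductionL A C).obj M.A where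
  f := M.a
  h := M.coassoc.symm

theorem contrL_counit_coactL (M : LComod A C) (m : M.A) :
    BT.contrL (counitR A C) (coactL M m) = m :=
  congrArg (fun k => k.hom m) M.counit

theorem actOnL_one (M : LComod A C) (m : M.A) : actOnL M 1 m = m := contrL_counit_coactL M m

/-- The left action of `C^*` on a comodule as an additive map in the scalar. -/
def actOnLHom (M : LComod A C) (m : M.A) : RDual A C →+ M.A :=
  AddMonoidHom.mk' (fun g => actOnL M g m) fun _ _ => BT.contrL_add _ _ _

theorem actOnL_add (M : LComod A C) (g : RDual A C) (m n : M.A) :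
    actOnL M g (m + n) = actOnL M g m + actOnL M g n := by
  rw [actOnL, map_add, map_add]
  rfl

theorem actOnL_zero (M : LComod A C) (g : RDual A C) : actOnL M g 0 = 0 := by
  rw [actOnL, map_zero, map_zero]

/-- By coassociativity, the coaction of `g(m₋₁) m₀` is `g(m₋₁₁) m₋₁₂ ⊗ m₀`. -/
theorem coactL_actOnL (M : LComod A C) (g : RDual A C) (m : M.A) :
    coactL M (actOnL M g m) = BT.map g.act LinearMap.id (coactL M m) := by
  have h1 : ∀ y : BT A C M.A, coactL M (BT.contrL g.lin y) =
      BT.contrL g.lin (BT.map LinearMap.id (coactL M) y) := fun y => by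
    induction y using BT.induction with
    | h0 => simp only [map_zero]
    | ht n c => exact map_smul (coactL M) _ _
    | ha x y hx hy => simp only [map_add, hx, hy]
  have h2 : ∀ (n : M.A) (y : BT A C C), BT.contrL g.lin (BT.assoc (BT.tmul A y n)) =
      BT.tmul A (BT.contrL g.lin y) n := fun n y => by
    induction y using BT.induction with
    | h0 => simp only [BT.zero_tmul, map_zero]
    | ht c d => rfl
    | ha x y hx hy => rw [BT.add_tmul, map_add, map_add, hx, hy, map_add, BT.add_tmul]
  have h3 : ∀ y : BT A C M.A, BT.contrL g.lin (deltaL A C M.A y) =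
      BT.map g.act LinearMap.id y := fun y => by
    induction y using BT.induction with
    | h0 => simp only [map_zero]
    | ht c n => exact h2 n _
    | ha x y hx hy => simp only [map_add, hx, hy]
  have h4 : deltaL A C M.A (coactL M m) = BT.map LinearMap.id (coactL M) (coactL M m) :=
    congrArg (fun k => k.hom m) M.coassoc
  rw [actOnL, h1, ← h4, h3]

theorem actOnL_hom {M M' : LComod A C} (f : M ⟶ M') (g : RDual A C) (m : M.A) :
    actOnL M' g (f.f.hom m) = f.f.hom (actOnL M g m) := by
  have h : coactL M' (f.f.hom m) = BT.map LinearMap.id f.f.hom (coactL M m) :=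
    (congrArg (fun k => k.hom m) f.h).symm
  rw [actOnL, actOnL, h]
  induction (coactL M m) using BT.induction with
  | h0 => simp only [map_zero]
  | ht c n => exact (map_smul f.f.hom _ _).symm
  | ha x y hx hy => simp only [map_add, hx, hy]

theorem actOnL_induction (N : ModuleCat.{u} A) (g : RDual A C) (n : N) (c : C) :
    actOnL ((inductionL A C).obj N) g (BT.tmul A c n) = BT.tmul A (g • c) n :=
  actOnL_hom (tmulLComod n) g c

/-- The left action is left linear for the bilinear elements of `C^*`. -/
theorem actOnL_smul (M : LComod A C) {g : RDual A C}
    (hg : ∀ (a : A) (c : C), g (a • c) = a * g c) (a : A) (m : M.A) :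
    actOnL M g (a • m) = a • actOnL M g m := by
  rw [actOnL, actOnL, map_smul]
  induction (coactL M m) using BT.induction with
  | h0 => simp only [smul_zero, map_zero]
  | ht c n =>
    change g (a • c) • n = _
    rw [hg, mul_smul]
    rfl
  | ha x y hx hy => simp only [smul_add, map_add, hx, hy]

variable {I : Type u}

section OfNatTrans

variable (J : forgetL A C ⋙ copower (ModuleCat.{u} A) I ⋙ inductionL A C ⟶ 𝟭 (LComod A C))

/-- The value `J_M(c ⊗ m)`, for `m` in the summand of `M^(I)` with index `i`. -/
noncomputable def natTransL (M : LComod A C) (i : I) (c : C) : M.A →+ M.A :=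
  (J.app M).f.hom.toAddMonoidHom.comp
    ((BT.mkL (A := A) c).comp (copowerι (I := I) M.A i).toAddMonoidHom)

theorem natTransL_naturality {M M' : LComod A C} (f : M ⟶ M') (i : I) (c : C) (m : M.A) :
    natTransL J M' i c (f.f.hom m) = f.f.hom (natTransL J M i c m) := by
  have h := congrArg (fun k => k.f.hom (BT.tmul A c (copowerι M.A i m))) (J.naturality f)
  refine Eq.trans ?_ h
  change (J.app M').f.hom (BT.tmul A c (copowerι M'.A i (f.f.hom m))) =
    (J.app M').f.hom (BT.tmul A c (((copower (ModuleCat.{u} A) I).map f.f).hom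
      (copowerι M.A i m)))
  rw [copower_map_ι]

/-- The map `x ↦ J_C(c ⊗ x)`, which is right linear by naturality. -/
noncomputable def natTransSelfL (i : I) (c : C) : C →ₗ[Aᵐᵒᵖ] C where
  toFun := natTransL J (selfLComod A C) i c
  map_add' := map_add (natTransL J (selfLComod A C) i c)
  map_smul' a x := natTransL_naturality J (rmulLComod a.unop) i c x

theorem natTransL_induction (N : ModuleCat.{u} A) (i : I) (c : C) (y : BT A C N) :
    natTransL J ((inductionL A C).obj N) i c y = BT.map (natTransSelfL J i c) LinearMap.id y := by
  refine DFunLike.congr_fun (f := (natTransL J ((inductionL A C).obj N) i c : BT A C N →+ BT A C N))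
    (BT.hom_ext fun x n => ?_) y
  exact natTransL_naturality J (tmulLComod n) i c x

/-- The map `J_C : C ⊗_A C^(I) → C`. -/
noncomputable def natTransSelfMapL :
    BT A C ((copower (ModuleCat.{u} A) I).obj (ModuleCat.of A C)) →ₗ[A] C :=
  (J.app (selfLComod A C)).f.hom

/-- The partial maps `c ↦ ε(J_C(c ⊗ x))`. -/
noncomputable def natTransFormL (i : I) (x : C) : LDual A C :=
  (Coring.counit : C →ₗ[A] A).comp ((natTransSelfMapL J).comp
    (⟨⟨fun c => BT.tmul A c (copowerι (ModuleCat.of A C) i x), fun c d => BT.add_tmul c d _⟩,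
      fun _ _ => rfl⟩ : C →ₗ[A] BT A C ((copower (ModuleCat.{u} A) I).obj (ModuleCat.of A C))))

/-- `J_C(c ⊗ x) = ε(J_C(c ⊗ x₁)) x₂`, by naturality for the comultiplication `C → C ⊗_A C`. -/
theorem natTransSelfL_eq_right (i : I) (x c : C) :
    (show RDual A C from (counitR A C).comp (natTransSelfL J i c)) • x =
      natTransSelfL J i c x := by
  have h := natTransL_naturality J (coactLHom (selfLComod A C)) i c x
  have h2 := (natTransL_induction J (ModuleCat.of A C) i c (Coring.comul x)).symm.trans h
  have h3 := congrArg (BT.contrL (counitR A C)) h2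
  refine Eq.trans ?_ (h3.trans (Coring.contrL_counit _))
  rw [RDual.smul_def]
  induction (Coring.comul x : BT A C C) using BT.induction with
  | h0 => simp only [map_zero]
  | ht n c => rfl
  | ha x y hx hy => simp only [map_add, hx, hy]

/-- `J_C(c ⊗ x) = c₁ ε(J_C(c₂ ⊗ x))`, since `J_C` is a morphism of comodules. -/
theorem natTransSelfL_eq_left (i : I) (x c : C) :
    MulOpposite.op (natTransFormL J i x) • c = natTransSelfL J i c x := by
  have h : BT.map LinearMap.id (natTransSelfMapL J)
      (BT.assoc (BT.tmul A (Coring.comul c) (copowerι (ModuleCat.of A C) i x))) =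
      Coring.comul (natTransSelfL J i c x) :=
    congrArg (fun k => k.hom (BT.tmul A c (copowerι (ModuleCat.of A C) i x)))
      (J.app (selfLComod A C)).h
  have h3 := congrArg (BT.contrR (Coring.counit (A := A))) h
  refine Eq.trans ?_ (h3.trans (Coring.contrR_counit _))
  rw [LDual.op_smul_def]
  induction (Coring.comul c : BT A C C) using BT.induction with
  | h0 => simp only [map_zero, BT.zero_tmul]
  | ht n c => rfl
  | ha x y hx hy => simp only [map_add, BT.add_tmul, hx, hy]

/-- The balanced forms `σᵢ(c, x) = ε(J_C(c ⊗ x))` of a natural transformation `J`, where `x` is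
taken in the summand of `C^(I)` with index `i`. -/
noncomputable def BalancedForm.ofNatTransL (i : I) : BalancedForm A C where
  L := natTransFormL J i
  R c := (counitR A C).comp (natTransSelfL J i c)
  L_apply c x := rfl
  L_op_smul a c x := by
    refine congrArg (fun w => Coring.counit (A := A) (natTransSelfMapL J w)) ?_
    exact (BT.smul_tmul _ _ _).trans (congrArg (fun w => BT.tmul A x w)
      (map_smul (copowerι (ModuleCat.of A C) i) a c).symm)
  op_L_smul c x := (natTransSelfL_eq_left J i c x).trans (natTransSelfL_eq_right J i c x).symm

/-- `J_M(c ⊗ m) = σᵢ(c, m₋₁) m₀`, by naturality for the coaction `M → C ⊗_A M`. -/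
theorem natTransL_eq (M : LComod A C) (i : I) (c : C) (m : M.A) :
    natTransL J M i c m = actOnL M ((BalancedForm.ofNatTransL J i).R c) m := by
  have h := natTransL_naturality J (coactLHom M) i c m
  have h2 := (natTransL_induction J M.A i c (coactL M m)).symm.trans h
  have h3 := congrArg (BT.contrL (counitR A C)) h2
  refine ((contrL_counit_coactL M _).symm.trans h3.symm).trans ?_
  rw [actOnL]
  induction (coactL M m) using BT.induction with
  | h0 => simp only [map_zero]
  | ht n c => rfl
  | ha x y hx hy => simp only [map_add, hx, hy]

end OfNatTrans

section ToNatTrans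

variable (σ : I → BalancedForm A C)

/-- The map `c ⊗ m ↦ ∑ᵢ σᵢ(c, mᵢ₋₁) mᵢ₀`. -/
noncomputable def formMapL (M : LComod A C) :
    BT A C ((copower (ModuleCat.{u} A) I).obj M.A) →+ M.A :=
  BT.lift (fun c w => (copowerCoord M.A w).sum fun i m => actOnL M ((σ i).R c) m)
    (fun c d w => by
      rw [← Finsupp.sum_add]
      refine Finsupp.sum_congr fun i _ => ?_
      rw [(σ i).R_add]
      exact map_add (actOnLHom M _) _ _)
    (fun c w w' => by
      rw [map_add]
      exact Finsupp.sum_add_index' (fun i => actOnL_zero M _) fun i => actOnL_add M _)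
    (fun c a w => by
      rw [map_smul, Finsupp.sum_smul_index' fun i => actOnL_zero M _]
      refine Finsupp.sum_congr fun i _ => ?_
      rw [(σ i).R_op_smul, actOnL, actOnL, map_smul, BT.contrL_smul_lin])

theorem formMapL_ι (M : LComod A C) (i : I) (m : M.A) (c : C) :
    formMapL σ M (BT.tmul A c (copowerι M.A i m)) = actOnL M ((σ i).R c) m := by
  change (copowerCoord M.A (copowerι M.A i m)).sum _ = _
  rw [copowerCoord_ι, Finsupp.sum_single_index]
  exact actOnL_zero M _

/-- For `y = ∑ d ⊗ c`, the right linear map `x ↦ ∑ d σ(c, x)`. -/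
def BalancedForm.contrLeft (τ : BalancedForm A C) (y : BT A C C) : C →ₗ[Aᵐᵒᵖ] C where
  toFun x := BT.contrR (τ.L x).lin y
  map_add' x x' := by
    rw [τ.L_add]
    exact BT.contrR_add _ _ _
  map_smul' a x := by
    induction a using MulOpposite.rec' with
    | h a =>
    induction y using BT.induction with
    | h0 => simp only [map_zero, smul_zero]
    | ht d c =>
      change MulOpposite.op (τ.L (MulOpposite.op a • x) c) • d =
        MulOpposite.op a • MulOpposite.op (τ.L x c) • d
      rw [τ.L_apply, RDual.map_op_smul, ← τ.L_apply, MulOpposite.op_mul, mul_smul]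
    | ha x y hx hy =>
      simp only [map_add, smul_add, hx, hy]

/-- The map `C ⊗ formMapL` sends `d ⊗ (c ⊗ m)` to `d σᵢ(c, m₋₁) ⊗ m₀`. -/
theorem map_formMapL_assoc (M : LComod A C)
    (f : BT A C ((copower (ModuleCat.{u} A) I).obj M.A) →ₗ[A] M.A)
    (hf : ∀ x, f x = formMapL σ M x) (i : I) (m : M.A) (y : BT A C C) :
    BT.map LinearMap.id f (BT.assoc (BT.tmul A y (copowerι M.A i m))) =
      BT.map ((σ i).contrLeft y) LinearMap.id (coactL M m) := by
  induction y using BT.induction with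
  | h0 =>
    rw [BT.zero_tmul, map_zero, map_zero]
    induction (coactL M m) using BT.induction with
    | h0 => rw [map_zero]
    | ht x n => exact (BT.zero_tmul n).symm
    | ha x y hx hy => rw [map_add, ← hx, ← hy, add_zero]
  | ht d c =>
    change BT.tmul A d (f _) = _
    rw [hf, formMapL_ι, actOnL]
    induction (coactL M m) using BT.induction with
    | h0 => rw [map_zero, map_zero, BT.tmul_zero]
    | ht x n =>
      refine (BT.smul_tmul _ _ _).symm.trans ?_
      rw [BT.map_tmul]
      exact congrArg (fun a : A => BT.tmul A (MulOpposite.op a • d) n) ((σ i).L_apply x c).symm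
    | ha x y hx hy => rw [map_add, map_add, BT.tmul_add, hx, hy]
  | ha y z hy hz =>
    rw [BT.add_tmul, map_add, map_add, hy, hz]
    induction (coactL M m) using BT.induction with
    | h0 => simp only [map_zero, add_zero]
    | ht x n =>
      refine (BT.add_tmul _ _ _).symm.trans (congrArg (fun w => BT.tmul A w n) ?_)
      exact (map_add (BT.contrR ((σ i).L x).lin) y z).symm
    | ha x y hx hy => simp only [map_add, ← hx, ← hy]; abel

/-- The natural transformation `J_M(c ⊗ m) = ∑ᵢ σᵢ(c, mᵢ₋₁) mᵢ₀` given by balanced forms. It is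
colinear by the identity `x₁ σ(x₂, c) = σ(x, c₁) c₂`. -/
noncomputable def natTransOfFormL :
    forgetL A C ⋙ copower (ModuleCat.{u} A) I ⋙ inductionL A C ⟶ 𝟭 (LComod A C) where
  app M :=
    { f := ModuleCat.ofHom
        { toFun := formMapL σ M
          map_add' := map_add _
          map_smul' := fun a x => by
            refine DFunLike.congr_fun (f := (formMapL σ M).comp (BT.actL a))
              (g := (DistribSMul.toAddMonoidHom M.A a).comp (formMapL σ M))
              (BT.copower_right_hom_ext fun i n c => ?_) x
            change formMapL σ M (BT.tmul A (a • c) (copowerι M.A i n)) =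
              a • formMapL σ M (BT.tmul A c (copowerι M.A i n))
            rw [formMapL_ι, formMapL_ι, actOnL, actOnL]
            induction (coactL M n) using BT.induction with
            | h0 => simp only [map_zero, smul_zero]
            | ht d n =>
              change (σ i).R (a • c) d • n = _
              rw [← (σ i).L_apply, LDual.map_smul, (σ i).L_apply, mul_smul]
              rfl
            | ha x y hx hy => simp only [map_add, smul_add, hx, hy] }
      h := ModuleCat.hom_ext <| LinearMap.ext
          fun (x : BT A C ((copower (ModuleCat.{u} A) I).obj M.A)) => by
        change BT.map LinearMap.id _ (deltaL A C _ x) = coactL M (formMapL σ M x)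
        refine DFunLike.congr_fun (f := (BT.map LinearMap.id _).comp (deltaL A C _).toAddMonoidHom)
          (g := (coactL M).toAddMonoidHom.comp (formMapL σ M))
          (BT.copower_right_hom_ext fun i m c => ?_) x
        refine (map_formMapL_assoc σ M _ (fun _ => rfl) i m (Coring.comul c)).trans ?_
        change _ = coactL M (formMapL σ M (BT.tmul A c (copowerι M.A i m)))
        rw [formMapL_ι, coactL_actOnL]
        congr 2
        exact LinearMap.ext fun x => (σ i).op_L_smul x c }
  naturality M M' f := Comonad.Coalgebra.Hom.ext' _ _ _ _ <| ModuleCat.hom_ext <| LinearMap.ext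
      fun (x : BT A C ((copower (ModuleCat.{u} A) I).obj M.A)) => by
    refine DFunLike.congr_fun
      (f := (formMapL σ M').comp (BT.map LinearMap.id ((copower (ModuleCat.{u} A) I).map f.f).hom))
      (g := f.f.hom.toAddMonoidHom.comp (formMapL σ M))
      (BT.copower_right_hom_ext fun i m c => ?_) x
    change formMapL σ M' (BT.tmul A c (((copower (ModuleCat.{u} A) I).map f.f).hom
      (copowerι M.A i m))) = f.f.hom (formMapL σ M (BT.tmul A c (copowerι M.A i m)))
    rw [copower_map_ι, formMapL_ι, formMapL_ι, actOnL_hom]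

theorem natTransL_natTransOfFormL (M : LComod A C) (i : I) (c : C) (m : M.A) :
    natTransL (natTransOfFormL σ) M i c m = actOnL M ((σ i).R c) m :=
  formMapL_ι σ M i m c

end ToNatTrans

end LeftComodules

/-! ### Local units and quasi-adjoints on left comodules -/

section LeftUnits

variable {A C : Type u} [Ring A] [AddCommGroup C] [Module Aᵐᵒᵖ C] {I : Type u}

/-- The left linear map `a ↦ a n` from `A`. -/
def toSpanL {N : ModuleCat.{u} A} (n : N) : ModuleCat.of A A ⟶ N :=
  ModuleCat.ofHom (LinearMap.toSpanSingleton A N n)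

theorem toSpanL_one {N : ModuleCat.{u} A} (n : N) : (toSpanL n).hom (1 : A) = n :=
  one_smul A n

/-- Right multiplication by `a` as an endomorphism of the left module `A`. -/
def rmulModL (a : A) : ModuleCat.of A A ⟶ ModuleCat.of A A := toSpanL (N := ModuleCat.of A A) a

/-- The map `a ↦ c a` as an additive map. -/
def opSmulHom (c : C) : A →+ C := AddMonoidHom.mk' (fun a => MulOpposite.op a • c) fun a b => by
  rw [MulOpposite.op_add, add_smul]

variable (A C I) in
/-- The map `C ⊗_A A^(I) → C^(I)`. -/
noncomputable def tensorCopowerL :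
    BT A C ((copower (ModuleCat.{u} A) I).obj (ModuleCat.of A A)) →+ (I →₀ C) :=
  BT.lift (fun c w => Finsupp.mapRange.addMonoidHom (opSmulHom c)
      (copowerCoord (ModuleCat.of A A) w : I →₀ A))
    (fun c d w => Finsupp.ext fun i => smul_add _ c d)
    (fun c w w' => by rw [map_add]; exact map_add _ _ _)
    (fun c a w => by
      rw [map_smul]
      exact Finsupp.ext fun i => (mul_smul _ (MulOpposite.op a) c).symm)

theorem tensorCopowerL_ι (i : I) (a : A) (c : C) :
    tensorCopowerL A C I (BT.tmul A c (copowerι (ModuleCat.of A A) i a)) =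
      Finsupp.single i (MulOpposite.op a • c) := by
  change Finsupp.mapRange.addMonoidHom (opSmulHom c)
    (copowerCoord (ModuleCat.of A A) (copowerι (ModuleCat.of A A) i a) : I →₀ A) = _
  rw [copowerCoord_ι]
  exact Finsupp.mapRange_single (hf := map_zero _)

variable [Module A C] [SMulCommClass A Aᵐᵒᵖ C]

variable (A C I) in
/-- The map `(C ⊗_A A)^(I) → C^(I)`. -/
noncomputable def copowerTensorL :
    (copower (ModuleCat.{u} A) I).obj (ModuleCat.of A (BT A C (ModuleCat.of A A))) →+ (I →₀ C) :=
  (Finsupp.mapRange.addMonoidHom (BT.contrR (LinearMap.id : A →ₗ[A] A))).comp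
    (copowerCoord (ModuleCat.of A (BT A C (ModuleCat.of A A)))).toAddMonoidHom

theorem copowerTensorL_ι (i : I) (y : BT A C A) :
    copowerTensorL A C I (copowerι (ModuleCat.of A (BT A C (ModuleCat.of A A))) i y) =
      Finsupp.single i (BT.contrR (LinearMap.id : A →ₗ[A] A) y) := by
  change Finsupp.mapRange.addMonoidHom (BT.contrR (LinearMap.id : A →ₗ[A] A))
    (copowerCoord (ModuleCat.of A (BT A C (ModuleCat.of A A))) _ : I →₀ BT A C A) = _
  rw [copowerCoord_ι]
  exact Finsupp.mapRange_single (hf := map_zero _)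

/-- Two additive maps out of `(C ⊗_A A)^(I)` agree if they agree on the elements `c ⊗ 1` of each
summand. -/
theorem copower_tensorLeft_hom_ext {P : Type u} [AddCommGroup P]
    {Φ Ψ : (copower (ModuleCat.{u} A) I).obj
      (ModuleCat.of A (BT A C (ModuleCat.of A A))) →+ P}
    (h : ∀ i c, Φ (copowerι (ModuleCat.of A (BT A C (ModuleCat.of A A))) i
        (BT.tmul A c (1 : A))) =
      Ψ (copowerι (ModuleCat.of A (BT A C (ModuleCat.of A A))) i (BT.tmul A c (1 : A)))) :
    Φ = Ψ := by
  refine copower_addHom_ext fun i y => ?_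
  let k : BT A C A →+ _ :=
    (copowerι (I := I) (ModuleCat.of A (BT A C (ModuleCat.of A A))) i).toAddMonoidHom
  refine DFunLike.congr_fun (f := Φ.comp k) (g := Ψ.comp k) (BT.hom_ext fun c a => ?_) y
  have h1 : BT.tmul A c a = BT.tmul A (MulOpposite.op a • c) (1 : A) := by
    rw [BT.smul_tmul]
    exact congrArg (fun b : A => BT.tmul A c b) (mul_one a).symm
  rw [h1]
  exact h i (MulOpposite.op a • c)

variable [Coring A C]

section Left

/-- The natural transformation `n ↦ ∑ᵢ zᵢ ⊗ n` given by an invariant family. -/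
noncomputable def tensorInvariantsL (z : I →₀ C) (hz : z ∈ invariants A C I) :
    𝟭 (ModuleCat.{u} A) ⟶
      (copower (ModuleCat.{u} A) I ⋙ inductionL A C) ⋙ forgetL A C where
  app N := ModuleCat.ofHom
    { toFun := fun n => (z.sum fun i x => BT.tmul A x (copowerι N i n) :
        BT A C ((copower (ModuleCat.{u} A) I).obj N))
      map_add' := fun m n => by
        refine Eq.trans ?_ Finsupp.sum_add
        refine Finsupp.sum_congr fun i _ => ?_
        rw [map_add, BT.tmul_add]
      map_smul' := fun a n => by
        refine Eq.trans ?_ (map_finsuppSum (BT.actL a) z _).symm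
        refine Finsupp.sum_congr fun i _ => ?_
        rw [map_smul, ← BT.smul_tmul, ← hz a i]
        rfl }
  naturality N N' f := ModuleCat.hom_ext <| LinearMap.ext fun n => by
    refine Eq.trans ?_ (map_finsuppSum
      (BT.map LinearMap.id ((copower (ModuleCat.{u} A) I).map f).hom) z
      fun i x => BT.tmul A x (copowerι N i n)).symm
    exact Finset.sum_congr rfl fun i _ =>
      (congrArg (BT.tmul A (z i)) (copower_map_ι f i n)).symm

variable (β : 𝟭 (ModuleCat.{u} A) ⟶
  (copower (ModuleCat.{u} A) I ⋙ inductionL A C) ⋙ forgetL A C)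

/-- The map `β_N` with values in the tensor product. -/
noncomputable def tensorAppL (N : ModuleCat.{u} A) :
    N →ₗ[A] BT A C ((copower (ModuleCat.{u} A) I).obj N) := (β.app N).hom

theorem tensorAppL_naturality {N N' : ModuleCat.{u} A} (f : N ⟶ N') (n : N) :
    tensorAppL β N' (f.hom n) =
      BT.map LinearMap.id ((copower (ModuleCat.{u} A) I).map f).hom (tensorAppL β N n) :=
  congrArg (fun k => k.hom n) (β.naturality f)

/-- The invariant family `β_A(1)` given by a natural transformation `β`. -/
noncomputable def tensorFamilyL : I →₀ C :=
  tensorCopowerL A C I (tensorAppL β (ModuleCat.of A A) (1 : A))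

theorem tensorFamilyL_mem : tensorFamilyL β ∈ invariants A C I := fun a i => by
  have h1 : tensorAppL β (ModuleCat.of A A) ((rmulModL a).hom (1 : A)) =
      a • tensorAppL β (ModuleCat.of A A) (1 : A) := by
    rw [← map_smul]
    refine congrArg (tensorAppL β (ModuleCat.of A A)) ((toSpanL_one _).trans ?_)
    exact (mul_one a).symm
  rw [tensorAppL_naturality] at h1
  have h2 : ∀ w : BT A C ((copower (ModuleCat.{u} A) I).obj (ModuleCat.of A A)),
      tensorCopowerL A C I (BT.map LinearMap.id ((copower (ModuleCat.{u} A) I).map (rmulModL a)).hom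
        w) = MulOpposite.op a • tensorCopowerL A C I w := fun w => by
    refine DFunLike.congr_fun (f := (tensorCopowerL A C I).comp (BT.map LinearMap.id _))
      (g := (DistribSMul.toAddMonoidHom (I →₀ C) (MulOpposite.op a)).comp (tensorCopowerL A C I))
      (BT.copower_right_hom_ext fun i b c => ?_) w
    change tensorCopowerL A C I (BT.tmul A c (((copower (ModuleCat.{u} A) I).map (rmulModL a)).hom
      (copowerι (ModuleCat.of A A) i b))) = MulOpposite.op a • tensorCopowerL A C I (BT.tmul A c _)
    rw [copower_map_ι, tensorCopowerL_ι, tensorCopowerL_ι, Finsupp.smul_single]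
    exact congrArg (Finsupp.single i) (mul_smul (MulOpposite.op a) (MulOpposite.op b) c)
  have h3 : ∀ w : BT A C ((copower (ModuleCat.{u} A) I).obj (ModuleCat.of A A)),
      tensorCopowerL A C I (a • w) = a • tensorCopowerL A C I w := fun w => by
    refine DFunLike.congr_fun (f := (tensorCopowerL A C I).comp (BT.actL a))
      (g := (DistribSMul.toAddMonoidHom (I →₀ C) a).comp (tensorCopowerL A C I))
      (BT.copower_right_hom_ext fun i b c => ?_) w
    change tensorCopowerL A C I (BT.tmul A (a • c) _) = a • tensorCopowerL A C I (BT.tmul A c _)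
    rw [tensorCopowerL_ι, tensorCopowerL_ι, Finsupp.smul_single]
    exact congrArg (Finsupp.single i) (smul_comm a (MulOpposite.op b) c).symm
  have h4 := congrArg (tensorCopowerL A C I) h1
  rw [h2, h3] at h4
  exact (DFunLike.congr_fun h4 i).symm

variable {J : forgetL A C ⋙ copower (ModuleCat.{u} A) I ⋙ inductionL A C ⟶ 𝟭 (LComod A C)}
  {σ : I → BalancedForm A C}
  (hJ : ∀ (M : LComod A C) i c m, natTransL J M i c m = actOnL M ((σ i).R c) m)

/-- The map `J_M` as an additive map out of the tensor product. -/
noncomputable def natTransMapL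
    (J : forgetL A C ⋙ copower (ModuleCat.{u} A) I ⋙ inductionL A C ⟶ 𝟭 (LComod A C))
    (M : LComod A C) : BT A C ((copower (ModuleCat.{u} A) I).obj M.A) →+ M.A :=
  (J.app M).f.hom.toAddMonoidHom

include hJ in
theorem natTransMapL_tensorInvariantsL (z : I →₀ C) (hz : z ∈ invariants A C I) (M : LComod A C)
    (m : M.A) : natTransMapL J M (tensorAppL (tensorInvariantsL z hz) M.A m) =
      actOnL M (sumFormR σ z) m := by
  refine (map_finsuppSum (natTransMapL J M) z
    fun i x => BT.tmul A x (copowerι M.A i m)).trans ?_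
  refine Eq.trans ?_ (map_finsuppSum (actOnLHom M m) z _).symm
  exact Finset.sum_congr rfl fun i _ => hJ M i (z i) m

include hJ in
/-- The composite `J_M ∘ β_M` is the action of `∑ᵢ σᵢ(zᵢ, -)`, where `z = β_A(1)`: by naturality,
`β_M(m)` is the image of `β_A(1)` under `a ↦ a m`. -/
theorem natTransMapL_tensorAppL (M : LComod A C) (m : M.A) :
    natTransMapL J M (tensorAppL β M.A m) = actOnL M (sumFormR σ (tensorFamilyL β)) m := by
  have h1 := tensorAppL_naturality β (toSpanL m) (1 : A)
  rw [toSpanL_one] at h1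
  rw [h1]
  refine DFunLike.congr_fun (f := (natTransMapL J M).comp (BT.map LinearMap.id _))
    (g := (actOnLHom M m).comp ((sumFormRHom σ).lin.toAddMonoidHom.comp (tensorCopowerL A C I)))
    (BT.copower_right_hom_ext fun i a c => ?_) _
  change natTransMapL J M (BT.tmul A c (((copower (ModuleCat.{u} A) I).map (toSpanL m)).hom
      (copowerι (ModuleCat.of A A) i a))) =
    actOnL M (sumFormR σ (tensorCopowerL A C I (BT.tmul A c _))) m
  rw [copower_map_ι, tensorCopowerL_ι, sumFormR_single, (σ i).R_op_smul]
  refine (hJ M i c _).trans ?_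
  refine (congrArg (BT.contrL _) (map_smul (coactL M) a m)).trans ?_
  exact BT.contrL_smul_lin _ _ _

variable (A C I) in
/-- The condition that `F'` be a right locally quasi-adjoint for `G'` amounts to the existence of
local units of the form `∑ᵢ σᵢ(zᵢ, -)`. -/
theorem hasUnitalEndLeft_fgpL_iff (hgen : (fgpL A C).IsSeparating) :
    HasUnitalEndLeft I (fgpL A C) (forgetL A C) (inductionL A C) ↔
      ∃ σ : I → BalancedForm A C, LeftUnital σ := by
  classical
  rw [hasUnitalEndLeft_iff]
  constructor
  · rintro ⟨J, h⟩
    refine ⟨BalancedForm.ofNatTransL J, fun s => ?_⟩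
    obtain ⟨M, hM, f, hf⟩ := exists_hom_of_isSeparating hgen (selfLComod A C) s
    obtain ⟨β, hβ⟩ := h M hM (selfLComod A C) f.f
    refine ⟨tensorFamilyL β, tensorFamilyL_mem β, fun c hc => ?_⟩
    obtain ⟨m, hm⟩ := hf c hc
    have h1 : natTransMapL J _ (tensorAppL β _ (f.f.hom m)) = f.f.hom m :=
      congrArg (fun k => k.hom m) hβ
    rw [natTransMapL_tensorAppL β (natTransL_eq J), hm] at h1
    exact h1
  · rintro ⟨σ, hσ⟩
    refine ⟨natTransOfFormL σ, fun M hM M' f => ?_⟩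
    obtain ⟨t, ht⟩ := hM.1
    choose s hs using fun m : M.A => BT.exists_finset_left (coactL M' (f.hom m))
    obtain ⟨z, hz, hzs⟩ := (leftUnital_iff σ).1 hσ (t.biUnion s)
    refine ⟨tensorInvariantsL z hz, ModuleCat.hom_ext (LinearMap.ext_on ht fun m hm => ?_)⟩
    refine (natTransMapL_tensorInvariantsL (natTransL_natTransOfFormL σ) z hz M' (f.hom m)).trans ?_
    refine Eq.trans ?_ (actOnL_one M' (f.hom m))
    refine hs m _ (BT.contrL (sumFormR σ z).lin) (BT.contrL (1 : RDual A C).lin) fun c hc n => ?_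
    exact congrArg (· • n) (hzs c (Finset.mem_biUnion.2 ⟨m, hm, hc⟩))

end Left

section Right

/-- The natural transformation `n ↦ ∑ᵢ zᵢ ⊗ n` given by an invariant family. -/
noncomputable def copowerInvariantsL (z : I →₀ C) (hz : z ∈ invariants A C I) :
    𝟭 (ModuleCat.{u} A) ⟶
      inductionL A C ⋙ forgetL A C ⋙ copower (ModuleCat.{u} A) I where
  app N := ModuleCat.ofHom
    { toFun := fun n => (z.sum fun i x =>
        copowerι (ModuleCat.of A (BT A C N)) i (BT.tmul A x n) :
        (copower (ModuleCat.{u} A) I).obj (ModuleCat.of A (BT A C N)))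
      map_add' := fun m n => by
        refine Eq.trans ?_ Finsupp.sum_add
        refine Finsupp.sum_congr fun i _ => ?_
        rw [BT.tmul_add]
        exact map_add _ _ _
      map_smul' := fun a n => by
        refine Eq.trans ?_ (map_finsuppSum (DistribSMul.toAddMonoidHom
          ((copower (ModuleCat.{u} A) I).obj (ModuleCat.of A (BT A C N))) a) z _).symm
        refine Finsupp.sum_congr fun i _ => ?_
        rw [← BT.smul_tmul, ← hz a i]
        exact map_smul (copowerι (ModuleCat.of A (BT A C N)) i) a (BT.tmul A (z i) n) }
  naturality N N' f := ModuleCat.hom_ext <| LinearMap.ext fun n => by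
    refine Eq.trans ?_ (map_finsuppSum
      ((copower (ModuleCat.{u} A) I).map ((tensorLeft A C).map f)).hom z
      fun i x => copowerι (ModuleCat.of A (BT A C N)) i (BT.tmul A x n)).symm
    exact Finset.sum_congr rfl fun i _ =>
      (copower_map_ι ((tensorLeft A C).map f) i (BT.tmul A (z i) n)).symm

variable (β : 𝟭 (ModuleCat.{u} A) ⟶
  inductionL A C ⋙ forgetL A C ⋙ copower (ModuleCat.{u} A) I)

/-- The map `β_N` with values in the copower of the tensor product. -/
noncomputable def copowerAppL (N : ModuleCat.{u} A) :
    N →ₗ[A] (copower (ModuleCat.{u} A) I).obj (ModuleCat.of A (BT A C N)) := (β.app N).hom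

theorem copowerAppL_naturality {N N' : ModuleCat.{u} A} (f : N ⟶ N') (n : N) :
    copowerAppL β N' (f.hom n) =
      ((copower (ModuleCat.{u} A) I).map ((tensorLeft A C).map f)).hom (copowerAppL β N n) :=
  congrArg (fun k => k.hom n) (β.naturality f)

/-- The invariant family `β_A(1)` given by a natural transformation `β`. -/
noncomputable def copowerFamilyL : I →₀ C :=
  copowerTensorL A C I (copowerAppL β (ModuleCat.of A A) (1 : A))

theorem copowerFamilyL_mem : copowerFamilyL β ∈ invariants A C I := fun a i => by
  have h1 : copowerAppL β (ModuleCat.of A A) ((rmulModL a).hom (1 : A)) =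
      a • copowerAppL β (ModuleCat.of A A) (1 : A) := by
    rw [← map_smul]
    refine congrArg (copowerAppL β (ModuleCat.of A A)) ((toSpanL_one _).trans ?_)
    exact (mul_one a).symm
  rw [copowerAppL_naturality] at h1
  have h2 : ∀ w, copowerTensorL A C I (((copower (ModuleCat.{u} A) I).map
      ((tensorLeft A C).map (rmulModL a))).hom w) = MulOpposite.op a • copowerTensorL A C I w :=
      fun w => by
    refine DFunLike.congr_fun (f := (copowerTensorL A C I).comp
        ((copower (ModuleCat.{u} A) I).map ((tensorLeft A C).map (rmulModL a))).hom.toAddMonoidHom)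
      (g := (DistribSMul.toAddMonoidHom (I →₀ C) (MulOpposite.op a)).comp (copowerTensorL A C I))
      (copower_tensorLeft_hom_ext fun i c => ?_) w
    refine (congrArg (copowerTensorL A C I)
      (copower_map_ι ((tensorLeft A C).map (rmulModL a)) i (BT.tmul A c (1 : A)))).trans ?_
    refine (copowerTensorL_ι i _).trans ?_
    refine Eq.trans ?_ (congrArg (MulOpposite.op a • ·)
      (copowerTensorL_ι i (BT.tmul A c (1 : A))).symm)
    rw [Finsupp.smul_single]
    refine congrArg (Finsupp.single i) ?_
    change MulOpposite.op (1 * a) • c = MulOpposite.op a • MulOpposite.op (1 : A) • c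
    rw [one_mul, MulOpposite.op_one, one_smul]
  have h3 : ∀ w, copowerTensorL A C I (a • w) = a • copowerTensorL A C I w := fun w => by
    refine DFunLike.congr_fun (f := (copowerTensorL A C I).comp
        (DistribSMul.toAddMonoidHom _ a))
      (g := (DistribSMul.toAddMonoidHom (I →₀ C) a).comp (copowerTensorL A C I))
      (copower_tensorLeft_hom_ext fun i c => ?_) w
    refine (congrArg (copowerTensorL A C I) (map_smul (copowerι (ModuleCat.of A
      (BT A C (ModuleCat.of A A))) i) a (BT.tmul A c (1 : A))).symm).trans ?_
    refine (copowerTensorL_ι i _).trans ?_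
    refine Eq.trans ?_ (congrArg (a • ·) (copowerTensorL_ι i (BT.tmul A c (1 : A))).symm)
    rw [Finsupp.smul_single]
    refine congrArg (Finsupp.single i) ?_
    exact (smul_comm a (MulOpposite.op (1 : A)) c).symm
  exact DFunLike.congr_fun
    ((h3 _).symm.trans ((congrArg (copowerTensorL A C I) h1).symm.trans (h2 _))) i

variable {J : forgetL A C ⋙ copower (ModuleCat.{u} A) I ⋙ inductionL A C ⟶ 𝟭 (LComod A C)}
  {σ : I → BalancedForm A C}
  (hJ : ∀ (M : LComod A C) i c m, natTransL J M i c m = actOnL M ((σ i).R c) m)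

/-- The map `J` at the comodule `C ⊗_A N`. -/
noncomputable def natTransIndL
    (J : forgetL A C ⋙ copower (ModuleCat.{u} A) I ⋙ inductionL A C ⟶ 𝟭 (LComod A C))
    (N : ModuleCat.{u} A) :
    BT A C ((copower (ModuleCat.{u} A) I).obj (ModuleCat.of A (BT A C N))) →+ BT A C N :=
  natTransMapL J ((inductionL A C).obj N)

include hJ in
theorem natTransIndL_ι (N : ModuleCat.{u} A) (i : I) (n : N) (x c : C) :
    natTransIndL J N (BT.tmul A c (copowerι (ModuleCat.of A (BT A C N)) i (BT.tmul A x n))) =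
      BT.tmul A (MulOpposite.op ((σ i).L x) • c) n := by
  rw [(σ i).op_L_smul]
  exact (hJ ((inductionL A C).obj N) i c (BT.tmul A x n)).trans (actOnL_induction N _ n x)

include hJ in
theorem natTransIndL_copowerInvariantsL (z : I →₀ C) (hz : z ∈ invariants A C I)
    (N : ModuleCat.{u} A) (n : N) (c : C) :
    natTransIndL J N (BT.tmul A c (copowerAppL (copowerInvariantsL z hz) N n)) =
      BT.tmul A (MulOpposite.op (sumFormL σ z) • c) n := by
  rw [sumFormL_smul]
  refine (map_finsuppSum ((natTransIndL J N).comp (BT.mkL c)) z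
    fun i x => copowerι (ModuleCat.of A (BT A C N)) i (BT.tmul A x n)).trans ?_
  refine Eq.trans ?_ (map_finsuppSum (BT.mkR (A := A) (M := C) n) z _).symm
  exact Finsupp.sum_congr fun i _ => natTransIndL_ι hJ N i n (z i) c

include hJ in
/-- The composite of `C ⊗ β_N` and `J` is `e ⊗ N`, where `e = ∑ᵢ σᵢ(-, zᵢ)` and `z = β_A(1)`: by
naturality, `β_N(n)` is the image of `β_A(1)` under `a ↦ a n`. -/
theorem natTransIndL_copowerAppL (N : ModuleCat.{u} A) (n : N) (c : C) :
    natTransIndL J N (BT.tmul A c (copowerAppL β N n)) =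
      BT.tmul A (MulOpposite.op (sumFormL σ (copowerFamilyL β)) • c) n := by
  have h1 := copowerAppL_naturality β (toSpanL n) (1 : A)
  rw [toSpanL_one] at h1
  rw [h1]
  refine DFunLike.congr_fun (f := (natTransIndL J N).comp ((BT.mkL c).comp
      ((copower (ModuleCat.{u} A) I).map ((tensorLeft A C).map (toSpanL n))).hom.toAddMonoidHom))
    (g := (BT.mkR n).comp ((((smulAddHom (LDual A C)ᵐᵒᵖ C).flip c).comp
      (MulOpposite.opAddEquiv : LDual A C ≃+ _).toAddMonoidHom).comp
      ((sumFormLHom σ).lin.toAddMonoidHom.comp (copowerTensorL A C I))))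
    (copower_tensorLeft_hom_ext fun i x => ?_) _
  change natTransIndL J N (BT.tmul A c (((copower (ModuleCat.{u} A) I).map
      ((tensorLeft A C).map (toSpanL n))).hom (copowerι (ModuleCat.of A
        (BT A C (ModuleCat.of A A))) i (BT.tmul A x (1 : A))))) =
    BT.tmul A (MulOpposite.op (sumFormL σ (copowerTensorL A C I _)) • c) n
  rw [copowerTensorL_ι, BT.contrR_tmul, sumFormL_single]
  refine (congrArg (fun w => natTransIndL J N (BT.tmul A c w)) (copower_map_ι
    ((tensorLeft A C).map (toSpanL n)) i (BT.tmul A x (1 : A)))).trans ?_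
  refine Eq.trans (congrArg (fun m => natTransIndL J N (BT.tmul A c (copowerι (ModuleCat.of A
    (BT A C N)) i (BT.tmul A x m)))) (toSpanL_one n)) ?_
  rw [natTransIndL_ι hJ]
  exact congrArg (fun y : C => BT.tmul A (MulOpposite.op ((σ i).L y) • c) n)
    (one_smul Aᵐᵒᵖ x).symm

variable (A C I) in
/-- The condition that `G'` be a left locally quasi-adjoint for `F'` amounts to the existence of
local units of the form `∑ᵢ σᵢ(-, zᵢ)`. -/
theorem hasUnitalEndRight_fgpL_iff (hgen : (fgpL A C).IsSeparating) :
    HasUnitalEndRight I (fgpL A C) (forgetL A C) (inductionL A C) ↔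
      ∃ σ : I → BalancedForm A C, RightUnital σ := by
  classical
  rw [hasUnitalEndRight_iff]
  constructor
  · rintro ⟨J, h⟩
    refine ⟨BalancedForm.ofNatTransL J, fun s => ?_⟩
    obtain ⟨M, hM, f, hf⟩ := exists_hom_of_isSeparating hgen (selfLComod A C) s
    -- the comodule `C` is induced from the module `A`
    obtain ⟨β, hβ⟩ := h M hM (ModuleCat.of A A)
      (f ≫ tmulLComod (N := ModuleCat.of A A) (1 : A))
    refine ⟨copowerFamilyL β, copowerFamilyL_mem β, fun c hc => ?_⟩
    obtain ⟨m, hm⟩ := hf c hc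
    let d : C := f.f.hom m
    have h1 : natTransIndL J (ModuleCat.of A A) (BT.tmul A d (copowerAppL β _ (1 : A))) =
        BT.tmul A d (1 : A) :=
      congrArg (fun k => k.f.hom m) hβ
    rw [show d = c from hm] at h1
    have h2 : ∀ d : C, BT.contrR (LinearMap.id : A →ₗ[A] A) (BT.tmul A d (1 : A)) = d :=
      one_smul Aᵐᵒᵖ
    have h3 := (natTransIndL_copowerAppL β (natTransL_eq J) (ModuleCat.of A A) (1 : A) c).symm.trans
      h1
    exact (h2 _).symm.trans ((congrArg (BT.contrR (LinearMap.id : A →ₗ[A] A)) h3).trans (h2 c))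
  · rintro ⟨σ, hσ⟩
    refine ⟨natTransOfFormL σ, fun M hM N f => ?_⟩
    obtain ⟨t, ht⟩ := hM.1
    let ff : M.A →ₗ[A] BT A C N := f.f.hom
    choose s hs using fun m : M.A => BT.exists_finset_left (ff m)
    obtain ⟨z, hz, hzs⟩ := hσ (t.biUnion s)
    refine ⟨copowerInvariantsL z hz, Comonad.Coalgebra.Hom.ext' _ _ _ _
      (ModuleCat.hom_ext (LinearMap.ext_on ht fun m hm => ?_))⟩
    refine hs m _ ((natTransIndL (natTransOfFormL σ) N).comp
      (BT.map LinearMap.id (copowerAppL (copowerInvariantsL z hz) N))) (AddMonoidHom.id _)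
      fun c hc n => ?_
    refine (natTransIndL_copowerInvariantsL (natTransL_natTransOfFormL σ) z hz N n c).trans ?_
    rw [hzs c (Finset.mem_biUnion.2 ⟨m, hm, hc⟩)]
    rfl

end Right

end LeftUnits

/-! ### Local units on comodules -/

section UnitalOnComodules

variable {A C : Type u} [Ring A] [AddCommGroup C] [Module A C] [Module Aᵐᵒᵖ C]
  [SMulCommClass A Aᵐᵒᵖ C] [Coring A C] {I : Type u}

/-- Acting as the identity on the comodules that are finitely generated and projective over `A`
gives local units on `C`, as finite subsets of `C` lie in the image of such a comodule. Conversely,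
an element of `C^*` that agrees with the counit on finitely many elements of `C` fixes given
generators of a comodule, and acts by a linear map. -/
theorem traceUnitalR_iff (h : LocProj Aᵐᵒᵖ C) (hgen : (fgpL A C).IsSeparating) :
    TraceUnitalR A C I ↔ ∃ σ : I → BalancedForm A C, LeftUnital σ := by
  classical
  constructor
  · rintro ⟨j, hj⟩
    obtain ⟨σ, rfl⟩ := exists_sumFormRHom h j
    rw [evalR_image_traceSet] at hj
    refine ⟨σ, fun s => ?_⟩
    obtain ⟨M, hM, f, hf⟩ := exists_hom_of_isSeparating hgen (selfLComod A C) s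
    obtain ⟨_, ⟨z, hz, rfl⟩, he⟩ := hj M hM
    refine ⟨z, hz, fun c hc => ?_⟩
    obtain ⟨m, rfl⟩ := hf c hc
    exact (actOnL_hom f (sumFormR σ z) m).trans (congrArg _ (he m))
  · rintro ⟨σ, hσ⟩
    refine ⟨sumFormRHom σ, ?_⟩
    rw [evalR_image_traceSet]
    intro M hM
    obtain ⟨t, ht⟩ := hM.1
    choose s hs using fun m : M.A => BT.exists_finset_left (coactL M m)
    obtain ⟨z, hz, hzs⟩ := (leftUnital_iff σ).1 hσ (t.biUnion s)
    refine ⟨_, ⟨z, hz, rfl⟩, fun m => ?_⟩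
    let φ : M.A →ₗ[A] M.A :=
      { toFun := actOnL M (sumFormR σ z)
        map_add' := actOnL_add M _
        map_smul' := actOnL_smul M (sumFormR_bilinear σ hz) }
    refine LinearMap.congr_fun (f := φ) (g := LinearMap.id) (LinearMap.ext_on ht fun m hm => ?_) m
    refine Eq.trans ?_ (actOnL_one M m)
    refine hs m _ (BT.contrL (sumFormR σ z).lin) (BT.contrL (1 : RDual A C).lin) fun c hc n => ?_
    exact congrArg (· • n) (hzs c (Finset.mem_biUnion.2 ⟨m, hm, hc⟩))

theorem traceUnitalL_iff (h : LocProj A C) (hgen : (fgpR A C).IsSeparating) :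
    TraceUnitalL A C I ↔ ∃ σ : I → BalancedForm A C, RightUnital σ := by
  classical
  constructor
  · rintro ⟨j, hj⟩
    obtain ⟨σ, rfl⟩ := exists_sumFormLHom h j
    rw [evalL_image_traceSet] at hj
    refine ⟨σ, fun s => ?_⟩
    obtain ⟨M, hM, f, hf⟩ := exists_hom_of_isSeparating hgen (selfRComod A C) s
    obtain ⟨_, ⟨z, hz, rfl⟩, he⟩ := hj M hM
    refine ⟨z, hz, fun c hc => ?_⟩
    obtain ⟨m, rfl⟩ := hf c hc
    exact (actOnR_hom f (sumFormL σ z) m).trans (congrArg _ (he m))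
  · rintro ⟨σ, hσ⟩
    refine ⟨sumFormLHom σ, ?_⟩
    rw [evalL_image_traceSet]
    intro M hM
    obtain ⟨t, ht⟩ := hM.1
    choose s hs using fun m : M.A => BT.exists_finset_right (coactR M m)
    obtain ⟨z, hz, hzs⟩ := (rightUnital_iff σ).1 hσ (t.biUnion s)
    refine ⟨_, ⟨z, hz, rfl⟩, fun m => ?_⟩
    let φ : M.A →ₗ[Aᵐᵒᵖ] M.A :=
      { toFun := actOnR M (sumFormL σ z)
        map_add' := actOnR_add M _
        map_smul' := fun a => actOnR_op_smul M (sumFormL_bilinear σ hz) a.unop }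
    refine LinearMap.congr_fun (f := φ) (g := LinearMap.id) (LinearMap.ext_on ht fun m hm => ?_) m
    refine Eq.trans ?_ (actOnR_one M m)
    refine hs m _ (BT.contrR (sumFormL σ z).lin) (BT.contrR (1 : LDual A C).lin) fun n c hc => ?_
    exact congrArg (fun a => MulOpposite.op a • n) (hzs c (Finset.mem_biUnion.2 ⟨m, hm, hc⟩))

/-! ### Change of the index set -/

theorem embDomain_mem_invariants {A C : Type u} [Ring A] [AddCommGroup C] [Module A C]
    [Module Aᵐᵒᵖ C] {I I' : Type u} (k : I ↪ I') {z : I →₀ C}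
    (hz : z ∈ invariants A C I) : z.embDomain k ∈ invariants A C I' := fun a i => by
  by_cases hi : i ∈ Set.range k
  · obtain ⟨i, rfl⟩ := hi
    rw [Finsupp.embDomain_apply_self]
    exact hz a i
  · rw [Finsupp.embDomain_of_notMem_range _ _ _ hi, smul_zero, smul_zero]

theorem LeftUnital.of_comp {I' : Type u} (k : I ↪ I') {σ : I' → BalancedForm A C}
    (h : LeftUnital (σ ∘ k)) : LeftUnital σ := fun s => by
  obtain ⟨z, hz, hs⟩ := h s
  refine ⟨z.embDomain k, embDomain_mem_invariants k hz, fun c hc => ?_⟩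
  rw [sumFormR, Finsupp.sum_embDomain]
  exact hs c hc

theorem RightUnital.of_comp {I' : Type u} (k : I ↪ I') {σ : I' → BalancedForm A C}
    (h : RightUnital (σ ∘ k)) : RightUnital σ := fun s => by
  obtain ⟨z, hz, hs⟩ := h s
  refine ⟨z.embDomain k, embDomain_mem_invariants k hz, fun c hc => ?_⟩
  rw [sumFormL, Finsupp.sum_embDomain]
  exact hs c hc

end UnitalOnComodules

/-! ### Locally quasi-Frobenius pairs -/

section Pairs

variable (A C : Type u) [Ring A] [AddCommGroup C] [Module A C] [Module Aᵐᵒᵖ C]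
  [SMulCommClass A Aᵐᵒᵖ C] [Coring A C] (I : Type u)

theorem leftLQFOn_and_rightLQFOn_iff (h : LocProj A C) :
    LeftLQFOn A C I ∧ RightLQFOn A C I ↔
      (∃ σ : I → BalancedForm A C, LeftUnital σ) ∧ ∃ σ : I → BalancedForm A C, RightUnital σ := by
  rw [leftLQFOn_iff h]
  refine and_congr_right ?_
  rintro ⟨σ, hσ⟩
  exact rightLQFOn_iff hσ.locProj

theorem isLocallyQuasiFrobeniusPair_fgpR_iff (hgen : (fgpR A C).IsSeparating) :
    IsLocallyQuasiFrobeniusPair I (fgpR A C) (forgetR A C) (inductionR A C) ↔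
      (∃ σ : I → BalancedForm A C, LeftUnital σ) ∧ ∃ σ : I → BalancedForm A C, RightUnital σ := by
  rw [← hasUnitalEndRight_fgpR_iff A C I hgen, ← hasUnitalEndLeft_fgpR_iff A C I hgen,
    hasUnitalEndRight_iff, hasUnitalEndLeft_iff]
  exact and_iff_right ⟨(rightComonad A C).adj⟩

theorem isLocallyQuasiFrobeniusPair_fgpL_iff (hgen : (fgpL A C).IsSeparating) :
    IsLocallyQuasiFrobeniusPair I (fgpL A C) (forgetL A C) (inductionL A C) ↔
      (∃ σ : I → BalancedForm A C, LeftUnital σ) ∧ ∃ σ : I → BalancedForm A C, RightUnital σ := by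
  rw [and_comm, ← hasUnitalEndRight_fgpL_iff A C I hgen, ← hasUnitalEndLeft_fgpL_iff A C I hgen,
    hasUnitalEndRight_iff, hasUnitalEndLeft_iff]
  exact and_iff_right ⟨(leftComonad A C).adj⟩

/-- Left and right local units coming from families of forms with different index sets also come
from one family, indexed by the disjoint union. -/
theorem leftLQF_and_rightLQF_iff (h : LocProj A C) :
    LeftLQF A C ∧ RightLQF A C ↔ ∃ I : Type u, LeftLQFOn A C I ∧ RightLQFOn A C I := by
  constructor
  · rintro ⟨⟨I₁, h₁⟩, I₂, h₂⟩
    obtain ⟨σ, hσ⟩ := (leftLQFOn_iff h).1 h₁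
    obtain ⟨τ, hτ⟩ := (rightLQFOn_iff hσ.locProj).1 h₂
    exact ⟨I₁ ⊕ I₂, (leftLQFOn_and_rightLQFOn_iff A C _ h).2
      ⟨⟨Sum.elim σ τ, .of_comp .inl hσ⟩, Sum.elim σ τ, .of_comp .inr hτ⟩⟩
  · rintro ⟨I, h₁, h₂⟩
    exact ⟨⟨I, h₁⟩, I, h₂⟩

end Pairs

end LQF

theorem mainTheorem1 (A C : Type u) [Ring A] [AddCommGroup C] [Module A C] [Module Aᵐᵒᵖ C]
    [SMulCommClass A Aᵐᵒᵖ C] [LQF.Coring A C]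
    (hgenR : (LQF.fgpR A C).IsSeparating) (hgenL : (LQF.fgpL A C).IsSeparating) :
    (LQF.LocProj A C → ∀ I : Type u,
      [LQF.LeftLQFOn A C I,
        LQF.HasUnitalEndLeft I (LQF.fgpL A C) (LQF.forgetL A C) (LQF.inductionL A C),
        LQF.IsRightLocallyQuasiAdjoint I (LQF.fgpL A C) (LQF.forgetL A C) (LQF.inductionL A C),
        LQF.HasUnitalEndRight I (LQF.fgpR A C) (LQF.forgetR A C) (LQF.inductionR A C),
        LQF.IsLeftLocallyQuasiAdjoint I (LQF.fgpR A C) (LQF.inductionR A C)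
          (LQF.forgetR A C)].TFAE ∧
      (LQF.LeftLQFOn A C I → LQF.LocProj Aᵐᵒᵖ C) ∧
      (LQF.LocProj Aᵐᵒᵖ C →
        [LQF.LeftLQFOn A C I,
          LQF.TraceUnitalR A C I,
          LQF.TraceLocalUnitsR A C I,
          LQF.HasUnitalEndLeft I (LQF.fgpL A C) (LQF.forgetL A C) (LQF.inductionL A C),
          LQF.IsRightLocallyQuasiAdjoint I (LQF.fgpL A C) (LQF.forgetL A C) (LQF.inductionL A C),
          LQF.HasUnitalEndRight I (LQF.fgpR A C) (LQF.forgetR A C) (LQF.inductionR A C),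
          LQF.IsLeftLocallyQuasiAdjoint I (LQF.fgpR A C) (LQF.inductionR A C) (LQF.forgetR A C),
          LQF.YonedaLocalUnitsR A C I,
          LQF.CoyonedaLocalUnitsR A C I].TFAE)) ∧
    (LQF.LocProj Aᵐᵒᵖ C → ∀ I : Type u,
      [LQF.RightLQFOn A C I,
        LQF.HasUnitalEndLeft I (LQF.fgpR A C) (LQF.forgetR A C) (LQF.inductionR A C),
        LQF.IsRightLocallyQuasiAdjoint I (LQF.fgpR A C) (LQF.forgetR A C) (LQF.inductionR A C),
        LQF.HasUnitalEndRight I (LQF.fgpL A C) (LQF.forgetL A C) (LQF.inductionL A C),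
        LQF.IsLeftLocallyQuasiAdjoint I (LQF.fgpL A C) (LQF.inductionL A C)
          (LQF.forgetL A C)].TFAE ∧
      (LQF.RightLQFOn A C I → LQF.LocProj A C) ∧
      (LQF.LocProj A C →
        [LQF.RightLQFOn A C I,
          LQF.TraceUnitalL A C I,
          LQF.TraceLocalUnitsL A C I,
          LQF.HasUnitalEndLeft I (LQF.fgpR A C) (LQF.forgetR A C) (LQF.inductionR A C),
          LQF.IsRightLocallyQuasiAdjoint I (LQF.fgpR A C) (LQF.forgetR A C) (LQF.inductionR A C),
          LQF.HasUnitalEndRight I (LQF.fgpL A C) (LQF.forgetL A C) (LQF.inductionL A C),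
          LQF.IsLeftLocallyQuasiAdjoint I (LQF.fgpL A C) (LQF.inductionL A C) (LQF.forgetL A C),
          LQF.YonedaLocalUnitsL A C I,
          LQF.CoyonedaLocalUnitsL A C I].TFAE)) ∧
    (LQF.LocProj A C →
      (∀ I : Type u,
        [LQF.LeftLQFOn A C I ∧ LQF.RightLQFOn A C I,
          LQF.IsLocallyQuasiFrobeniusPair I (LQF.fgpR A C) (LQF.forgetR A C) (LQF.inductionR A C),
          LQF.IsLocallyQuasiFrobeniusPair I (LQF.fgpL A C) (LQF.forgetL A C)
            (LQF.inductionL A C)].TFAE) ∧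
      [LQF.LeftLQF A C ∧ LQF.RightLQF A C,
        ∃ I : Type u, LQF.IsLocallyQuasiFrobeniusPair I (LQF.fgpR A C) (LQF.forgetR A C)
          (LQF.inductionR A C),
        ∃ I : Type u, LQF.IsLocallyQuasiFrobeniusPair I (LQF.fgpL A C) (LQF.forgetL A C)
          (LQF.inductionL A C)].TFAE) := by
  have tfae : ∀ {l : List Prop} (q : Prop), (∀ p ∈ l, p ↔ q) → l.TFAE := fun q hq p hp r hr =>
    (hq p hp).trans (hq r hr).symm
  refine ⟨fun h I => ?_, fun h I => ?_, fun h => ⟨fun I => ?_, ?_⟩⟩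
  · have ha := LQF.leftLQFOn_iff (I := I) h
    have hd := LQF.hasUnitalEndLeft_fgpL_iff A C I hgenL
    have hf := LQF.hasUnitalEndRight_fgpR_iff A C I hgenR
    have he := (LQF.hasUnitalEndLeft_iff I (LQF.fgpL A C) _ _).symm.trans hd
    have hg := (LQF.hasUnitalEndRight_iff I (LQF.fgpR A C) _ _).symm.trans hf
    refine ⟨tfae (∃ σ : I → LQF.BalancedForm A C, LQF.LeftUnital σ) ?_,
      fun hl => ?_, fun h' =>
      tfae (∃ σ : I → LQF.BalancedForm A C, LQF.LeftUnital σ) ?_⟩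
    · simpa only [List.forall_mem_cons, List.not_mem_nil, false_imp_iff, implies_true, and_true]
        using ⟨ha, hd, he, hf, hg⟩
    · obtain ⟨σ, hσ⟩ := ha.1 hl
      exact hσ.locProj
    · have hc := LQF.traceLocalUnitsR_iff (I := I) h'
      simpa only [List.forall_mem_cons, List.not_mem_nil, false_imp_iff, implies_true, and_true]
        using ⟨ha, LQF.traceUnitalR_iff h' hgenL, hc, hd, he, hf, hg,
          LQF.yonedaLocalUnitsR_iff.trans hc, LQF.coyonedaLocalUnitsR_iff.trans hc⟩
  · have ha := LQF.rightLQFOn_iff (I := I) h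
    have hd := LQF.hasUnitalEndLeft_fgpR_iff A C I hgenR
    have hf := LQF.hasUnitalEndRight_fgpL_iff A C I hgenL
    have he := (LQF.hasUnitalEndLeft_iff I (LQF.fgpR A C) _ _).symm.trans hd
    have hg := (LQF.hasUnitalEndRight_iff I (LQF.fgpL A C) _ _).symm.trans hf
    refine ⟨tfae (∃ σ : I → LQF.BalancedForm A C, LQF.RightUnital σ) ?_,
      fun hl => ?_, fun h' =>
      tfae (∃ σ : I → LQF.BalancedForm A C, LQF.RightUnital σ) ?_⟩
    · simpa only [List.forall_mem_cons, List.not_mem_nil, false_imp_iff, implies_true, and_true]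
        using ⟨ha, hd, he, hf, hg⟩
    · obtain ⟨σ, hσ⟩ := ha.1 hl
      exact hσ.locProj
    · have hc := LQF.traceLocalUnitsL_iff (I := I) h'
      simpa only [List.forall_mem_cons, List.not_mem_nil, false_imp_iff, implies_true, and_true]
        using ⟨ha, LQF.traceUnitalL_iff h' hgenR, hc, hd, he, hf, hg,
          LQF.yonedaLocalUnitsL_iff.trans hc, LQF.coyonedaLocalUnitsL_iff.trans hc⟩
  · refine tfae ((∃ σ : I → LQF.BalancedForm A C, LQF.LeftUnital σ) ∧
      ∃ σ : I → LQF.BalancedForm A C, LQF.RightUnital σ) ?_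
    simpa only [List.forall_mem_cons, List.not_mem_nil, false_imp_iff, implies_true, and_true]
      using ⟨LQF.leftLQFOn_and_rightLQFOn_iff A C I h,
        LQF.isLocallyQuasiFrobeniusPair_fgpR_iff A C I hgenR,
        LQF.isLocallyQuasiFrobeniusPair_fgpL_iff A C I hgenL⟩
  · refine tfae (∃ I : Type u, (∃ σ : I → LQF.BalancedForm A C, LQF.LeftUnital σ) ∧
      ∃ σ : I → LQF.BalancedForm A C, LQF.RightUnital σ) ?_
    simpa only [List.forall_mem_cons, List.not_mem_nil, false_imp_iff, implies_true, and_true]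
      using ⟨(LQF.leftLQF_and_rightLQF_iff A C h).trans
          (exists_congr fun I => LQF.leftLQFOn_and_rightLQFOn_iff A C I h),
        exists_congr fun I => LQF.isLocallyQuasiFrobeniusPair_fgpR_iff A C I hgenR,
        exists_congr fun I => LQF.isLocallyQuasiFrobeniusPair_fgpL_iff A C I hgenL⟩
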